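/- Let $k$ be a field of characteristic zero. Let $W_6$ be the hyperoctahedral group of signed permutations of $6$ coordinates (the Coxeter group of type $B_6$), with Coxeter generating set $S$ consisting of the sign change of the first coordinate and the five transpositions of adjacent coordinates. For $J\subseteq S$ let $X_J$ be the set of minimal length representatives of the left cosets $wW_J$ of $W_J=\langle J\rangle$ in $W_6$, and let $x_J=\sum_{x\in X_J}x\in kW_6$. The descent algebra $\Sigma(W_6)$ is the linear span of the elements $x_J$, $J\subseteq S$, which is a subalgebra of $kW_6$. Let $Q_6$ be the quiver whose vertices are the partitions of the numbers $0,1,\ldots,6$ and whose arrows are the following. (i) For each partition $p$ that is a vertex and all integers $r,s,t\ge 1$ with $s<t$ and $r+s+t+|p|=7$, where $|p|$ is the sum of the parts of $p$, one arrow $[r,[s,t]]$ from $p\cup\{s,t\}$ to $p$ (unions of partitions are unions of multisets of parts). (ii) For all integers $r,s,t\ge 1$ with $s<t$ and $r\le t$ and each partition $q$ with $|q|+r+s+t\le 6$, one arrow $[r,[s,t]]$ from $q\cup\{r,s,t\}$ to $q\cup\{r+s+t\}$. Let $a$ be the arrow $[2,[1,2]]$ of type (ii) from $1122$ to $15$,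 let $b$ be the arrow $[1,[1,2]]$ of type (ii) from $1122$ to $24$, let $c$ be the arrow $[1,[1,5]]$ of type (i) from $15$ to the empty partition, and let $d$ be the arrow $[1,[2,4]]$ of type (i) from $24$ to the empty partition. Let $kQ_6$ be the path algebra, in which $xy$ denotes the path $x$ followed by the path $y$ (and is zero if $x$ does not end where $y$ starts). Then $Q_6$ has $30$ vertices and $28$ arrows, the linear span of the $x_J$ is indeed closed under multiplication, and there is an isomorphism of $k$-algebras $$\Sigma(W_6)\cong kQ_6/(ac-bd),$$ where $(ac-bd)$ is the two-sided ideal generated by $ac-bd$, a linear combination of paths of length two from $1122$ to the empty partition. -/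

import Mathlib

/-! ### Descent algebras -/

namespace DescentAlg

/-- The length of `w` with respect to a family `s` of involutions generating a group `W`. -/
noncomputable def wordLength {W ι : Type*} [Group W] (s : ι → W) (w : W) : ℕ :=
  sInf {m : ℕ | ∃ l : List ι, l.length = m ∧ (l.map s).prod = w}

/-- `X_J`: the elements `w` which have minimal length in their left coset `w W_J`, where
`W_J` is the parabolic subgroup generated by the simple reflections `s j` with `j ∈ J`. -/
def minCosetReps {W ι : Type*} [Group W] (s : ι → W) (J : Set ι) : Set W :=
  {w | ∀ u ∈ Subgroup.closure (s '' J), wordLength s w ≤ wordLength s (w * u)}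

open Classical in
/-- `x_J`, the sum of the elements of `X_J` in the group algebra `kW`. -/
noncomputable def xElem (k : Type*) [CommRing k] {W ι : Type*} [Group W] [Fintype W]
    (s : ι → W) (J : Set ι) : MonoidAlgebra k W :=
  ∑ w : W, if w ∈ minCosetReps s J then MonoidAlgebra.of k W w else 0

/-- The linear span of the elements `x_J` for all `J ⊆ S`. -/
noncomputable def descentSpan (k : Type*) [CommRing k] {W ι : Type*} [Group W] [Fintype W]
    (s : ι → W) : Submodule k (MonoidAlgebra k W) :=
  Submodule.span k (Set.range (xElem k s))

/-- The descent algebra `Σ(W)`, as the subalgebra of `kW` generated by the elements `x_J`.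
That it is no larger than their linear span `descentSpan k s` is a property of Coxeter groups;
for the group at hand this equality is asserted, not assumed. -/
noncomputable def descentAlgebra (k : Type*) [CommRing k] {W ι : Type*} [Group W] [Fintype W]
    (s : ι → W) : Subalgebra k (MonoidAlgebra k W) :=
  Algebra.adjoin k (Set.range (xElem k s))

/-- The hyperoctahedral group `W_n` of signed permutations: the permutations of the `2n` vectors
`± e_i`, with `(i, ε)` standing for `ε e_i`, which commute with negation. -/
def Hyperoctahedral (n : ℕ) : Subgroup (Equiv.Perm (Fin n × ℤˣ)) where
  carrier := {w | ∀ (i : Fin n) (ε : ℤˣ), w (i, -ε) = ((w (i, ε)).1, -(w (i, ε)).2)}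
  one_mem' := by intro i ε; simp
  mul_mem' := by
    intro v w hv hw i ε
    simp only [Equiv.Perm.mul_apply]
    rw [hw i ε, hv]
  inv_mem' := by
    intro w hw i ε
    rw [Equiv.Perm.inv_eq_iff_eq]
    rw [hw]
    simp

noncomputable instance (n : ℕ) : Fintype (Hyperoctahedral n) := Fintype.ofFinite _

/-- The Coxeter generators of `W_n`: the generator of index `0` is the reflection which changes
the sign of the first coordinate, and the generator of index `i > 0` interchanges the
coordinates of index `i - 1` and `i`. -/
def simpleReflection (n : ℕ) (i : Fin n) : Hyperoctahedral n :=
  if i.val = 0 then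
    ⟨Equiv.swap (i, 1) (i, -1), by
      intro j ε
      rcases Int.units_eq_one_or ε with rfl | rfl <;> by_cases h : j = i <;>
        simp [Equiv.swap_apply_def, h]⟩
  else
    ⟨(Equiv.swap ⟨i.val - 1, lt_of_le_of_lt (Nat.sub_le _ _) i.isLt⟩ i).prodCongr
      (Equiv.refl ℤˣ), by intro j ε; simp⟩

end DescentAlg

/-! ### Path algebras -/

/-- The paths of a quiver, each with its source and its destination. -/
abbrev QuiverPath (V : Type*) [Quiver V] : Type _ := Σ u : V, Σ v : V, Quiver.Path u v

/-- The path algebra `kQ`: the vector space with basis the paths of `Q`. -/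
def PathAlgebra (k V : Type*) [CommRing k] [Quiver V] : Type _ := QuiverPath V →₀ k

namespace PathAlgebra

section

variable {k V : Type*} [CommRing k] [Quiver V]

noncomputable instance : AddCommGroup (PathAlgebra k V) :=
  inferInstanceAs (AddCommGroup (QuiverPath V →₀ k))

noncomputable instance : Module k (PathAlgebra k V) :=
  inferInstanceAs (Module k (QuiverPath V →₀ k))

/-- The basis element of `kQ` given by a path. -/
noncomputable def ofPath (k : Type*) {V : Type*} [CommRing k] [Quiver V] (p : QuiverPath V) :
    PathAlgebra k V :=
  Finsupp.single p (1 : k)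

/-- The element of `kQ` given by an arrow. -/
noncomputable def ofArrow (k : Type*) {V : Type*} [CommRing k] [Quiver V] {u v : V}
    (e : u ⟶ v) : PathAlgebra k V :=
  ofPath k ⟨u, v, e.toPath⟩

open Classical in
/-- The product of two paths: `p` followed by `q` if the destination of `p` is the source of `q`,
and zero otherwise. -/
noncomputable def mulPath (k : Type*) {V : Type*} [CommRing k] [Quiver V]
    (p q : QuiverPath V) : PathAlgebra k V :=
  if h : p.2.1 = q.1 then
    ofPath k ⟨p.1, q.2.1, p.2.2.comp (q.2.2.cast h.symm rfl)⟩
  else 0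

/-- The product of paths extended bilinearly. -/
noncomputable def mulHom (k V : Type*) [CommRing k] [Quiver V] :
    PathAlgebra k V →ₗ[k] PathAlgebra k V →ₗ[k] PathAlgebra k V :=
  Finsupp.linearCombination k fun p =>
    (Finsupp.linearCombination k fun q => mulPath k p q :
      (QuiverPath V →₀ k) →ₗ[k] PathAlgebra k V)

noncomputable instance : Mul (PathAlgebra k V) := ⟨fun x y => mulHom k V x y⟩

/-- The unit is the sum of the paths of length zero. -/
noncomputable instance [Fintype V] : One (PathAlgebra k V) :=
  ⟨∑ v : V, ofPath k ⟨v, v, Quiver.Path.nil⟩⟩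

theorem mul_def (x y : PathAlgebra k V) : x * y = mulHom k V x y := rfl

theorem one_def [Fintype V] :
    (1 : PathAlgebra k V) = ∑ v : V, ofPath k ⟨v, v, Quiver.Path.nil⟩ := rfl

theorem ofPath_mul_ofPath (p q : QuiverPath V) :
    (ofPath k p * ofPath k q : PathAlgebra k V) = mulPath k p q := by
  rw [mul_def, mulHom, ofPath, ofPath]
  erw [Finsupp.linearCombination_single, one_smul]
  erw [Finsupp.linearCombination_single, one_smul]

theorem hom_ext {M : Type*} [AddCommGroup M] [Module k M] {f g : PathAlgebra k V →ₗ[k] M}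
    (h : ∀ p, f (ofPath k p) = g (ofPath k p)) : f = g :=
  Finsupp.lhom_ext' fun p => LinearMap.ext_ring (h p)

theorem mulPath_of_comp {u v w : V} (p : Quiver.Path u v) (q : Quiver.Path v w) :
    mulPath k ⟨u, v, p⟩ ⟨v, w, q⟩ = ofPath k ⟨u, w, p.comp q⟩ := by
  simp [mulPath]

theorem mulPath_of_ne {p q : QuiverPath V} (h : p.2.1 ≠ q.1) : mulPath k p q = 0 := by
  simp [mulPath, h]

theorem mulPath_assoc (p q r : QuiverPath V) :
    mulHom k V (mulPath k p q) (ofPath k r) = mulHom k V (ofPath k p) (mulPath k q r) := by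
  obtain ⟨a, b, p⟩ := p
  obtain ⟨c, d, q⟩ := q
  obtain ⟨e, f, r⟩ := r
  by_cases h₁ : b = c
  · subst h₁
    by_cases h₂ : d = e
    · subst h₂
      rw [mulPath_of_comp, mulPath_of_comp, ← mul_def, ← mul_def, ofPath_mul_ofPath,
        ofPath_mul_ofPath, mulPath_of_comp, mulPath_of_comp, Quiver.Path.comp_assoc]
    · rw [mulPath_of_comp, mulPath_of_ne (p := ⟨b, d, q⟩) (q := ⟨e, f, r⟩) h₂, ← mul_def,
        ofPath_mul_ofPath, mulPath_of_ne (by exact h₂), map_zero]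
  · rw [mulPath_of_ne (p := ⟨a, b, p⟩) (q := ⟨c, d, q⟩) h₁, map_zero, LinearMap.zero_apply]
    by_cases h₂ : d = e
    · subst h₂
      rw [mulPath_of_comp, ← mul_def, ofPath_mul_ofPath, mulPath_of_ne (by exact h₁)]
    · rw [mulPath_of_ne (p := ⟨c, d, q⟩) (q := ⟨e, f, r⟩) h₂, map_zero]

protected theorem mul_assoc (x y z : PathAlgebra k V) : x * y * z = x * (y * z) := by
  have h3 (p q : QuiverPath V) : mulHom k V (mulPath k p q) =
      (mulHom k V (ofPath k p)).comp (mulHom k V (ofPath k q)) :=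
    hom_ext fun r => by
      rw [LinearMap.comp_apply, ← mul_def (ofPath k q), ofPath_mul_ofPath, mulPath_assoc]
  have h2 (p : QuiverPath V) : (mulHom k V).comp (mulHom k V (ofPath k p)) =
      (LinearMap.llcomp k _ _ _ (mulHom k V (ofPath k p))).comp (mulHom k V) :=
    hom_ext fun q => by
      rw [LinearMap.comp_apply, ← mul_def, ofPath_mul_ofPath, h3]
      rfl
  have h1 : LinearMap.flip ((LinearMap.compr₂ (mulHom k V) (mulHom k V)).flip y) z =
      (mulHom k V).flip (mulHom k V y z) :=
    hom_ext fun p => LinearMap.congr_fun (LinearMap.congr_fun (h2 p) y) z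
  exact LinearMap.congr_fun h1 x

protected theorem one_mul [Fintype V] (x : PathAlgebra k V) : 1 * x = x := by
  have h : mulHom k V 1 = LinearMap.id := hom_ext fun p => by
    obtain ⟨a, b, p⟩ := p
    rw [one_def, map_sum, LinearMap.sum_apply, Finset.sum_eq_single a]
    · rw [← mul_def, ofPath_mul_ofPath, mulPath_of_comp, Quiver.Path.nil_comp]; rfl
    · intro c _ hc
      rw [← mul_def, ofPath_mul_ofPath, mulPath_of_ne (by exact hc)]
    · simp
  exact LinearMap.congr_fun h x

protected theorem mul_one [Fintype V] (x : PathAlgebra k V) : x * 1 = x := by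
  have h : (mulHom k V).flip 1 = LinearMap.id := hom_ext fun p => by
    obtain ⟨a, b, p⟩ := p
    rw [LinearMap.flip_apply, one_def, map_sum, Finset.sum_eq_single b]
    · rw [← mul_def, ofPath_mul_ofPath, mulPath_of_comp, Quiver.Path.comp_nil]; rfl
    · intro c _ hc
      rw [← mul_def, ofPath_mul_ofPath, mulPath_of_ne (by exact hc.symm)]
    · simp
  exact LinearMap.congr_fun h x

noncomputable instance [Fintype V] : Ring (PathAlgebra k V) :=
  { (inferInstance : AddCommGroup (PathAlgebra k V)) with
    mul := (· * ·)
    one := 1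
    left_distrib := fun x y z => map_add (mulHom k V x) y z
    right_distrib := fun x y z => LinearMap.map_add₂ (mulHom k V) x y z
    zero_mul := fun x => LinearMap.map_zero₂ (mulHom k V) x
    mul_zero := fun x => map_zero (mulHom k V x)
    mul_assoc := PathAlgebra.mul_assoc
    one_mul := PathAlgebra.one_mul
    mul_one := PathAlgebra.mul_one }

noncomputable instance [Fintype V] : Algebra k (PathAlgebra k V) :=
  Algebra.ofModule (fun r x y => LinearMap.map_smul₂ (mulHom k V) r x y)
    (fun r x y => map_smul (mulHom k V x) r y)

end

end PathAlgebra

/-! ### The quiver -/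

namespace DescentAlg

/-- The vertices of `Q_n`: the partitions of the numbers `0, 1, …, n`. The partition with parts
`q_1, …, q_j` stands for the orbit of the forest of leaves `q_0 q_1 ⋯ q_j` of value `n + 1`. -/
def QVertex (n : ℕ) : Type := Σ m : Fin (n + 1), Nat.Partition m.val

noncomputable instance (n : ℕ) : Fintype (QVertex n) :=
  inferInstanceAs (Fintype (Σ m : Fin (n + 1), Nat.Partition m.val))

/-- The parts of the partition `u`. -/
def QVertex.parts {n : ℕ} (u : QVertex n) : Multiset ℕ := u.2.parts

/-- The vertex with a given multiset of parts. -/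
def QVertex.mk {n : ℕ} (q : Multiset ℕ) (hpos : ∀ {i}, i ∈ q → 0 < i) (hsum : q.sum ≤ n) :
    QVertex n :=
  ⟨⟨q.sum, Nat.lt_succ_of_le hsum⟩, ⟨q, hpos, rfl⟩⟩

/-- The arrows of `Q_n` from `u` to `v`. They stand for the orbits of forests of value `n + 1` of
the following two shapes. The labels of the two inner nodes are `1` (root) and `2`.

* `[a, [b, c]] q_1 ⋯ q_j` with `b < c`, whose tree of positive length is the first tree;
* `q_0 [a, [b, c]] q_1 ⋯ q_j` with `b < c` and `a ≤ c`, whose tree of positive length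
  is not the first tree.

The destination of an arrow is its squash (the values of its trees), and its source is its
foliage (its leaves), in both cases without the first entry and up to order. -/
inductive QArrow (n : ℕ) (u v : QVertex n) : Type
  | first (a b c : ℕ) (ha : 0 < a) (hb : 0 < b) (hbc : b < c)
      (hvalue : a + b + c + v.parts.sum = n + 1)
      (hsource : u.parts = b ::ₘ c ::ₘ v.parts) : QArrow n u v
  | other (a b c : ℕ) (q : Multiset ℕ) (ha : 0 < a) (hb : 0 < b) (hbc : b < c) (hac : a ≤ c)
      (hdestination : v.parts = (a + b + c) ::ₘ q)
      (hsource : u.parts = a ::ₘ b ::ₘ c ::ₘ q) : QArrow n u v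

instance (n : ℕ) : Quiver (QVertex n) := ⟨QArrow n⟩

/-- The vertex `1122` of `Q_6`. -/
def v1122 : QVertex 6 := QVertex.mk {1, 1, 2, 2} (by simp) (by decide)

/-- The vertex `15` of `Q_6`. -/
def v15 : QVertex 6 := QVertex.mk {1, 5} (by simp) (by decide)

/-- The vertex `24` of `Q_6`. -/
def v24 : QVertex 6 := QVertex.mk {2, 4} (by simp) (by decide)

/-- The vertex of `Q_6` given by the empty partition. -/
def vEmpty : QVertex 6 := QVertex.mk 0 (by simp) (by decide)

/-- The arrow `a`, the orbit of the forest `1 [2, [1, 2]] 1`. -/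
def arrowA : v1122 ⟶ v15 :=
  QArrow.other 2 1 2 {1} (by decide) (by decide) (by decide) (by decide) (by decide) (by decide)

/-- The arrow `b`, the orbit of the forest `1 [1, [1, 2]] 2`. -/
def arrowB : v1122 ⟶ v24 :=
  QArrow.other 1 1 2 {2} (by decide) (by decide) (by decide) (by decide) (by decide) (by decide)

/-- The arrow `c`, the orbit of the forest `[1, [1, 5]]`. -/
def arrowC : v15 ⟶ vEmpty :=
  QArrow.first 1 1 5 (by decide) (by decide) (by decide) (by decide) (by decide)

/-- The arrow `d`, the orbit of the forest `[1, [2, 4]]`. -/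
def arrowD : v24 ⟶ vEmpty :=
  QArrow.first 1 2 4 (by decide) (by decide) (by decide) (by decide) (by decide)

/-- The element `ac - bd` of `kQ_6`. -/
noncomputable def relationQ6 (k : Type*) [CommRing k] : PathAlgebra k (QVertex 6) :=
  PathAlgebra.ofArrow k arrowA * PathAlgebra.ofArrow k arrowC -
    PathAlgebra.ofArrow k arrowB * PathAlgebra.ofArrow k arrowD

end DescentAlg

/-!
The isomorphism comes from two commuting actions on words. The words are those in letters which
are positive integers, within the algebra of noncommutative polynomials, and `T` is the span of the
words of weight (the sum of the letters) at most `n`. A face of the Coxeter complex is encoded by a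
map `f` from letters to integers with `|f| ≤ n`; it acts on a word by collecting the letters into
blocks according to their labels, the letters with negative labels being reversed and put in front
of those with the opposite label (`arr`). For `n` letters of weight one, `x_J` is the sum of the
faces of type `J` (`xElem_eq`). The composition of two faces is a face again, and the number of ways
in which a face of type `I` arises from faces of types `J` and `K` does not depend on the word
(`sum_faces_faces`). This shows that the span of the `x_J` is closed under multiplication
(`xElem_mul_xElem`), and that `x_J ↦ faceOp J`, the sum of all faces of type `J` acting on `T`, is
an anti-homomorphism (`faceOp_faceOp`). It is
faithful because `exists_coeff_faceOp_ne_zero` gives a triangular matrix of coefficients.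

The operators `faceOp J` commute with the left multiplication by a commutator `[b, c]` of letters,
where opposite labels cancel (`faceOp_lie_mul`), and with the substitution of `[a, [b, c]]` for a
letter `a + b + c` which occurs once, since `[a, [b, c]]` is invariant under the reversal of words
(`faceOp_lie3`). For `n = 6` these are the actions of the two kinds of arrows, so that the path
algebra acts on `T` (`rep`), and the relation `ac - bd` acts as zero by the Jacobi identity
(`rep_relationQ6`).

The sum `v` of the sorted words, one for each vertex, generates `T` under the path algebra: by
induction on the length, interchanging neighbouring letters of a word changes it by an element of
the orbit of `v` (`sub_mem_of_perm`, `range_orbitMap`). There are at most `65` paths, while `T` has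
dimension `64`, the number of words and the dimension of the descent algebra; hence the annihilator
of `v` is spanned by `ac - bd` (`ker_orbitMap`). Finally, an element `s` of the descent algebra is
sent to the class of the elements `x` of the path algebra with `x v = s v`. This is multiplicative
because the two actions commute and the descent algebra acts from the right, and bijective by the
equality of the dimensions.
-/

/-! ### Signed letters and the rearrangement of a list by a face -/

namespace DescentAlg

/-- The signed letters `± e_i`; the pair `(i, ε)` stands for `ε e_i`. -/
abbrev SignedLetter (r : ℕ) : Type := Fin r × ℤˣ

/-- The negative of a signed letter. -/
def bar {r : ℕ} (e : SignedLetter r) : SignedLetter r := (e.1, -e.2)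

@[simp] theorem bar_bar {r : ℕ} (e : SignedLetter r) : bar (bar e) = e := by
  simp [bar]

/-- The extension of a function on the letters to an odd function on the signed letters. -/
def oddExt {r : ℕ} (f : Fin r → ℤ) (e : SignedLetter r) : ℤ := (e.2 : ℤ) * f e.1

@[simp] theorem oddExt_bar {r : ℕ} (f : Fin r → ℤ) (e : SignedLetter r) :
    oddExt f (bar e) = -oddExt f e := by
  simp [oddExt, bar]

@[simp] theorem oddExt_one {r : ℕ} (f : Fin r → ℤ) (i : Fin r) : oddExt f (i, 1) = f i := by
  simp [oddExt]

@[simp] theorem oddExt_neg_one {r : ℕ} (f : Fin r → ℤ) (i : Fin r) :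
    oddExt f (i, -1) = -f i := by
  simp [oddExt]

theorem abs_oddExt {r : ℕ} (f : Fin r → ℤ) (e : SignedLetter r) : |oddExt f e| = |f e.1| := by
  obtain ⟨i, ε⟩ := e
  rcases Int.units_eq_one_or ε with rfl | rfl <;> simp

/-- The standard total order `-r < ⋯ < -1 < 1 < ⋯ < r` of the signed letters. -/
def val {r : ℕ} : SignedLetter r → ℤ := oddExt fun i => (i : ℤ) + 1

@[simp] theorem val_one {r : ℕ} (i : Fin r) : val (i, 1) = (i : ℤ) + 1 := by simp [val]

@[simp] theorem val_neg_one {r : ℕ} (i : Fin r) : val (i, -1) = -((i : ℤ) + 1) := by simp [val]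

@[simp] theorem val_bar {r : ℕ} (e : SignedLetter r) : val (bar e) = -val e := by simp [val]

theorem val_ne_zero {r : ℕ} (e : SignedLetter r) : val e ≠ 0 := by
  obtain ⟨i, ε⟩ := e
  rcases Int.units_eq_one_or ε with rfl | rfl <;> simp <;> omega

theorem val_injective {r : ℕ} : Function.Injective (val (r := r)) := by
  rintro ⟨i, ε⟩ ⟨j, δ⟩ h
  rcases Int.units_eq_one_or ε with rfl | rfl <;> rcases Int.units_eq_one_or δ with rfl | rfl <;>
    simp at h <;> simp [Fin.ext_iff] <;> omega

/-- The action of the face with labels `g` on a list: the entries with label `0` come first, then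
for each `m = 1, …, n` the block formed by the entries with label `-m`, reversed and with `ν`
applied to each of them, and the entries with label `m`. Within a block the entries keep the order
they have in the list. -/
def arr {α : Type*} (n : ℕ) (ν : α → α) (g : α → ℤ) (L : List α) : List α :=
  L.filter (fun e => g e = 0) ++ (List.range n).flatMap fun (m : ℕ) =>
    ((L.filter (fun e => g e = -((m : ℤ) + 1))).map ν).reverse ++
      L.filter (fun e => g e = (m : ℤ) + 1)

theorem arr_map {α β : Type*} (n : ℕ) (ν : α → α) (ν' : β → β) (φ : α → β)
    (hν : ∀ a, φ (ν a) = ν' (φ a)) (g : β → ℤ) (L : List α) :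
    arr n ν' g (L.map φ) = (arr n ν (fun a => g (φ a)) L).map φ := by
  simp [arr, List.filter_map, List.map_flatMap, Function.comp_def, hν]

/-- `L` is the list of the signed letters which are positive for `κ`, in increasing order. -/
structure IsChamber {r : ℕ} {K : Type*} [LT K] [Zero K] (κ : SignedLetter r → K)
    (L : List (SignedLetter r)) : Prop where
  sorted : L.Pairwise fun e e' => κ e < κ e'
  mem_iff : ∀ e, e ∈ L ↔ 0 < κ e

theorem IsChamber.unique {r : ℕ} {K : Type*} [Preorder K] [Zero K] {κ : SignedLetter r → K}
    {L L' : List (SignedLetter r)} (h : IsChamber κ L) (h' : IsChamber κ L') : L = L' := by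
  have : Std.Irrefl fun e e' : SignedLetter r => κ e < κ e' := ⟨fun _ => lt_irrefl _⟩
  have : Std.Asymm fun e e' : SignedLetter r => κ e < κ e' := ⟨fun _ _ => lt_asymm⟩
  exact h.sorted.eq_of_mem_iff h'.sorted fun e => by rw [h.mem_iff, h'.mem_iff]

theorem IsChamber.congr {r : ℕ} {K K' : Type*} [LT K] [Zero K] [LT K'] [Zero K']
    {κ : SignedLetter r → K} {κ' : SignedLetter r → K'}
    {L : List (SignedLetter r)} (h : IsChamber κ L) (hlt : ∀ e e', κ e < κ e' ↔ κ' e < κ' e')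
    (hpos : ∀ e, 0 < κ e ↔ 0 < κ' e) : IsChamber κ' L :=
  ⟨h.sorted.imp fun {e e'} => (hlt e e').1, fun e => by rw [h.mem_iff, hpos]⟩

/-- The order in which the labels `g` are compared first, and ties are broken by `κ`. -/
def lexKey {r : ℕ} {K : Type*} (g : SignedLetter r → ℤ) (κ : SignedLetter r → K)
    (e : SignedLetter r) : ℤ ×ₗ K := toLex (g e, κ e)

theorem lexKey_lt {r : ℕ} {K : Type*} [LT K] (g : SignedLetter r → ℤ) (κ : SignedLetter r → K)
    (e e' : SignedLetter r) :
    lexKey g κ e < lexKey g κ e' ↔ g e < g e' ∨ g e = g e' ∧ κ e < κ e' :=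
  Prod.Lex.toLex_lt_toLex

theorem lexKey_pos {r : ℕ} {K : Type*} [LT K] [Zero K] (g : SignedLetter r → ℤ)
    (κ : SignedLetter r → K) (e : SignedLetter r) :
    0 < lexKey g κ e ↔ 0 < g e ∨ g e = 0 ∧ 0 < κ e := by
  rw [eq_comm (a := g e)]
  exact Prod.Lex.toLex_lt_toLex (x := ((0 : ℤ), (0 : K)))

/-- Acting with a face on a chamber refines the order of the chamber lexicographically, with the
labels of the face as the primary key. -/
theorem IsChamber.arr {r : ℕ} {K : Type*} [AddCommGroup K] [LinearOrder K] [IsOrderedAddMonoid K]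
    {κ : SignedLetter r → K} {L : List (SignedLetter r)} (h : IsChamber κ L)
    (hκ : ∀ e, κ (bar e) = -κ e) (hκ0 : ∀ e, κ e ≠ 0) {n : ℕ} {g : SignedLetter r → ℤ}
    (hg : ∀ e, g (bar e) = -g e) (hgn : ∀ e, g e ≤ n) :
    IsChamber (lexKey g κ) (arr n bar g L) := by
  have mem_flip (m : ℕ) (e : SignedLetter r) :
      e ∈ ((L.filter (fun e => g e = -((m : ℤ) + 1))).map bar).reverse ↔
        bar e ∈ L ∧ g e = (m : ℤ) + 1 := by
    simp only [List.mem_reverse, List.mem_map, List.mem_filter, decide_eq_true_eq]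
    constructor
    · rintro ⟨a, ⟨ha, ha'⟩, rfl⟩
      exact ⟨by simpa using ha, by rw [hg, ha']; ring⟩
    · rintro ⟨h1, h2⟩
      exact ⟨bar e, ⟨h1, by rw [hg, h2]⟩, bar_bar e⟩
  have mem_block (m : ℕ) (e : SignedLetter r) :
      e ∈ ((L.filter (fun e => g e = -((m : ℤ) + 1))).map bar).reverse ++
        L.filter (fun e => g e = (m : ℤ) + 1) ↔ (bar e ∈ L ∨ e ∈ L) ∧ g e = (m : ℤ) + 1 := by
    rw [List.mem_append, mem_flip]
    simp only [List.mem_filter, decide_eq_true_eq]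
    tauto
  constructor
  · rw [DescentAlg.arr, List.pairwise_append]
    refine ⟨?_, ?_, ?_⟩
    · rw [List.pairwise_filter]
      refine h.sorted.imp fun {a b} hab ha hb => ?_
      simp only [decide_eq_true_eq] at ha hb
      rw [lexKey_lt]
      exact Or.inr ⟨by rw [ha, hb], hab⟩
    · rw [List.pairwise_flatMap]
      constructor
      · intro m _
        rw [List.pairwise_append]
        refine ⟨?_, ?_, ?_⟩
        · rw [List.pairwise_reverse, List.pairwise_map, List.pairwise_filter]
          refine h.sorted.imp fun {a b} hab ha hb => ?_
          simp only [decide_eq_true_eq] at ha hb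
          rw [lexKey_lt]
          exact Or.inr ⟨by rw [hg, hg, ha, hb], by rw [hκ, hκ]; exact neg_lt_neg hab⟩
        · rw [List.pairwise_filter]
          refine h.sorted.imp fun {a b} hab ha hb => ?_
          simp only [decide_eq_true_eq] at ha hb
          rw [lexKey_lt]
          exact Or.inr ⟨by rw [ha, hb], hab⟩
        · intro a ha b hb
          rw [mem_flip] at ha
          simp only [List.mem_filter, decide_eq_true_eq] at hb
          rw [lexKey_lt]
          refine Or.inr ⟨by rw [ha.2, hb.2], lt_trans (b := 0) ?_ ((h.mem_iff b).1 hb.1)⟩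
          have := (h.mem_iff _).1 ha.1
          rw [hκ] at this
          exact neg_pos.1 this
      · refine List.pairwise_lt_range.imp fun {m m'} hmm a ha b hb => ?_
        rw [mem_block] at ha hb
        rw [lexKey_lt]
        left
        rw [ha.2, hb.2]
        omega
    · intro a ha b hb
      simp only [List.mem_filter, decide_eq_true_eq] at ha
      rw [List.mem_flatMap] at hb
      obtain ⟨m, _, hb⟩ := hb
      rw [mem_block] at hb
      rw [lexKey_lt]
      left
      rw [ha.2, hb.2]
      omega
  · intro e
    rw [lexKey_pos, DescentAlg.arr, List.mem_append, List.mem_flatMap]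
    simp only [mem_block, List.mem_filter, decide_eq_true_eq, List.mem_range, h.mem_iff, hκ]
    have hd : 0 < -κ e ∨ 0 < κ e := by
      rcases lt_or_gt_of_ne (hκ0 e) with h | h
      · exact Or.inl (neg_pos.2 h)
      · exact Or.inr h
    have := hgn e
    constructor
    · rintro (⟨h1, h2⟩ | ⟨m, _, _, h2⟩)
      · exact Or.inr ⟨h2, h1⟩
      · exact Or.inl (by omega)
    · rintro (h1 | ⟨h1, h2⟩)
      · exact Or.inr ⟨(g e - 1).toNat, by omega, hd, by omega⟩
      · exact Or.inl ⟨h2, h1⟩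

/-- The positive signed letters in the standard order. -/
def stdList (r : ℕ) : List (SignedLetter r) := (List.finRange r).map fun i => (i, 1)

theorem isChamber_stdList (r : ℕ) : IsChamber val (stdList r) := by
  constructor
  · rw [stdList, List.pairwise_map]
    refine (List.pairwise_lt_finRange r).imp fun {i j} hij => ?_
    simpa using hij
  · rintro ⟨i, ε⟩
    rcases Int.units_eq_one_or ε with rfl | rfl
    · simp [stdList]
    · simp [stdList, val_neg_one]

end DescentAlg

/-! ### Faces of type `J` and their products -/

namespace DescentAlg

/-- The labels `g` on letters of weights `wt` form a face of type `J ⊆ {0, …, n-1}`. The blocks of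
such a face start at the positions `i ∉ J`, and the block starting at position `i` carries the
labels `± (i + 1)`; the letters labelled `0`, together with a phantom of weight `n - ∑ wt`, fill
the positions before the first block. -/
structure IsFace {n : ℕ} (J : Set (Fin n)) {r : ℕ} (wt : Fin r → ℕ) (g : Fin r → ℤ) : Prop where
  label : ∀ l, g l ≠ 0 → ∃ i : Fin n, i ∉ J ∧ |g l| = (i : ℤ) + 1
  tail : ∀ i : Fin n, i ∉ J → (∑ l, if (i : ℤ) + 1 ≤ |g l| then wt l else 0) + i = n

section

variable {n : ℕ} {I J : Set (Fin n)} {r r' : ℕ} {wt : Fin r → ℕ} {wt' : Fin r' → ℕ}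
  {G g : Fin r → ℤ} {G' : Fin r' → ℤ}

theorem IsFace.abs_le (hg : IsFace J wt g) (l : Fin r) : |g l| ≤ n := by
  by_cases h : g l = 0
  · simp [h]
  · obtain ⟨i, _, hi⟩ := hg.label l h
    rw [hi]
    omega

theorem IsFace.tail_eq (hG : IsFace I wt G) (hG' : IsFace I wt' G') (m : ℕ) :
    (∑ l, if (m : ℤ) + 1 ≤ |G l| then wt l else 0) =
      ∑ l, if (m : ℤ) + 1 ≤ |G' l| then wt' l else 0 := by
  by_cases hm : n ≤ m
  · rw [Finset.sum_eq_zero, Finset.sum_eq_zero]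
    · intro l _
      have := hG'.abs_le l
      exact if_neg (by omega)
    · intro l _
      have := hG.abs_le l
      exact if_neg (by omega)
  · have key : ∀ {r : ℕ} {wt : Fin r → ℕ} {G : Fin r → ℤ}, IsFace I wt G →
        (⟨m, by omega⟩ : Fin n) ∈ I → (∑ l, if (m : ℤ) + 1 ≤ |G l| then wt l else 0) =
          ∑ l, if ((m + 1 : ℕ) : ℤ) + 1 ≤ |G l| then wt l else 0 := by
      intro r wt G hG hI
      refine Finset.sum_congr rfl fun l _ => if_congr ?_ rfl rfl
      push_cast
      refine ⟨fun h => ?_, fun h => by omega⟩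
      by_contra h'
      have h0 : G l ≠ 0 := by rintro h0; simp [h0] at h; omega
      obtain ⟨i, hi, hl⟩ := hG.label l h0
      have : i = ⟨m, by omega⟩ := by ext; simp; omega
      exact hi (this ▸ hI)
    by_cases hI : (⟨m, by omega⟩ : Fin n) ∈ I
    · rw [key hG hI, key hG' hI]
      exact IsFace.tail_eq hG hG' (m + 1)
    · have h1 := hG.tail _ hI
      have h2 := hG'.tail _ hI
      simp only at h1 h2
      omega
termination_by n - m

theorem IsFace.cell_eq (hG : IsFace I wt G) (hG' : IsFace I wt' G') (m : ℕ) :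
    (∑ l, if |G l| = (m : ℤ) + 1 then wt l else 0) =
      ∑ l, if |G' l| = (m : ℤ) + 1 then wt' l else 0 := by
  have key : ∀ {r : ℕ} (wt : Fin r → ℕ) (G : Fin r → ℤ),
      (∑ l, if (m : ℤ) + 1 ≤ |G l| then wt l else 0) =
        (∑ l, if |G l| = (m : ℤ) + 1 then wt l else 0) +
          ∑ l, if ((m + 1 : ℕ) : ℤ) + 1 ≤ |G l| then wt l else 0 := by
    intro r wt G
    rw [← Finset.sum_add_distrib]
    refine Finset.sum_congr rfl fun l _ => ?_
    push_cast
    split_ifs <;> omega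
  have h1 := key wt G
  have h2 := key wt' G'
  have h3 := hG.tail_eq hG' m
  have h4 := hG.tail_eq hG' (m + 1)
  omega

/-- The weights of the blocks of a face are determined by its type. -/
theorem IsFace.sum_eq (hG : IsFace I wt G) (hG' : IsFace I wt' G') (q : ℤ → Prop)
    [DecidablePred q] (hq : ¬ q 0) :
    (∑ l, if q |G l| then wt l else 0) = ∑ l, if q |G' l| then wt' l else 0 := by
  have key : ∀ {r : ℕ} {wt : Fin r → ℕ} {G : Fin r → ℤ}, IsFace I wt G →
      (∑ l, if q |G l| then wt l else 0) =
        ∑ m : Fin n, if q ((m : ℤ) + 1) then ∑ l, (if |G l| = (m : ℤ) + 1 then wt l else 0)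
          else 0 := by
    intro r wt G hG
    have : ∀ m : Fin n,
        (if q ((m : ℤ) + 1) then ∑ l, (if |G l| = (m : ℤ) + 1 then wt l else 0) else 0) =
          ∑ l, if |G l| = (m : ℤ) + 1 then (if q ((m : ℤ) + 1) then wt l else 0) else 0 := by
      intro m
      split_ifs <;> simp
    rw [Finset.sum_congr rfl fun m _ => this m, Finset.sum_comm]
    refine Finset.sum_congr rfl fun l _ => ?_
    by_cases h0 : G l = 0
    · rw [if_neg (by simpa [h0] using hq), Finset.sum_eq_zero]
      intro m _
      exact if_neg (by simp [h0]; omega)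
    · obtain ⟨i, _, hi⟩ := hG.label l h0
      rw [Finset.sum_eq_single i]
      · simp [hi]
      · intro m _ hm
        refine if_neg fun h => hm ?_
        ext
        omega
      · simp
  rw [key hG, key hG']
  exact Finset.sum_congr rfl fun m _ => if_congr Iff.rfl (hG.cell_eq hG' m) rfl

open Classical in
/-- The standard face of type `J` on `n` letters of weight one: the label of a letter tells where
its block starts. -/
noncomputable def stdFace (J : Set (Fin n)) (p : Fin n) : ℤ :=
  ((Finset.univ.filter fun i : Fin n => i ≤ p ∧ i ∉ J).sup fun i => i.val + 1 : ℕ)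

theorem stdFace_nonneg (J : Set (Fin n)) (p : Fin n) : 0 ≤ stdFace J p := by
  simp [stdFace]

theorem stdFace_mono (J : Set (Fin n)) : Monotone (stdFace J) := by
  intro p q h
  rw [stdFace, stdFace, Nat.cast_le]
  refine Finset.sup_mono fun i hi => ?_
  simp only [Finset.mem_filter, Finset.mem_univ, true_and] at hi ⊢
  exact ⟨hi.1.trans h, hi.2⟩

theorem stdFace_cases (J : Set (Fin n)) (p : Fin n) :
    stdFace J p = 0 ∨ ∃ i : Fin n, i ∉ J ∧ i ≤ p ∧ stdFace J p = (i : ℤ) + 1 := by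
  classical
  by_cases h : (Finset.univ.filter fun i : Fin n => i ≤ p ∧ i ∉ J).Nonempty
  · obtain ⟨i, hi, hs⟩ := Finset.exists_mem_eq_sup _ h fun i => i.val + 1
    simp only [Finset.mem_filter, Finset.mem_univ, true_and] at hi
    refine Or.inr ⟨i, hi.2, hi.1, ?_⟩
    rw [stdFace]
    convert congrArg (Nat.cast : ℕ → ℤ) hs using 1
    simp
  · rw [Finset.not_nonempty_iff_eq_empty] at h
    left
    rw [stdFace, Nat.cast_eq_zero]
    refine Nat.le_zero.1 (Finset.sup_le fun i hi => ?_)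
    exact absurd (by convert hi) (Finset.eq_empty_iff_forall_notMem.1 h i)

theorem le_stdFace {i p : Fin n} (hi : i ∉ J) : (i : ℤ) + 1 ≤ stdFace J p ↔ i ≤ p := by
  classical
  constructor
  · intro h
    rcases stdFace_cases J p with h0 | ⟨j, _, hj, h0⟩
    · omega
    · exact le_trans (Fin.le_def.2 (by omega)) hj
  · intro h
    rw [stdFace]
    exact_mod_cast Finset.le_sup (f := fun i : Fin n => i.val + 1) (by simp [h, hi])

theorem stdFace_self {i : Fin n} (hi : i ∉ J) : stdFace J i = (i : ℤ) + 1 := by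
  refine le_antisymm ?_ ((le_stdFace hi).2 le_rfl)
  rcases stdFace_cases J i with h0 | ⟨j, _, hj, h0⟩ <;> rw [h0]
  · omega
  · have := Fin.le_def.1 hj
    omega

theorem isFace_stdFace (J : Set (Fin n)) : IsFace J (fun _ => 1) (stdFace J) := by
  constructor
  · intro p h
    rw [abs_of_nonneg (stdFace_nonneg J p)]
    rcases stdFace_cases J p with h0 | ⟨i, hi, _, h0⟩
    · exact absurd h0 h
    · exact ⟨i, hi, h0⟩
  · intro i hi
    have : (∑ l, if (i : ℤ) + 1 ≤ |stdFace J l| then 1 else 0) =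
        ∑ l, if l ∈ Finset.Ici i then 1 else 0 := by
      refine Finset.sum_congr rfl fun l _ => if_congr ?_ rfl rfl
      rw [abs_of_nonneg (stdFace_nonneg J l), le_stdFace hi, Finset.mem_Ici]
    rw [this]
    simp only [Finset.sum_ite_mem, Finset.univ_inter, Finset.sum_const, smul_eq_mul, mul_one,
      Fin.card_Ici]
    omega

theorem IsFace.exists_label (hG : IsFace I wt G) {i : Fin n} (hi : i ∉ I) :
    ∃ l, |G l| = (i : ℤ) + 1 := by
  by_contra! h
  have h1 := hG.cell_eq (isFace_stdFace I) i
  rw [Finset.sum_eq_zero fun l _ => if_neg (h l), eq_comm, Finset.sum_eq_zero_iff] at h1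
  have h2 := h1 i (Finset.mem_univ i)
  rw [stdFace_self hi, abs_of_nonneg (by omega)] at h2
  simp at h2

open Classical in
/-- The faces of type `J` on letters of weights `wt`. -/
noncomputable def faces (J : Set (Fin n)) (wt : Fin r → ℕ) : Finset (Fin r → ℤ) :=
  (Fintype.piFinset fun _ => Finset.Icc (-(n : ℤ)) n).filter (IsFace J wt)

@[simp] theorem mem_faces : g ∈ faces J wt ↔ IsFace J wt g := by
  classical
  rw [faces, Finset.mem_filter, Fintype.mem_piFinset, and_iff_right_iff_imp]
  intro h l
  rw [Finset.mem_Icc, ← abs_le]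
  exact h.abs_le l

end

/-! ### The product theorem -/

section

variable {n : ℕ} {r r' : ℕ}

/-- The odd function on the integers which sends `i + 1` to `θ i`. -/
def extLabel (θ : Fin n → ℤ ×ₗ ℤ) (v : ℤ) : ℤ ×ₗ ℤ :=
  if h : v.natAbs - 1 < n then v.sign • θ ⟨v.natAbs - 1, h⟩ else 0

theorem extLabel_zero (θ : Fin n → ℤ ×ₗ ℤ) : extLabel θ 0 = 0 := by
  simp [extLabel]

theorem extLabel_neg (θ : Fin n → ℤ ×ₗ ℤ) (v : ℤ) : extLabel θ (-v) = -extLabel θ v := by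
  simp only [extLabel, Int.natAbs_neg, Int.sign_neg]
  split_ifs <;> simp

theorem extLabel_succ (θ : Fin n → ℤ ×ₗ ℤ) (i : Fin n) : extLabel θ ((i : ℤ) + 1) = θ i := by
  have h1 : ((i : ℤ) + 1).natAbs - 1 = i := by omega
  have h2 : ((i : ℤ) + 1).sign = 1 := Int.sign_eq_one_of_pos (by omega)
  rw [extLabel, dif_pos (by rw [h1]; exact i.2), h2, one_smul]
  congr 1

theorem abs_extLabel (θ : Fin n → ℤ ×ₗ ℤ) (v : ℤ) : |extLabel θ (|v|)| = |extLabel θ v| := by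
  rcases abs_choice v with h | h <;> rw [h]
  rw [extLabel_neg, abs_neg]

/-- A pair of labels encoded by `F` is a face of type `J` and a face of type `K`. -/
structure IsFacePair (J K : Set (Fin n)) (wt : Fin r → ℕ) (F : Fin r → ℤ ×ₗ ℤ) : Prop where
  fst : IsFace J wt fun l => (ofLex (F l)).1
  snd : IsFace K wt fun l => (ofLex (F l)).2

/-- `θ` relabels the blocks of a face of type `I` by positive labels, preserving their order. -/
structure IsRelabelling (I : Set (Fin n)) (θ : Fin n → ℤ ×ₗ ℤ) : Prop where
  eq_zero : ∀ i ∈ I, θ i = 0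
  pos : ∀ i ∉ I, 0 < θ i
  lt : ∀ i ∉ I, ∀ j ∉ I, i < j → θ i < θ j

theorem extLabel_fst_abs (θ : Fin n → ℤ ×ₗ ℤ) (v : ℤ) :
    |(ofLex (extLabel θ (|v|))).1| = |(ofLex (extLabel θ v)).1| := by
  rcases abs_choice v with h | h <;> rw [h]
  rw [extLabel_neg, ofLex_neg, Prod.fst_neg, abs_neg]

theorem extLabel_snd_abs (θ : Fin n → ℤ ×ₗ ℤ) (v : ℤ) :
    |(ofLex (extLabel θ (|v|))).2| = |(ofLex (extLabel θ v)).2| := by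
  rcases abs_choice v with h | h <;> rw [h]
  rw [extLabel_neg, ofLex_neg, Prod.snd_neg, abs_neg]

theorem IsFace.relabel {I J : Set (Fin n)} {wt : Fin r → ℕ} {wt' : Fin r' → ℕ} {G : Fin r → ℤ}
    {G' : Fin r' → ℤ} (hwt' : ∀ l, 0 < wt' l) (hG : IsFace I wt G) (hG' : IsFace I wt' G')
    {c : ℤ → ℤ} (hc0 : c 0 = 0) (hc : ∀ v, |c (|v|)| = |c v|) (h : IsFace J wt fun l => c (G l)) :
    IsFace J wt' fun l => c (G' l) := by
  classical
  constructor
  · by_contra! hcon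
    obtain ⟨l, hl0, hl⟩ := hcon
    have key := hG.sum_eq hG' (fun v => c v ≠ 0 ∧ ∀ i : Fin n, i ∉ J → |c v| ≠ (i : ℤ) + 1)
      (by simp [hc0])
    have hne : ∀ v, c (|v|) ≠ 0 ↔ c v ≠ 0 := fun v => by
      rw [← abs_ne_zero, hc, abs_ne_zero]
    simp only [hne, hc] at key
    rw [Finset.sum_eq_zero, eq_comm, Finset.sum_eq_zero_iff] at key
    · have := key l (Finset.mem_univ l)
      rw [if_pos ⟨hl0, hl⟩] at this
      exact (hwt' l).ne' this
    · intro l _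
      refine if_neg fun h' => ?_
      obtain ⟨i, hi, hi'⟩ := h.label l h'.1
      exact h'.2 i hi hi'
  · intro i hi
    have key := hG.sum_eq hG' (fun v => (i : ℤ) + 1 ≤ |c v|) (by rw [hc0]; simp)
    simp only [hc] at key
    rw [← key]
    exact h.tail i hi

theorem IsFacePair.relabel {I J K : Set (Fin n)} {wt : Fin r → ℕ} {wt' : Fin r' → ℕ}
    {G : Fin r → ℤ} {G' : Fin r' → ℤ} (hwt' : ∀ l, 0 < wt' l) (hG : IsFace I wt G)
    (hG' : IsFace I wt' G') {θ : Fin n → ℤ ×ₗ ℤ}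
    (h : IsFacePair J K wt fun l => extLabel θ (G l)) :
    IsFacePair J K wt' fun l => extLabel θ (G' l) := by
  constructor
  · exact IsFace.relabel hwt' hG hG' (c := fun v => (ofLex (extLabel θ v)).1)
      (by rw [extLabel_zero]; rfl) (extLabel_fst_abs θ) h.fst
  · exact IsFace.relabel hwt' hG hG' (c := fun v => (ofLex (extLabel θ v)).2)
      (by rw [extLabel_zero]; rfl) (extLabel_snd_abs θ) h.snd

theorem IsRelabelling.strictMonoOn {I : Set (Fin n)} {θ : Fin n → ℤ ×ₗ ℤ}
    (hθ : IsRelabelling I θ) :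
    StrictMonoOn (extLabel θ) {v | v ≠ 0 → ∃ i : Fin n, i ∉ I ∧ |v| = (i : ℤ) + 1} := by
  have pos : ∀ v : ℤ, 0 < v → (∃ i : Fin n, i ∉ I ∧ |v| = (i : ℤ) + 1) → 0 < extLabel θ v := by
    rintro v hv ⟨i, hi, hvi⟩
    rw [abs_of_pos hv] at hvi
    rw [hvi, extLabel_succ]
    exact hθ.pos i hi
  have neg : ∀ v : ℤ, v < 0 → (∃ i : Fin n, i ∉ I ∧ |v| = (i : ℤ) + 1) → extLabel θ v < 0 := by
    intro v hv h
    have := pos (-v) (by omega) (by rwa [abs_neg])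
    rw [extLabel_neg] at this
    exact neg_pos.1 this
  have lt : ∀ v w : ℤ, 0 < v → v < w → (∃ i : Fin n, i ∉ I ∧ |v| = (i : ℤ) + 1) →
      (∃ i : Fin n, i ∉ I ∧ |w| = (i : ℤ) + 1) → extLabel θ v < extLabel θ w := by
    rintro v w hv hvw ⟨i, hi, hvi⟩ ⟨j, hj, hwj⟩
    rw [abs_of_pos hv] at hvi
    rw [abs_of_pos (hv.trans hvw)] at hwj
    rw [hvi, hwj, extLabel_succ, extLabel_succ]
    exact hθ.lt i hi j hj (Fin.lt_def.2 (by omega))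
  intro v hv w hw hvw
  rcases lt_trichotomy v 0 with h | rfl | h
  · rcases lt_trichotomy w 0 with h' | rfl | h'
    · have := lt (-w) (-v) (by omega) (by omega) (by rw [abs_neg]; exact hw h'.ne)
        (by rw [abs_neg]; exact hv h.ne)
      rw [extLabel_neg, extLabel_neg] at this
      exact neg_lt_neg_iff.1 this
    · rw [extLabel_zero]
      exact neg v h (hv h.ne)
    · exact (neg v h (hv h.ne)).trans (pos w h' (hw h'.ne'))
  · rw [extLabel_zero]
    exact pos w hvw (hw hvw.ne')
  · exact lt v w h hvw (hv h.ne') (hw (h.trans hvw).ne')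

theorem lexKey_bar {K : Type*} [AddCommGroup K] {g : SignedLetter r → ℤ} {κ : SignedLetter r → K}
    (hg : ∀ e, g (bar e) = -g e) (hκ : ∀ e, κ (bar e) = -κ e) (e : SignedLetter r) :
    lexKey g κ (bar e) = -lexKey g κ e := by
  rw [lexKey, lexKey, hg, hκ]
  rfl

theorem lexKey_ne_zero {K : Type*} [Zero K] {g : SignedLetter r → ℤ} {κ : SignedLetter r → K}
    (hκ : ∀ e, κ e ≠ 0) (e : SignedLetter r) : lexKey g κ e ≠ 0 := fun h =>
  hκ e (congrArg (fun z => (ofLex z).2) h)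

theorem IsFace.oddExt_le {J : Set (Fin n)} {wt : Fin r → ℕ} {g : Fin r → ℤ} (hg : IsFace J wt g)
    (e : SignedLetter r) : oddExt g e ≤ n :=
  (le_abs_self _).trans ((abs_oddExt g e).trans_le (hg.abs_le e.1))

/-- The successive action of two faces is the action of a single face. -/
theorem IsRelabelling.arr_arr {I J K : Set (Fin n)} {wt : Fin r → ℕ} {G : Fin r → ℤ}
    {θ : Fin n → ℤ ×ₗ ℤ} (hθ : IsRelabelling I θ) (hG : IsFace I wt G)
    (h : IsFacePair J K wt fun l => extLabel θ (G l)) :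
    arr n bar (oddExt fun l => (ofLex (extLabel θ (G l))).1)
      (arr n bar (oddExt fun l => (ofLex (extLabel θ (G l))).2) (stdList r)) =
      arr n bar (oddExt G) (stdList r) := by
  set f : Fin r → ℤ := fun l => (ofLex (extLabel θ (G l))).1 with hf
  set g : Fin r → ℤ := fun l => (ofLex (extLabel θ (G l))).2 with hg
  have h1 : IsChamber (lexKey (oddExt f) (lexKey (oddExt g) val))
      (arr n bar (oddExt f) (arr n bar (oddExt g) (stdList r))) :=
    ((isChamber_stdList r).arr val_bar val_ne_zero (oddExt_bar g) h.snd.oddExt_le).arr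
      (lexKey_bar (oddExt_bar g) val_bar) (lexKey_ne_zero val_ne_zero) (oddExt_bar f)
      h.fst.oddExt_le
  have h2 : IsChamber (lexKey (oddExt G) val) (arr n bar (oddExt G) (stdList r)) :=
    (isChamber_stdList r).arr val_bar val_ne_zero (oddExt_bar G) hG.oddExt_le
  have hD (e : SignedLetter r) : oddExt G e ≠ 0 →
      ∃ i : Fin n, i ∉ I ∧ |oddExt G e| = (i : ℤ) + 1 := by
    intro he
    rw [abs_oddExt]
    exact hG.label _ (by rwa [← abs_pos, ← abs_oddExt, abs_pos])
  have hF (e : SignedLetter r) : toLex (oddExt f e, oddExt g e) = extLabel θ (oddExt G e) := by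
    obtain ⟨l, ε⟩ := e
    rcases Int.units_eq_one_or ε with rfl | rfl
    · simp [hf, hg]
    · simp only [oddExt_neg_one, extLabel_neg]
      rfl
  have hinj (e e' : SignedLetter r) :
      oddExt f e = oddExt f e' ∧ oddExt g e = oddExt g e' ↔ oddExt G e = oddExt G e' := by
    rw [← (hθ.strictMonoOn.injOn).eq_iff (hD e) (hD e'), ← hF, ← hF, toLex_inj, Prod.mk.injEq]
  have hlt (e e' : SignedLetter r) :
      oddExt f e < oddExt f e' ∨ oddExt f e = oddExt f e' ∧ oddExt g e < oddExt g e' ↔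
        oddExt G e < oddExt G e' := by
    rw [← hθ.strictMonoOn.lt_iff_lt (hD e) (hD e'), ← hF, ← hF, Prod.Lex.toLex_lt_toLex]
  have hpos (e : SignedLetter r) :
      0 < oddExt f e ∨ 0 = oddExt f e ∧ 0 < oddExt g e ↔ 0 < oddExt G e := by
    rw [← hθ.strictMonoOn.lt_iff_lt (show (0 : ℤ) ∈ _ from fun h => absurd rfl h) (hD e), ← hF,
      extLabel_zero]
    change _ ↔ toLex ((0 : ℤ), (0 : ℤ)) < _
    rw [Prod.Lex.toLex_lt_toLex]
  have hzero (e : SignedLetter r) : 0 = oddExt f e ∧ 0 = oddExt g e ↔ 0 = oddExt G e := by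
    rw [← (hθ.strictMonoOn.injOn).eq_iff (show (0 : ℤ) ∈ _ from fun h => absurd rfl h) (hD e),
      ← hF, extLabel_zero]
    change _ ↔ toLex ((0 : ℤ), (0 : ℤ)) = _
    rw [toLex_inj, Prod.mk.injEq]
  refine h1.unique (h2.congr (fun e e' => ?_) fun e => ?_)
  · rw [lexKey_lt, lexKey_lt, lexKey_lt, ← hlt, ← hinj]
    tauto
  · rw [lexKey_pos, lexKey_pos, lexKey_pos, ← hpos, eq_comm (a := oddExt G e), ← hzero]
    simp only [eq_comm (a := (0 : ℤ))]
    tauto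

open Classical in
/-- The relabellings which turn the faces of type `I` into pairs of faces of types `J` and `K`. -/
noncomputable def relabellings (J K I : Set (Fin n)) : Finset (Fin n → ℤ ×ₗ ℤ) :=
  (Fintype.piFinset fun _ => (Finset.Icc (-(n : ℤ)) n ×ˢ Finset.Icc (-(n : ℤ)) n).map
    toLex.toEmbedding).filter fun θ => IsRelabelling I θ ∧
      IsFacePair J K (fun _ => 1) fun p => extLabel θ (stdFace I p)

theorem mem_relabellings {J K I : Set (Fin n)} {θ : Fin n → ℤ ×ₗ ℤ} :
    θ ∈ relabellings J K I ↔ IsRelabelling I θ ∧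
      IsFacePair J K (fun _ => 1) fun p => extLabel θ (stdFace I p) := by
  classical
  rw [relabellings, Finset.mem_filter, Fintype.mem_piFinset, and_iff_right_iff_imp]
  rintro ⟨hθ, h⟩ i
  rw [Finset.mem_map_equiv, Finset.mem_product, Finset.mem_Icc, Finset.mem_Icc, ← abs_le, ← abs_le]
  by_cases hi : i ∈ I
  · rw [hθ.eq_zero i hi]
    exact ⟨by simp, by simp⟩
  · have h1 := h.fst.abs_le i
    have h2 := h.snd.abs_le i
    rw [stdFace_self hi, extLabel_succ] at h1 h2
    exact ⟨h1, h2⟩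

theorem mem_relabellings_iff {J K I : Set (Fin n)} {θ : Fin n → ℤ ×ₗ ℤ} {wt : Fin r → ℕ}
    (hwt : ∀ l, 0 < wt l) {G : Fin r → ℤ} (hG : IsFace I wt G) :
    θ ∈ relabellings J K I ↔ IsRelabelling I θ ∧
      IsFacePair J K wt fun l => extLabel θ (G l) := by
  rw [mem_relabellings]
  exact and_congr_right fun _ => ⟨fun h => h.relabel hwt (isFace_stdFace I) hG,
    fun h => h.relabel (fun _ => one_pos) hG (isFace_stdFace I)⟩

/-- Every pair of faces arises from a face by a relabelling: replace the label of a letter by the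
first position of its block in the common refinement of the two faces. -/
theorem exists_relabelling {wt : Fin r → ℕ} (hwt : ∀ l, 0 < wt l) (hsum : ∑ l, wt l ≤ n)
    (F : Fin r → ℤ ×ₗ ℤ) : ∃ (I : Set (Fin n)) (θ : Fin n → ℤ ×ₗ ℤ) (G : Fin r → ℤ),
      IsRelabelling I θ ∧ IsFace I wt G ∧ ∀ l, extLabel θ (G l) = F l := by
  classical
  -- the weight of the letters from the block of `l` onwards
  set t : Fin r → ℕ := fun l => ∑ m, if |F l| ≤ |F m| then wt m else 0 with ht
  have ht_le (l : Fin r) : t l ≤ n :=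
    (Finset.sum_le_sum fun m _ => by split_ifs <;> omega).trans hsum
  have ht_pos (l : Fin r) : 0 < t l := by
    refine lt_of_lt_of_le (hwt l) ?_
    have := Finset.single_le_sum (f := fun m => if |F l| ≤ |F m| then wt m else 0)
      (fun m _ => Nat.zero_le _) (Finset.mem_univ l)
    simpa using this
  have ht_mono (l m : Fin r) (h : |F l| ≤ |F m|) : t m ≤ t l := by
    refine Finset.sum_le_sum fun p _ => ?_
    by_cases h' : |F m| ≤ |F p|
    · rw [if_pos h', if_pos (h.trans h')]
    · rw [if_neg h']
      exact Nat.zero_le _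
  have ht_lt (l m : Fin r) (h : |F l| < |F m|) : t m < t l := by
    refine Finset.sum_lt_sum (fun p _ => ?_) ⟨l, Finset.mem_univ l, ?_⟩
    · by_cases h' : |F m| ≤ |F p|
      · rw [if_pos h', if_pos (h.le.trans h')]
      · rw [if_neg h']
        exact Nat.zero_le _
    · rw [if_neg (not_le.2 h), if_pos le_rfl]
      exact hwt l
  have ht_iff (l m : Fin r) : t m ≤ t l ↔ |F l| ≤ |F m| :=
    ⟨fun h => not_lt.1 fun h' => absurd (ht_lt m l h') (not_lt.2 h), ht_mono l m⟩
  set P : Fin n → Prop := fun i => ∃ l, F l ≠ 0 ∧ i + t l = n with hP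
  set θ : Fin n → ℤ ×ₗ ℤ := fun i => if h : P i then |F h.choose| else 0 with hθ
  have hθ_eq (i : Fin n) (l : Fin r) (hl : F l ≠ 0) (hi : i + t l = n) : θ i = |F l| := by
    have h : P i := ⟨l, hl, hi⟩
    have h' := h.choose_spec.2
    have : t h.choose = t l := by omega
    simp only [hθ, dif_pos h]
    exact le_antisymm ((ht_iff _ _).1 this.ge) ((ht_iff _ _).1 this.le)
  set G : Fin r → ℤ := fun l =>
    if F l = 0 then 0 else (if 0 < F l then 1 else -1) * ((n : ℤ) - t l + 1) with hG
  have hG_abs (l : Fin r) (hl : F l ≠ 0) : |G l| = (n : ℤ) - t l + 1 := by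
    have := ht_le l
    simp only [hG, if_neg hl]
    rw [abs_mul, abs_of_nonneg (a := (n : ℤ) - t l + 1) (by omega)]
    split_ifs <;> simp
  have hG_ne (l : Fin r) : G l ≠ 0 ↔ F l ≠ 0 := by
    constructor
    · intro h h'
      exact h (by simp [hG, h'])
    · intro h h'
      have h1 := hG_abs l h
      have := ht_le l
      rw [h', abs_zero] at h1
      omega
  refine ⟨{i | ¬P i}, θ, G, ⟨fun i hi => dif_neg hi, ?_, ?_⟩, ⟨?_, ?_⟩, ?_⟩
  · intro i hi
    obtain ⟨l, hl, hi⟩ := not_not.1 hi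
    rw [hθ_eq i l hl hi]
    exact abs_pos.2 hl
  · intro i hi j hj hij
    obtain ⟨l, hl, hi⟩ := not_not.1 hi
    obtain ⟨m, hm, hj⟩ := not_not.1 hj
    rw [hθ_eq i l hl hi, hθ_eq j m hm hj, ← not_le, ← ht_iff]
    have := Fin.lt_def.1 hij
    omega
  · intro l hl
    rw [hG_ne] at hl
    have h1 := ht_le l
    have h2 := ht_pos l
    refine ⟨⟨n - t l, by omega⟩, not_not.2 ⟨l, hl, by simp only; omega⟩, ?_⟩
    rw [hG_abs l hl]
    simp only
    omega
  · intro i hi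
    obtain ⟨l, hl, hi⟩ := not_not.1 hi
    have : (∑ m, if (i : ℤ) + 1 ≤ |G m| then wt m else 0) = t l := by
      refine Finset.sum_congr rfl fun m _ => if_congr ?_ rfl rfl
      by_cases hm : F m = 0
      · have h0 : G m = 0 := not_not.1 ((hG_ne m).not.2 (not_not.2 hm))
        rw [hm, h0, abs_zero, abs_zero]
        exact ⟨fun h => by omega, fun h => absurd h (not_le.2 (abs_pos.2 hl))⟩
      · rw [← ht_iff, hG_abs m hm]
        omega
    omega
  · intro l
    by_cases hl : F l = 0
    · rw [not_not.1 ((hG_ne l).not.2 (not_not.2 hl)), hl, extLabel_zero]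
    · have h1 := ht_le l
      have h2 := ht_pos l
      have h3 : (n : ℤ) - t l + 1 = ((⟨n - t l, by omega⟩ : Fin n) : ℤ) + 1 := by
        simp only
        omega
      have h4 : θ ⟨n - t l, by omega⟩ = |F l| := hθ_eq _ l hl (by simp only; omega)
      simp only [hG, if_neg hl]
      split_ifs with h
      · rw [one_mul, h3, extLabel_succ, h4, abs_of_pos h]
      · rw [neg_one_mul, extLabel_neg, h3, extLabel_succ, h4,
          abs_of_neg (lt_of_le_of_ne (not_lt.1 h) hl), neg_neg]

theorem IsRelabelling.tail_eq {I : Set (Fin n)} {θ : Fin n → ℤ ×ₗ ℤ} {wt : Fin r → ℕ}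
    {G : Fin r → ℤ} (hθ : IsRelabelling I θ) (hG : IsFace I wt G) {l : Fin r} (hl : G l ≠ 0) :
    ((∑ m, if |extLabel θ (G l)| ≤ |extLabel θ (G m)| then wt m else 0 : ℕ) : ℤ) + |G l| =
      n + 1 := by
  obtain ⟨i, hi, hil⟩ := hG.label l hl
  have h1 := hG.tail i hi
  have hD (l : Fin r) : |G l| ≠ 0 → ∃ i : Fin n, i ∉ I ∧ |(|G l|)| = (i : ℤ) + 1 := by
    intro h
    rw [abs_abs]
    exact hG.label l (abs_ne_zero.1 h)
  have hnn (m : Fin r) : |extLabel θ (G m)| = extLabel θ (|G m|) := by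
    rw [← abs_extLabel, abs_of_nonneg]
    rw [← extLabel_zero θ]
    exact (hθ.strictMonoOn.le_iff_le (fun h => absurd rfl h) (hD m)).2 (abs_nonneg _)
  have h2 : (∑ m, if |extLabel θ (G l)| ≤ |extLabel θ (G m)| then wt m else 0) =
      ∑ m, if (i : ℤ) + 1 ≤ |G m| then wt m else 0 := by
    refine Finset.sum_congr rfl fun m _ => if_congr ?_ rfl rfl
    rw [hnn, hnn, hθ.strictMonoOn.le_iff_le (hD l) (hD m), hil]
  rw [h2, hil]
  omega

theorem IsRelabelling.unique {I I' : Set (Fin n)} {θ θ' : Fin n → ℤ ×ₗ ℤ} {wt : Fin r → ℕ}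
    {G G' : Fin r → ℤ} (hθ : IsRelabelling I θ) (hG : IsFace I wt G) (hθ' : IsRelabelling I' θ')
    (hG' : IsFace I' wt G') (h : ∀ l, extLabel θ (G l) = extLabel θ' (G' l)) :
    I = I' ∧ θ = θ' ∧ G = G' := by
  have h0 : ∀ {I : Set (Fin n)} {θ : Fin n → ℤ ×ₗ ℤ} {G : Fin r → ℤ}, IsRelabelling I θ →
      IsFace I wt G → ∀ l, SignType.sign (extLabel θ (G l)) = SignType.sign (G l) := by
    intro I θ G hθ hG l
    have hlt := hθ.strictMonoOn.lt_iff_lt (show (0 : ℤ) ∈ _ from fun h => absurd rfl h)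
      (hG.label l)
    have hgt := hθ.strictMonoOn.lt_iff_lt (hG.label l)
      (show (0 : ℤ) ∈ _ from fun h => absurd rfl h)
    rw [extLabel_zero] at hlt hgt
    rcases lt_trichotomy (G l) 0 with h | h | h
    · rw [sign_neg h, sign_neg (hgt.2 h)]
    · rw [h, extLabel_zero, sign_zero, sign_zero]
    · rw [sign_pos h, sign_pos (hlt.2 h)]
  have hsign (l : Fin r) : SignType.sign (G l) = SignType.sign (G' l) := by
    rw [← h0 hθ hG, ← h0 hθ' hG', h]
  have hGG : G = G' := by
    funext l
    by_cases hl : G l = 0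
    · have := hsign l
      rw [hl, sign_zero, eq_comm, sign_eq_zero_iff] at this
      rw [hl, this]
    · have hl' : G' l ≠ 0 := by
        intro h'
        have := hsign l
        rw [h', sign_zero, sign_eq_zero_iff] at this
        exact hl this
      have h1 := hθ.tail_eq hG hl
      have h2 := hθ'.tail_eq hG' hl'
      simp only [h] at h1
      have h3 : |G l| = |G' l| := by omega
      rw [← sign_mul_abs (G l), ← sign_mul_abs (G' l), h3, hsign]
  subst hGG
  have hII : I = I' := by
    have key : ∀ {I I' : Set (Fin n)}, IsFace I wt G → IsFace I' wt G → I' ⊆ I := by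
      intro I I' hG hG' i hi
      by_contra hi'
      obtain ⟨l, hl⟩ := hG.exists_label hi'
      obtain ⟨j, hj, hjl⟩ := hG'.label l (by rw [← abs_ne_zero]; omega)
      have : i = j := by ext; omega
      exact hj (this ▸ hi)
    exact Set.Subset.antisymm (key hG' hG) (key hG hG')
  subst hII
  refine ⟨rfl, ?_, rfl⟩
  funext i
  by_cases hi : i ∈ I
  · rw [hθ.eq_zero i hi, hθ'.eq_zero i hi]
  · obtain ⟨l, hl⟩ := hG.exists_label hi
    have := h l
    have h1 : |extLabel θ (G l)| = |extLabel θ' (G l)| := by rw [this]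
    rw [← abs_extLabel θ, ← abs_extLabel θ', hl, extLabel_succ, extLabel_succ,
      abs_of_pos (hθ.pos i hi), abs_of_pos (hθ'.pos i hi)] at h1
    exact h1

/-- The structure constants: the number of ways to relabel a face of type `I` as a pair of faces
of types `J` and `K`. They do not depend on the letters the faces live on. -/
noncomputable def structConst (J K I : Set (Fin n)) : ℕ := (relabellings J K I).card

/-- The product theorem: acting with all faces of type `K` and then with all faces of type `J` is
acting with all faces of type `I`, with multiplicity `structConst J K I`. -/
theorem sum_faces_faces {M : Type*} [AddCommMonoid M] {wt : Fin r → ℕ} (hwt : ∀ l, 0 < wt l)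
    (hsum : ∑ l, wt l ≤ n) (J K : Set (Fin n)) (φ : List (SignedLetter r) → M) :
    ∑ g ∈ faces K wt, ∑ f ∈ faces J wt,
        φ (arr n bar (oddExt f) (arr n bar (oddExt g) (stdList r))) =
      ∑ I : Set (Fin n), structConst J K I •
        ∑ G ∈ faces I wt, φ (arr n bar (oddExt G) (stdList r)) := by
  classical
  have h1 : ∀ I : Set (Fin n), structConst J K I •
      ∑ G ∈ faces I wt, φ (arr n bar (oddExt G) (stdList r)) =
      ∑ x ∈ relabellings J K I ×ˢ faces I wt, φ (arr n bar (oddExt x.2) (stdList r)) := by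
    intro I
    rw [Finset.sum_product]
    exact (Finset.sum_const _).symm
  rw [Finset.sum_congr rfl fun I _ => h1 I, ← Finset.sum_product', Finset.sum_sigma']
  symm
  have hmem : ∀ x ∈ (Finset.univ : Finset (Set (Fin n))).sigma
      (fun I => relabellings J K I ×ˢ faces I wt), IsRelabelling x.1 x.2.1 ∧
        IsFacePair J K wt (fun l => extLabel x.2.1 (x.2.2 l)) ∧ IsFace x.1 wt x.2.2 := by
    rintro ⟨I, θ, G⟩ hx
    simp only [Finset.mem_sigma, Finset.mem_univ, true_and, Finset.mem_product, mem_faces] at hx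
    obtain ⟨hθ, hG⟩ := hx
    rw [mem_relabellings_iff hwt hG] at hθ
    exact ⟨hθ.1, hθ.2, hG⟩
  refine Finset.sum_bij (fun x _ => (fun l => (ofLex (extLabel x.2.1 (x.2.2 l))).2,
    fun l => (ofLex (extLabel x.2.1 (x.2.2 l))).1)) ?_ ?_ ?_ ?_
  · intro x hx
    obtain ⟨_, h, _⟩ := hmem x hx
    rw [Finset.mem_product, mem_faces, mem_faces]
    exact ⟨h.snd, h.fst⟩
  · rintro ⟨I, θ, G⟩ hx ⟨I', θ', G'⟩ hx' h
    obtain ⟨hθ, _, hG⟩ := hmem _ hx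
    obtain ⟨hθ', _, hG'⟩ := hmem _ hx'
    rw [Prod.mk.injEq] at h
    obtain ⟨rfl, rfl, rfl⟩ := hθ.unique hG hθ' hG' fun l =>
      Prod.ext (congrFun h.2 l) (congrFun h.1 l)
    rfl
  · rintro ⟨g, f⟩ h
    rw [Finset.mem_product, mem_faces, mem_faces] at h
    obtain ⟨I, θ, G, hθ, hG, hF⟩ := exists_relabelling hwt hsum fun l => toLex (f l, g l)
    refine ⟨⟨I, θ, G⟩, ?_, ?_⟩
    · simp only [Finset.mem_sigma, Finset.mem_univ, true_and, Finset.mem_product, mem_faces]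
      rw [mem_relabellings_iff hwt hG]
      refine ⟨⟨hθ, ?_, ?_⟩, hG⟩
      · simp only [hF]
        exact h.2
      · simp only [hF]
        exact h.1
    · simp only [hF]
      rfl
  · intro x hx
    obtain ⟨hθ, h, hG⟩ := hmem x hx
    rw [hθ.arr_arr hG h]

end

end DescentAlg

/-! ### Signed permutations -/

namespace DescentAlg

variable {n : ℕ}

theorem hyp_bar (w : Hyperoctahedral n) (e : SignedLetter n) : w.1 (bar e) = bar (w.1 e) :=
  w.2 e.1 e.2

theorem hyp_ext {v w : Hyperoctahedral n} (h : ∀ i, v.1 (i, 1) = w.1 (i, 1)) : v = w := by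
  refine Subtype.ext (Equiv.ext ?_)
  rintro ⟨i, ε⟩
  rcases Int.units_eq_one_or ε with rfl | rfl
  · exact h i
  · have := congrArg bar (h i)
    rwa [← hyp_bar, ← hyp_bar] at this

theorem bar_ne (e : SignedLetter n) : bar e ≠ e := fun h => by
  have := congrArg val h
  have h0 := val_ne_zero e
  rw [val_bar] at this
  omega

/-- The left endpoint of the simple root of index `i`, viewed as an adjacent pair in the standard
order of the signed letters. -/
def rootFst (i : Fin n) : SignedLetter n :=
  if i.val = 0 then (i, -1) else (⟨i.val - 1, lt_of_le_of_lt (Nat.sub_le _ _) i.isLt⟩, 1)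

/-- `w` has an ascent at `i`: it maps the simple root of index `i` to a positive root. -/
def IsAscent (w : Hyperoctahedral n) (i : Fin n) : Prop :=
  val (w.1 (rootFst i)) < val (w.1 (i, 1))

theorem val_rootFst_zero {i : Fin n} (h : i.val = 0) : val (rootFst i) = -1 := by
  simp [rootFst, h]

theorem val_rootFst {i : Fin n} (h : i.val ≠ 0) : val (rootFst i) = i := by
  rw [rootFst, if_neg h, val_one]
  simp only
  omega

theorem rootFst_ne (i : Fin n) : rootFst i ≠ (i, 1) := by
  intro h
  have := congrArg val h
  by_cases h0 : i.val = 0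
  · rw [val_rootFst_zero h0, val_one] at this; omega
  · rw [val_rootFst h0, val_one] at this; omega

/-- A simple reflection interchanges the two endpoints of its root, and their negatives. -/
theorem simpleReflection_apply (i : Fin n) (e : SignedLetter n) :
    (simpleReflection n i).1 e = if e = rootFst i then (i, 1) else if e = (i, 1) then rootFst i
      else if e = bar (rootFst i) then bar (i, 1) else if e = bar (i, 1) then bar (rootFst i)
      else e := by
  obtain ⟨j, ε⟩ := e
  by_cases h : i.val = 0
  · have h' : i = ⟨0, by omega⟩ := Fin.ext h
    rcases Int.units_eq_one_or ε with rfl | rfl <;> by_cases hj : j = i <;>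
      simp [simpleReflection, rootFst, h, bar, Equiv.swap_apply_def, hj]
  · have hne : (⟨i.val - 1, lt_of_le_of_lt (Nat.sub_le _ _) i.isLt⟩ : Fin n) ≠ i := by
      intro h'
      have := congrArg Fin.val h'
      simp only at this
      omega
    rcases Int.units_eq_one_or ε with rfl | rfl <;> by_cases hj : j = i <;>
      by_cases hj' : j = ⟨i.val - 1, lt_of_le_of_lt (Nat.sub_le _ _) i.isLt⟩ <;>
      simp_all [simpleReflection, rootFst, bar, Equiv.swap_apply_def]

theorem simpleReflection_mul_self (i : Fin n) :
    simpleReflection n i * simpleReflection n i = 1 := by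
  refine Subtype.ext (Equiv.ext fun e => ?_)
  by_cases h : i.val = 0
  · simp [simpleReflection, h]
  · obtain ⟨j, ε⟩ := e
    simp [simpleReflection, h]

/-- The only positive root which a simple reflection makes negative is its own. -/
theorem eq_of_simpleReflection_neg {i : Fin n} {x y : SignedLetter n} (h : val x < val y)
    (h' : val ((simpleReflection n i).1 y) < val ((simpleReflection n i).1 x)) :
    (x = rootFst i ∧ y = (i, 1)) ∨ (x = bar (i, 1) ∧ y = bar (rootFst i)) := by
  have hx := simpleReflection_apply i x
  have hy := simpleReflection_apply i y
  have key (e : SignedLetter n) : (e = rootFst i ↔ val e = val (rootFst i)) ∧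
      (e = (i, 1) ↔ val e = (i : ℤ) + 1) ∧ (e = bar (rootFst i) ↔ val e = -val (rootFst i)) ∧
      (e = bar (i, 1) ↔ val e = -((i : ℤ) + 1)) := by
    refine ⟨val_injective.eq_iff.symm, ?_, ?_, ?_⟩
    · rw [← val_one, val_injective.eq_iff]
    · rw [← val_bar, val_injective.eq_iff]
    · rw [← val_one, ← val_bar, val_injective.eq_iff]
  rw [hx, hy] at h'
  simp only [key] at h' ⊢
  have hval := val_ne_zero x
  have hval' := val_ne_zero y
  by_cases h0 : i.val = 0
  · rw [val_rootFst_zero h0] at *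
    split_ifs at h' <;> (try simp only [val_bar, val_one, val_rootFst_zero h0] at h') <;> omega
  · rw [val_rootFst h0] at *
    split_ifs at h' <;> (try simp only [val_bar, val_one, val_rootFst h0] at h') <;> omega

/-- If `w` maps the root of index `i` to plus or minus that of index `j`, then `w` conjugates the
reflection of index `i` to that of index `j`. -/
theorem mul_simpleReflection {w : Hyperoctahedral n} {i j : Fin n}
    (h : (w.1 (rootFst i) = rootFst j ∧ w.1 (i, 1) = (j, 1)) ∨
      (w.1 (rootFst i) = bar (j, 1) ∧ w.1 (i, 1) = bar (rootFst j))) :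
    w * simpleReflection n i = simpleReflection n j * w := by
  refine Subtype.ext (Equiv.ext fun e => ?_)
  change w.1 ((simpleReflection n i).1 e) = (simpleReflection n j).1 (w.1 e)
  have key (a : SignedLetter n) : e = a ↔ w.1 e = w.1 a := w.1.injective.eq_iff.symm
  rw [simpleReflection_apply, simpleReflection_apply]
  simp only [key (rootFst i), key (i, 1), key (bar (rootFst i)), key (bar (i, 1)), hyp_bar]
  rcases h with ⟨h1, h2⟩ | ⟨h1, h2⟩
  · simp only [h1, h2, apply_ite w.1, hyp_bar]
  · simp only [h1, h2, apply_ite w.1, hyp_bar, bar_bar]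
    have hb := bar_ne ((j, 1) : SignedLetter n)
    have ha := bar_ne (rootFst j)
    have h3 := bar_bar (j, 1)
    have h4 := bar_bar (rootFst j)
    clear h1 h2 key
    generalize w.1 e = x
    generalize ((j, 1) : SignedLetter n) = b at *
    generalize rootFst j = a at *
    generalize hb' : bar b = b' at *
    generalize ha' : bar a = a' at *
    grind

/-- The exchange condition: if `w` has a descent at `i`, a letter can be deleted from a word for
`w` to give a word for `w s_i`. -/
theorem exists_word_of_not_isAscent {i : Fin n} (l : List (Fin n))
    (h : ¬IsAscent (l.map (simpleReflection n)).prod i) :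
    ∃ l' : List (Fin n), l'.length + 1 = l.length ∧
      (l'.map (simpleReflection n)).prod =
        (l.map (simpleReflection n)).prod * simpleReflection n i := by
  induction l with
  | nil =>
    refine absurd ?_ h
    simp only [List.map_nil, List.prod_nil, IsAscent, OneMemClass.coe_one, Equiv.Perm.coe_one,
      id_eq, val_one]
    by_cases h0 : i.val = 0
    · rw [val_rootFst_zero h0]; omega
    · rw [val_rootFst h0]; omega
  | cons j l ih =>
    simp only [List.map_cons, List.prod_cons] at h ⊢
    set w := (l.map (simpleReflection n)).prod with hw
    by_cases ha : IsAscent w i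
    · refine ⟨l, rfl, ?_⟩
      have hlt : val ((simpleReflection n j).1 (w.1 (i, 1))) <
          val ((simpleReflection n j).1 (w.1 (rootFst i))) := by
        refine lt_of_le_of_ne (not_lt.1 h) fun h' => rootFst_ne i ?_
        exact (w.1.injective ((simpleReflection n j).1.injective (val_injective h'))).symm
      rw [mul_assoc, mul_simpleReflection (eq_of_simpleReflection_neg ha hlt), ← mul_assoc,
        simpleReflection_mul_self, one_mul]
    · obtain ⟨l', h1, h2⟩ := ih ha
      exact ⟨j :: l', by simpa using h1, by simp [h2, mul_assoc]⟩

/-- The signed letters `w(1), …, w(n)`. -/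
def listOf (w : Hyperoctahedral n) : List (SignedLetter n) := (stdList n).map w.1

theorem listOf_injective : Function.Injective (listOf (n := n)) := by
  intro v w h
  refine hyp_ext fun i => ?_
  simp only [listOf, stdList, List.map_map] at h
  exact List.map_inj_left.1 h i (List.mem_finRange i)

/-- A weighted sum of the values of `w`, which grows when a descent is removed by a simple
reflection; it replaces the length in inductions. -/
def potential (w : Hyperoctahedral n) : ℤ := ∑ p : Fin n, ((p : ℤ) + 1) * val (w.1 (p, 1))

theorem potential_lt {w : Hyperoctahedral n} {i : Fin n} (h : ¬IsAscent w i) :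
    potential w < potential (w * simpleReflection n i) := by
  have hlt : val (w.1 (i, 1)) < val (w.1 (rootFst i)) :=
    lt_of_le_of_ne (not_lt.1 h) fun h' => rootFst_ne i (w.1.injective (val_injective h')).symm
  rw [← sub_pos, potential, potential, ← Finset.sum_sub_distrib]
  have hmul (e : SignedLetter n) :
      (w * simpleReflection n i).1 e = w.1 ((simpleReflection n i).1 e) := rfl
  by_cases h0 : i.val = 0
  · rw [Finset.sum_eq_single i]
    · rw [hmul, simpleReflection_apply, if_neg (rootFst_ne i).symm, if_pos rfl, ← mul_sub]
      exact mul_pos (by omega) (sub_pos.2 hlt)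
    · intro p _ hp
      rw [hmul]
      simp [simpleReflection, h0, Equiv.swap_apply_def, hp]
    · simp
  · set j : Fin n := ⟨i.val - 1, lt_of_le_of_lt (Nat.sub_le _ _) i.isLt⟩ with hj
    have hr : rootFst i = (j, 1) := if_neg h0
    have hji : j ≠ i := fun h' => rootFst_ne i (by rw [hr, h'])
    rw [Finset.sum_eq_add j i hji]
    · rw [hmul, hmul, simpleReflection_apply, simpleReflection_apply, if_pos hr.symm,
        if_neg (rootFst_ne i).symm, if_pos rfl, hr]
      rw [hr] at hlt
      have : (j : ℤ) = i - 1 := by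
        simp only [hj]
        omega
      rw [this]
      nlinarith
    · rintro p _ ⟨hp, hp'⟩
      rw [hmul]
      simp [simpleReflection, h0, Equiv.swap_apply_def, hp', ← hj, hp]
    · simp
    · simp

theorem potential_le (w : Hyperoctahedral n) : ∃ b : ℤ, ∀ v : Hyperoctahedral n, potential v ≤ b :=
  ⟨Finset.univ.sup' ⟨w, Finset.mem_univ w⟩ potential, fun v =>
    Finset.le_sup' potential (Finset.mem_univ v)⟩

theorem strictMono_of_isAscent {w : Hyperoctahedral n} {p q : Fin n} (hpq : p < q)
    (h : ∀ i, p < i → i ≤ q → IsAscent w i) : val (w.1 (p, 1)) < val (w.1 (q, 1)) := by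
  obtain ⟨q, hq⟩ := q
  induction q with
  | zero => exact absurd hpq (by simp [Fin.lt_def])
  | succ q ih =>
    have h1 := h ⟨q + 1, hq⟩ hpq le_rfl
    rw [IsAscent, rootFst, if_neg (by simp)] at h1
    simp only [Nat.add_sub_cancel] at h1
    by_cases hp : p = ⟨q, by omega⟩
    · rwa [← hp] at h1
    · have hlt : p < ⟨q, by omega⟩ := lt_of_le_of_ne (Nat.lt_succ_iff.1 hpq) hp
      exact (ih (by omega) hlt fun i hi hi' => h i hi (hi'.trans (by simp [Fin.le_def]))).trans h1

theorem pos_of_isAscent {w : Hyperoctahedral n} {p : Fin n}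
    (h : ∀ i, i ≤ p → IsAscent w i) : 0 < val (w.1 (p, 1)) := by
  have h0 : 0 < val (w.1 (⟨0, p.pos⟩, 1)) := by
    have := h ⟨0, p.pos⟩ (by simp [Fin.le_def])
    rw [IsAscent, rootFst, if_pos rfl] at this
    have hb : val (w.1 (bar (⟨0, p.pos⟩, 1))) < val (w.1 (⟨0, p.pos⟩, 1)) := this
    rw [hyp_bar, val_bar] at hb
    omega
  by_cases hp : p = ⟨0, p.pos⟩
  · rwa [← hp] at h0
  · exact h0.trans (strictMono_of_isAscent (Fin.lt_def.2 (Nat.pos_of_ne_zero fun h =>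
      hp (Fin.ext h))) fun i _ hi => h i hi)

/-- The odd extension of the standard face is constant on cosets of the parabolic subgroup. -/
theorem oddExt_stdFace_of_mem_closure {J : Set (Fin n)} {u : Hyperoctahedral n}
    (hu : u ∈ Subgroup.closure (simpleReflection n '' J)) (e : SignedLetter n) :
    oddExt (stdFace J) (u.1 e) = oddExt (stdFace J) e := by
  induction hu using Subgroup.closure_induction generalizing e with
  | mem x hx =>
    obtain ⟨j, hj, rfl⟩ := hx
    have hr : oddExt (stdFace J) (rootFst j) = oddExt (stdFace J) (j, 1) := by
      by_cases h0 : j.val = 0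
      · have : stdFace J j = 0 := by
          rcases stdFace_cases J j with h | ⟨i, hi, hij, _⟩
          · exact h
          · have : i = j := Fin.ext (by have := Fin.le_def.1 hij; omega)
            exact absurd hj (this ▸ hi)
        rw [rootFst, if_pos h0]
        simp [this]
      · rw [rootFst, if_neg h0, oddExt_one, oddExt_one]
        refine le_antisymm (stdFace_mono J (by simp [Fin.le_def])) ?_
        rcases stdFace_cases J j with h | ⟨i, hi, hij, h⟩ <;> rw [h]
        · exact stdFace_nonneg _ _
        · refine (le_stdFace hi).2 (Fin.le_def.2 ?_)
          have hne : i ≠ j := fun h' => hi (h' ▸ hj)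
          have := Fin.lt_def.1 (lt_of_le_of_ne hij hne)
          simp only
          omega
    rw [simpleReflection_apply]
    split_ifs with h1 h2 h3 h4
    · rw [h1, hr]
    · rw [h2, hr]
    · rw [h3, oddExt_bar, oddExt_bar, hr]
    · rw [h4, oddExt_bar, oddExt_bar, hr]
    · rfl
  | one => rfl
  | mul x y _ _ hx hy => exact (hx (y.1 e)).trans (hy e)
  | inv x _ hx =>
    rw [← hx]
    simp

/-- The labels of the signed letters given by the blocks of `w`. -/
noncomputable def faceOf (J : Set (Fin n)) (w : Hyperoctahedral n) (p : Fin n) : ℤ :=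
  oddExt (stdFace J) (w⁻¹.1 (p, 1))

theorem oddExt_faceOf (J : Set (Fin n)) (w : Hyperoctahedral n) (e : SignedLetter n) :
    oddExt (faceOf J w) e = oddExt (stdFace J) (w⁻¹.1 e) := by
  obtain ⟨p, ε⟩ := e
  rcases Int.units_eq_one_or ε with rfl | rfl
  · simp [faceOf]
  · have : ((p, -1) : SignedLetter n) = bar (p, 1) := rfl
    rw [this, oddExt_bar, hyp_bar, oddExt_bar, oddExt_one, faceOf]

/-- If `w` has ascents at all `j ∈ J`, the face of its blocks determines `w`: its letters are the
positive signed letters, ordered by their blocks, and increasing within each block. -/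
theorem listOf_eq_arr {J : Set (Fin n)} {w : Hyperoctahedral n} (h : ∀ j ∈ J, IsAscent w j) :
    listOf w = arr n bar (oddExt (faceOf J w)) (stdList n) := by
  have hle (e : SignedLetter n) : oddExt (faceOf J w) e ≤ n := by
    rw [oddExt_faceOf]
    exact (isFace_stdFace J).oddExt_le _
  have hblock (p q : Fin n) (hpq : p < q) (h' : stdFace J p = stdFace J q) (i : Fin n)
      (hi : p < i) (hi' : i ≤ q) : i ∈ J := by
    by_contra hiJ
    have h1 := (le_stdFace (p := q) hiJ).2 hi'
    rw [← h', le_stdFace hiJ] at h1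
    exact absurd hi (not_lt.2 h1)
  have hfirst (p : Fin n) (h' : stdFace J p = 0) (i : Fin n) (hi : i ≤ p) : i ∈ J := by
    by_contra hiJ
    have h1 := (le_stdFace (p := p) hiJ).2 hi
    omega
  have hlabel (a : SignedLetter n) : oddExt (faceOf J w) (w.1 a) = oddExt (stdFace J) a := by
    rw [oddExt_faceOf]
    simp
  have hpos (p : Fin n) : 0 < oddExt (faceOf J w) (w.1 (p, 1)) ∨
      oddExt (faceOf J w) (w.1 (p, 1)) = 0 ∧ 0 < val (w.1 (p, 1)) := by
    rw [hlabel, oddExt_one]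
    rcases (stdFace_nonneg J p).lt_or_eq with h0 | h0
    · exact Or.inl h0
    · exact Or.inr ⟨h0.symm, pos_of_isAscent fun i hi => h i (hfirst p h0.symm i hi)⟩
  refine IsChamber.unique (κ := lexKey (oddExt (faceOf J w)) val) ⟨?_, fun e => ?_⟩
    ((isChamber_stdList n).arr val_bar val_ne_zero (oddExt_bar _) hle)
  · rw [listOf, stdList, List.map_map, List.pairwise_map]
    refine (List.pairwise_lt_finRange n).imp fun {p q} hpq => ?_
    simp only [Function.comp_apply]
    rw [lexKey_lt, hlabel, hlabel, oddExt_one, oddExt_one]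
    rcases (stdFace_mono J hpq.le).lt_or_eq with h0 | h0
    · exact Or.inl h0
    · exact Or.inr ⟨h0, strictMono_of_isAscent hpq fun i hi hi' => h i (hblock p q hpq h0 i hi hi')⟩
  · rw [lexKey_pos, listOf, stdList, List.map_map, List.mem_map]
    obtain ⟨⟨p, ε⟩, rfl⟩ := w.1.surjective e
    rcases Int.units_eq_one_or ε with rfl | rfl
    · exact iff_of_true ⟨p, List.mem_finRange p, rfl⟩ (hpos p)
    · have hb : ((p, -1) : SignedLetter n) = bar (p, 1) := rfl
      rw [hb, hyp_bar, oddExt_bar, val_bar]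
      have := hpos p
      refine iff_of_false ?_ (by omega)
      rintro ⟨q, _, hq⟩
      have h1 := hpos q
      simp only [Function.comp_apply] at hq
      rw [hq, oddExt_bar, val_bar] at h1
      omega

/-- The simple reflections generate the group. -/
theorem exists_word (w : Hyperoctahedral n) :
    ∃ l : List (Fin n), (l.map (simpleReflection n)).prod = w := by
  obtain ⟨b, hb⟩ := potential_le w
  induction hm : (b - potential w).toNat using Nat.strong_induction_on generalizing w with
  | _ m ih =>
    by_cases h : ∀ i, IsAscent w i
    · refine ⟨[], ?_⟩
      have h1 := listOf_eq_arr (J := Set.univ) (w := w) fun i _ => h i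
      have h2 := listOf_eq_arr (J := Set.univ) (w := (1 : Hyperoctahedral n)) fun i _ => by
        rw [IsAscent]
        change val (rootFst i) < val (i, 1)
        rw [val_one]
        by_cases h0 : i.val = 0
        · rw [val_rootFst_zero h0]; omega
        · rw [val_rootFst h0]; omega
      have h3 (w : Hyperoctahedral n) : faceOf Set.univ w = 0 := by
        funext p
        have : stdFace (Set.univ : Set (Fin n)) = 0 := by
          funext q
          rcases stdFace_cases Set.univ q with h | ⟨i, hi, _⟩
          · exact h
          · exact absurd (Set.mem_univ i) hi
        simp [faceOf, this, oddExt]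
      rw [h3] at h1 h2
      exact listOf_injective (h2.trans h1.symm)
    · push Not at h
      obtain ⟨i, hi⟩ := h
      have hlt := potential_lt hi
      have := hb (w * simpleReflection n i)
      obtain ⟨l, hl⟩ := ih _ (by omega) (w * simpleReflection n i) rfl
      refine ⟨l ++ [i], ?_⟩
      rw [List.map_append, List.prod_append, hl]
      simp [mul_assoc, simpleReflection_mul_self]

/-- Descents in the sense of roots are descents in the sense of the length. -/
theorem wordLength_lt {w : Hyperoctahedral n} {i : Fin n} (h : ¬IsAscent w i) :
    wordLength (simpleReflection n) (w * simpleReflection n i) <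
      wordLength (simpleReflection n) w := by
  obtain ⟨l, hl, hlw⟩ := Nat.sInf_mem (s := {m : ℕ | ∃ l : List (Fin n), l.length = m ∧
    (l.map (simpleReflection n)).prod = w}) (by
      obtain ⟨l, hl⟩ := exists_word w
      exact ⟨l.length, l, rfl, hl⟩)
  subst hlw
  obtain ⟨l', h1, h2⟩ := exists_word_of_not_isAscent l h
  refine lt_of_le_of_lt (Nat.sInf_le ⟨l', rfl, h2⟩) ?_
  rw [wordLength, ← hl]
  omega

theorem isAscent_of_mem_minCosetReps {J : Set (Fin n)} {w : Hyperoctahedral n}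
    (h : w ∈ minCosetReps (simpleReflection n) J) {j : Fin n} (hj : j ∈ J) : IsAscent w j := by
  by_contra h'
  exact absurd (wordLength_lt h')
    (not_lt.2 (h _ (Subgroup.subset_closure (Set.mem_image_of_mem _ hj))))

theorem exists_mul_mem_minCosetReps (J : Set (Fin n)) (w : Hyperoctahedral n) :
    ∃ u ∈ Subgroup.closure (simpleReflection n '' J),
      w * u ∈ minCosetReps (simpleReflection n) J := by
  obtain ⟨u, hu, hmin⟩ := exists_minimalFor_of_wellFoundedLT
    (fun u => u ∈ Subgroup.closure (simpleReflection n '' J))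
    (fun u => wordLength (simpleReflection n) (w * u)) ⟨1, one_mem _⟩
  refine ⟨u, hu, fun v hv => ?_⟩
  rw [mul_assoc]
  rcases le_total (wordLength (simpleReflection n) (w * u))
    (wordLength (simpleReflection n) (w * (u * v))) with h' | h'
  · exact h'
  · exact hmin (mul_mem hu hv) h'

theorem faceOf_mul {J : Set (Fin n)} (w : Hyperoctahedral n) {u : Hyperoctahedral n}
    (hu : u ∈ Subgroup.closure (simpleReflection n '' J)) : faceOf J (w * u) = faceOf J w := by
  funext p
  rw [faceOf, faceOf, mul_inv_rev]
  exact oddExt_stdFace_of_mem_closure (inv_mem hu) _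

/-- The minimal coset representatives are the elements which have an ascent at each `j ∈ J`. -/
theorem mem_minCosetReps {J : Set (Fin n)} {w : Hyperoctahedral n} :
    w ∈ minCosetReps (simpleReflection n) J ↔ ∀ j ∈ J, IsAscent w j := by
  refine ⟨fun h j => isAscent_of_mem_minCosetReps h, fun h => ?_⟩
  -- a minimal representative of the coset has ascents at `J` too, hence it is `w`
  obtain ⟨u, hu, hwu⟩ := exists_mul_mem_minCosetReps J w
  have h1 := listOf_eq_arr fun j => isAscent_of_mem_minCosetReps (j := j) hwu
  rw [faceOf_mul w hu, ← listOf_eq_arr h] at h1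
  rwa [listOf_injective h1] at hwu

end DescentAlg

/-! ### The elements `x_J` as sums over faces -/

namespace DescentAlg

variable {n : ℕ}

theorem letter_bijective (v : Hyperoctahedral n) :
    Function.Bijective fun p : Fin n => (v.1 (p, 1)).1 := by
  refine Function.Injective.bijective_of_finite fun p q h => ?_
  have : v.1 (p, 1) = v.1 (q, 1) ∨ v.1 (p, 1) = bar (v.1 (q, 1)) := by
    rcases Int.units_eq_one_or (v.1 (p, 1)).2 with h1 | h1 <;>
      rcases Int.units_eq_one_or (v.1 (q, 1)).2 with h2 | h2
    · exact Or.inl (Prod.ext h (h1.trans h2.symm))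
    · exact Or.inr (Prod.ext h (by simp [bar, h1, h2]))
    · exact Or.inr (Prod.ext h (by simp [bar, h1, h2]))
    · exact Or.inl (Prod.ext h (h1.trans h2.symm))
  rw [← hyp_bar, v.1.injective.eq_iff, v.1.injective.eq_iff] at this
  rcases this with h' | h' <;> exact congrArg Prod.fst h'

/-- The group permutes the faces of a given type. -/
theorem IsFace.act {J : Set (Fin n)} {g : Fin n → ℤ} (hg : IsFace J (fun _ => 1) g)
    (v : Hyperoctahedral n) : IsFace J (fun _ => 1) fun p => oddExt g (v.1 (p, 1)) := by
  constructor
  · intro p hp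
    rw [abs_oddExt]
    exact hg.label _ (by rwa [← abs_pos, ← abs_oddExt, abs_pos])
  · intro i hi
    simp only [abs_oddExt]
    rw [(letter_bijective v).sum_comp fun p => if (i : ℤ) + 1 ≤ |g p| then 1 else 0]
    exact hg.tail i hi

theorem act_act_inv (g : Fin n → ℤ) (v : Hyperoctahedral n) :
    (fun p => oddExt (fun q => oddExt g (v⁻¹.1 (q, 1))) (v.1 (p, 1))) = g := by
  have key (e : SignedLetter n) :
      oddExt (fun q => oddExt g (v⁻¹.1 (q, 1))) e = oddExt g (v⁻¹.1 e) := by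
    obtain ⟨p, ε⟩ := e
    rcases Int.units_eq_one_or ε with rfl | rfl
    · simp
    · have : ((p, -1) : SignedLetter n) = bar (p, 1) := rfl
      rw [this, oddExt_bar, hyp_bar, oddExt_bar, oddExt_one]
  funext p
  rw [key]
  simp

/-- The group acts transitively on the faces of a given type. -/
theorem exists_faceOf_eq {J : Set (Fin n)} {g : Fin n → ℤ} (hg : IsFace J (fun _ => 1) g) :
    ∃ w, faceOf J w = g := by
  classical
  have hcard (c : ℤ) : Fintype.card {p // stdFace J p = c} = Fintype.card {p // |g p| = c} := by
    have hstd : Fintype.card {p // stdFace J p = c} = Fintype.card {p // |stdFace J p| = c} :=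
      Fintype.card_congr (Equiv.subtypeEquivRight fun p => by
        rw [abs_of_nonneg (stdFace_nonneg J p)])
    rw [hstd, Fintype.card_subtype, Fintype.card_subtype, Finset.card_filter, Finset.card_filter]
    by_cases hc : c = 0
    · have h1 := (isFace_stdFace J).sum_eq hg (fun v => v ≠ 0) (by simp)
      have h2 : ∀ h : Fin n → ℤ, (∑ p, if |h p| = c then 1 else 0) +
          (∑ p, if |h p| ≠ 0 then 1 else 0) = n := by
        intro h
        rw [← Finset.sum_add_distrib, hc, Finset.sum_congr rfl (g := fun _ => 1)]
        · simp
        · intro p _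
          split_ifs <;> simp_all
      have h3 := h2 (stdFace J)
      have h4 := h2 g
      omega
    · exact (isFace_stdFace J).sum_eq hg (fun v => v = c) (Ne.symm hc)
  let e : Fin n ≃ Fin n := Equiv.ofFiberEquiv (f := stdFace J) (g := fun p => |g p|) fun c =>
    Fintype.equivOfCardEq (hcard c)
  have he (p : Fin n) : |g (e p)| = stdFace J p :=
    Equiv.ofFiberEquiv_map (f := stdFace J) (g := fun p => |g p|) _ p
  let s : Fin n → ℤˣ := fun p => if g (e p) < 0 then -1 else 1
  have hs (p : Fin n) : (s p : ℤ) * stdFace J p = g (e p) := by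
    rw [← he]
    simp only [s]
    split_ifs with h
    · rw [abs_of_neg h]; simp
    · rw [abs_of_nonneg (not_lt.1 h)]; simp
  have hss (p : Fin n) : s p * s p = 1 := Int.units_mul_self _
  let w : Hyperoctahedral n := ⟨⟨fun x => (e x.1, x.2 * s x.1),
    fun x => (e.symm x.1, x.2 * s (e.symm x.1)), fun x => by simp [mul_assoc, hss],
    fun x => by simp [mul_assoc, hss]⟩, fun i ε => by simp⟩
  refine ⟨w, funext fun p => ?_⟩
  have : w⁻¹.1 (p, 1) = (e.symm p, 1 * s (e.symm p)) := rfl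
  rw [faceOf, this, oddExt]
  simp only [one_mul, hs, Equiv.apply_symm_apply]

/-- The minimal coset representatives correspond to the faces of type `J`. -/
theorem sum_minCosetReps {M : Type*} [AddCommMonoid M] (J : Set (Fin n))
    [DecidablePred (· ∈ minCosetReps (simpleReflection n) J)] (φ : List (SignedLetter n) → M) :
    (∑ w : Hyperoctahedral n, if w ∈ minCosetReps (simpleReflection n) J then φ (listOf w) else 0) =
      ∑ f ∈ faces J (fun _ => 1), φ (arr n bar (oddExt f) (stdList n)) := by
  rw [← Finset.sum_filter]
  refine Finset.sum_bij (fun w _ => faceOf J w) ?_ ?_ ?_ ?_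
  · intro w _
    rw [mem_faces]
    exact (isFace_stdFace J).act w⁻¹
  · intro v hv w hw h
    rw [Finset.mem_filter, mem_minCosetReps] at hv hw
    have := listOf_eq_arr hv.2
    rw [h, ← listOf_eq_arr hw.2] at this
    exact listOf_injective this
  · intro f hf
    obtain ⟨w, rfl⟩ := exists_faceOf_eq (mem_faces.1 hf)
    obtain ⟨u, hu, hwu⟩ := exists_mul_mem_minCosetReps J w
    exact ⟨w * u, Finset.mem_filter.2 ⟨Finset.mem_univ _, hwu⟩, faceOf_mul w hu⟩
  · intro w hw
    rw [Finset.mem_filter, mem_minCosetReps] at hw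
    rw [listOf_eq_arr hw.2]

theorem sum_faces_act {M : Type*} [AddCommMonoid M] (J : Set (Fin n)) (v : Hyperoctahedral n)
    (φ : List (SignedLetter n) → M) :
    ∑ f ∈ faces J (fun _ => 1), φ ((arr n bar (oddExt f) (stdList n)).map v.1) =
      ∑ f ∈ faces J (fun _ => 1), φ (arr n bar (oddExt f) (listOf v)) := by
  refine Finset.sum_bij' (fun f _ p => oddExt f (v⁻¹.1 (p, 1)))
    (fun f _ p => oddExt f (v.1 (p, 1))) ?_ ?_ ?_ ?_ ?_
  · intro f hf
    rw [mem_faces] at hf ⊢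
    exact hf.act v⁻¹
  · intro f hf
    rw [mem_faces] at hf ⊢
    exact hf.act v
  · intro f _
    exact act_act_inv f v
  · intro f _
    have := act_act_inv f v⁻¹
    rwa [inv_inv] at this
  · intro f _
    rw [listOf, arr_map n bar bar v.1 (hyp_bar v)]
    congr 3
    funext e
    obtain ⟨p, ε⟩ := e
    have h1 := congrFun (act_act_inv f v) p
    rcases Int.units_eq_one_or ε with rfl | rfl
    · rw [h1, oddExt_one]
    · have : ((p, -1) : SignedLetter n) = bar (p, 1) := rfl
      rw [this, hyp_bar, oddExt_bar, oddExt_bar, h1, oddExt_one]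

section

variable (k : Type*) [CommRing k]

/-- The group element `w` with `listOf w = L`, or zero if there is none. -/
noncomputable def ofList (L : List (SignedLetter n)) : MonoidAlgebra k (Hyperoctahedral n) :=
  Function.extend listOf (fun w => MonoidAlgebra.of k _ w) 0 L

theorem ofList_listOf (w : Hyperoctahedral n) :
    ofList k (listOf w) = MonoidAlgebra.of k _ w :=
  listOf_injective.extend_apply _ _ _

/-- The element `x_J` is the sum of the chambers obtained by letting the faces of type `J` act on
the fundamental chamber. -/
theorem xElem_eq (J : Set (Fin n)) : xElem k (simpleReflection n) J =
    ∑ f ∈ faces J (fun _ => 1), ofList k (arr n bar (oddExt f) (stdList n)) := by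
  classical
  rw [← sum_minCosetReps, xElem]
  refine Finset.sum_congr rfl fun w _ => ?_
  rw [ofList_listOf]

theorem of_mul_xElem (v : Hyperoctahedral n) (J : Set (Fin n)) :
    MonoidAlgebra.of k _ v * xElem k (simpleReflection n) J =
      ∑ f ∈ faces J (fun _ => 1), ofList k (arr n bar (oddExt f) (listOf v)) := by
  classical
  rw [← sum_faces_act J v (ofList k),
    ← sum_minCosetReps J fun L => ofList k (L.map v.1), xElem, Finset.mul_sum]
  refine Finset.sum_congr rfl fun w _ => ?_
  have : (listOf w).map v.1 = listOf (v * w) := by simp [listOf, Function.comp_def]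
  rw [this, ofList_listOf]
  split_ifs with h
  · rw [map_mul]
  · rw [mul_zero]

/-- The structure constants of the descent algebra are those of the composition of faces. -/
theorem xElem_mul_xElem (J K : Set (Fin n)) :
    xElem k (simpleReflection n) K * xElem k (simpleReflection n) J =
      ∑ I : Set (Fin n), structConst J K I • xElem k (simpleReflection n) I := by
  classical
  have h1 : xElem k (simpleReflection n) K * xElem k (simpleReflection n) J =
      ∑ w : Hyperoctahedral n, if w ∈ minCosetReps (simpleReflection n) K then
        ∑ f ∈ faces J (fun _ => 1), ofList k (arr n bar (oddExt f) (listOf w)) else 0 := by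
    nth_rewrite 1 [xElem]
    rw [Finset.sum_mul]
    refine Finset.sum_congr rfl fun w _ => ?_
    split_ifs with h
    · exact of_mul_xElem k w J
    · rw [zero_mul]
  rw [h1, sum_minCosetReps K fun L => ∑ f ∈ faces J (fun _ => 1), ofList k (arr n bar (oddExt f) L),
    sum_faces_faces (fun _ => one_pos) (by simp)]
  exact Finset.sum_congr rfl fun I _ => by rw [xElem_eq]

theorem faces_univ {r : ℕ} (wt : Fin r → ℕ) : faces (Set.univ : Set (Fin n)) wt = {0} := by
  ext g
  rw [mem_faces, Finset.mem_singleton]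
  constructor
  · intro h
    funext l
    by_contra hl
    obtain ⟨i, hi, _⟩ := h.label l hl
    exact hi (Set.mem_univ i)
  · rintro rfl
    exact ⟨fun l hl => absurd rfl hl, fun i hi => absurd (Set.mem_univ i) hi⟩

theorem arr_zero {α : Type*} (ν : α → α) (L : List α) : arr n ν (fun _ => 0) L = L := by
  have h (m : ℕ) : decide ((0 : ℤ) = -((m : ℤ) + 1)) = false := by
    rw [decide_eq_false_iff_not]; omega
  have h' (m : ℕ) : decide ((0 : ℤ) = (m : ℤ) + 1) = false := by
    rw [decide_eq_false_iff_not]; omega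
  simp only [arr, h, h', decide_true, List.filter_true, List.filter_false, List.map_nil,
    List.reverse_nil, List.append_nil]
  simp

theorem xElem_univ : xElem k (simpleReflection n) Set.univ = 1 := by
  rw [xElem_eq, faces_univ, Finset.sum_singleton]
  have h1 : oddExt (0 : Fin n → ℤ) = fun _ => 0 := by
    funext e
    simp [oddExt]
  have h2 : stdList n = listOf (1 : Hyperoctahedral n) := by
    simp [listOf]
  rw [h1, arr_zero, h2, ofList_listOf, map_one]

/-- Solomon's theorem: the span of the elements `x_J` is closed under multiplication. -/
theorem toSubmodule_descentAlgebra :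
    Subalgebra.toSubmodule (descentAlgebra k (simpleReflection n)) =
      descentSpan k (simpleReflection n) := by
  refine le_antisymm ?_ (Submodule.span_le.2 Algebra.subset_adjoin)
  have hone : (1 : MonoidAlgebra k (Hyperoctahedral n)) ∈ descentSpan k (simpleReflection n) :=
    xElem_univ (n := n) k ▸ Submodule.subset_span (Set.mem_range_self Set.univ)
  have hmul : ∀ x y, x ∈ descentSpan k (simpleReflection n) →
      y ∈ descentSpan k (simpleReflection n) → x * y ∈ descentSpan k (simpleReflection n) := by
    intro x y hx hy
    refine Submodule.span_induction₂ (p := fun x y _ _ => x * y ∈ descentSpan k _) ?_ ?_ ?_ ?_ ?_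
      ?_ ?_ hx hy
    · rintro _ _ ⟨K, rfl⟩ ⟨J, rfl⟩
      rw [xElem_mul_xElem]
      exact Submodule.sum_mem _ fun I _ =>
        nsmul_mem (Submodule.subset_span (Set.mem_range_self I)) _
    · intro y _
      rw [zero_mul]
      exact zero_mem _
    · intro x _
      rw [mul_zero]
      exact zero_mem _
    · intro x y z _ _ _ hx hy
      rw [add_mul]
      exact add_mem hx hy
    · intro x y z _ _ _ hx hy
      rw [mul_add]
      exact add_mem hx hy
    · intro r x y _ _ h
      rw [smul_mul_assoc]
      exact Submodule.smul_mem _ r h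
    · intro r x y _ _ h
      rw [mul_smul_comm]
      exact Submodule.smul_mem _ r h
  exact (Algebra.adjoin_le (S := (descentSpan k (simpleReflection n)).toSubalgebra hone hmul)
    Submodule.subset_span)

end

theorem oddExt_stdFace_mono (J : Set (Fin n)) {e e' : SignedLetter n} (h : val e ≤ val e') :
    oddExt (stdFace J) e ≤ oddExt (stdFace J) e' := by
  obtain ⟨p, ε⟩ := e
  obtain ⟨q, δ⟩ := e'
  have hp := stdFace_nonneg J p
  have hq := stdFace_nonneg J q
  rcases Int.units_eq_one_or ε with rfl | rfl <;> rcases Int.units_eq_one_or δ with rfl | rfl <;>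
    simp only [val_one, val_neg_one, oddExt_one, oddExt_neg_one] at h ⊢
  · exact stdFace_mono J (Fin.le_def.2 (by omega))
  · omega
  · omega
  · exact neg_le_neg (stdFace_mono J (Fin.le_def.2 (by omega)))

/-- Every set of generators is the set of ascents of some element: the longest element of the
parabolic subgroup of the complement. -/
theorem exists_isAscent_iff (K : Set (Fin n)) :
    ∃ w : Hyperoctahedral n, ∀ i, IsAscent w i ↔ i ∈ K := by
  classical
  obtain ⟨w, hw, hmin⟩ := Finset.exists_min_image (Finset.univ.filter fun u =>
    u ∈ Subgroup.closure (simpleReflection n '' Kᶜ)) potential ⟨1, by simp [one_mem]⟩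
  simp only [Finset.mem_filter, Finset.mem_univ, true_and] at hw hmin
  refine ⟨w, fun i => ⟨fun h => ?_, fun h => ?_⟩⟩
  · by_contra hi
    have h1 : ¬IsAscent (w * simpleReflection n i) i := by
      have e1 : (w * simpleReflection n i).1 (rootFst i) = w.1 (i, 1) := by
        change w.1 ((simpleReflection n i).1 _) = _
        rw [simpleReflection_apply, if_pos rfl]
      have e2 : (w * simpleReflection n i).1 (i, 1) = w.1 (rootFst i) := by
        change w.1 ((simpleReflection n i).1 _) = _
        rw [simpleReflection_apply, if_neg (rootFst_ne i).symm, if_pos rfl]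
      rw [IsAscent, e1, e2]
      exact not_lt.2 (le_of_lt h)
    have h2 := potential_lt h1
    rw [mul_assoc, simpleReflection_mul_self, mul_one] at h2
    exact absurd (hmin _ (mul_mem hw (Subgroup.subset_closure (Set.mem_image_of_mem _ hi))))
      (not_le.2 h2)
  · have hi : i ∉ Kᶜ := fun h' => h' h
    -- the endpoints of the root lie in different blocks, and `w` preserves the blocks
    have hlt : oddExt (stdFace Kᶜ) (rootFst i) < oddExt (stdFace Kᶜ) (i, 1) := by
      rw [oddExt_one, stdFace_self hi]
      by_cases h0 : i.val = 0
      · rw [rootFst, if_pos h0, oddExt_neg_one, stdFace_self hi]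
        omega
      · rw [rootFst, if_neg h0, oddExt_one, ← not_le, le_stdFace hi, not_le, Fin.lt_def]
        simp only
        omega
    rw [← oddExt_stdFace_of_mem_closure hw, ← oddExt_stdFace_of_mem_closure hw (i, 1)] at hlt
    by_contra h'
    exact absurd (oddExt_stdFace_mono _ (not_lt.1 h')) (not_le.2 hlt)

/-- The matrix of the coefficients of the `x_J` at elements with prescribed ascent sets is
unitriangular. -/
theorem linearIndependent_xElem (k : Type*) [CommRing k] :
    LinearIndependent k (xElem k (simpleReflection n)) := by
  classical
  rw [Fintype.linearIndependent_iff]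
  intro c hc J
  -- by induction on `J`, comparing the coefficients of an element with ascent set `J`
  induction J using WellFoundedLT.induction with
  | _ K ih =>
    obtain ⟨w, hw⟩ := exists_isAscent_iff K
    have h1 (J : Set (Fin n)) :
        (xElem k (simpleReflection n) J).coeff w = if J ⊆ K then 1 else 0 := by
      rw [xElem, MonoidAlgebra.coeff_sum, Finsupp.finsetSum_apply, Finset.sum_eq_single w]
      · have : w ∈ minCosetReps (simpleReflection n) J ↔ J ⊆ K := by
          rw [mem_minCosetReps]
          exact forall₂_congr fun j _ => hw j
        by_cases hJ : J ⊆ K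
        · rw [if_pos (this.2 hJ), if_pos hJ]
          simp
        · rw [if_neg (fun h => hJ (this.1 h)), if_neg hJ]
          rfl
      · intro v _ hv
        split_ifs
        · simp [hv]
        · rfl
      · simp
    have h2 := congrArg (fun x => x.coeff w) hc
    simp only [MonoidAlgebra.coeff_sum, Finsupp.finsetSum_apply, MonoidAlgebra.coeff_smul_apply,
      h1] at h2
    rw [Finset.sum_eq_single K] at h2
    · simpa using h2
    · intro J _ hJ
      split_ifs with hJK
      · rw [ih J (lt_of_le_of_ne hJK hJ), zero_smul]
      · rw [smul_zero]
    · simp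

end DescentAlg

/-! ### Words and the operators on words given by the faces of type `J` -/

namespace DescentAlg

/-- The algebra of noncommutative polynomials in the letters `α`, with basis the words. -/
abbrev WordAlg (k α : Type*) [CommRing k] : Type _ := MonoidAlgebra k (FreeMonoid α)

section

variable (k : Type*) [CommRing k] {α : Type*}

/-- The basis element given by a word. -/
noncomputable def word (l : List α) : WordAlg k α := MonoidAlgebra.of k _ (FreeMonoid.ofList l)

theorem word_append (l l' : List α) : word k (l ++ l') = word k l * word k l' := by
  rw [word, FreeMonoid.ofList_append, map_mul]
  rfl

theorem word_nil : word k ([] : List α) = 1 := map_one _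

theorem word_eq_prod (l : List α) : word k l = (l.map fun a => word k [a]).prod := by
  induction l with
  | nil => exact word_nil k
  | cons a l ih => rw [List.map_cons, List.prod_cons, ← ih, ← word_append, List.singleton_append]

variable {k}

/-- The linear map with given values on the words. -/
noncomputable def wordLift {M : Type*} [AddCommGroup M] [Module k M] (F : List α → M) :
    WordAlg k α →ₗ[k] M :=
  (MonoidAlgebra.basis (FreeMonoid α) k).constr k fun m => F m.toList

@[simp] theorem wordLift_word {M : Type*} [AddCommGroup M] [Module k M] (F : List α → M)
    (l : List α) : wordLift F (word k l) = F l := by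
  have : word k l = MonoidAlgebra.basis (FreeMonoid α) k (FreeMonoid.ofList l) := by
    rw [MonoidAlgebra.basis_apply]
    rfl
  rw [this, wordLift, Module.Basis.constr_basis]
  rfl

theorem wordAlg_hom_ext {M : Type*} [AddCommGroup M] [Module k M] {f g : WordAlg k α →ₗ[k] M}
    (h : ∀ l, f (word k l) = g (word k l)) : f = g :=
  (MonoidAlgebra.basis (FreeMonoid α) k).ext fun m => by
    rw [MonoidAlgebra.basis_apply]
    exact h m.toList

theorem coeff_word (l : List α) (m : FreeMonoid α) [Decidable (l = m.toList)] :
    (word k l).coeff m = if l = m.toList then 1 else 0 := by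
  classical
  rw [word, MonoidAlgebra.of_apply, MonoidAlgebra.coeff_single, Finsupp.single_apply]
  exact if_congr Iff.rfl rfl rfl

end

section

variable (k : Type*) [CommRing k] {n : ℕ}

/-- Attach a label in `{-n, …, n}` to each letter of a word, in all possible ways. -/
noncomputable def label (n : ℕ) : WordAlg k ℕ →ₐ[k] WordAlg k (ℕ × ℤ) :=
  MonoidAlgebra.lift k _ _ (FreeMonoid.lift fun x =>
    ∑ v ∈ Finset.Icc (-(n : ℤ)) n, word k [(x, v)])

theorem label_letter (x : ℕ) :
    label k n (word k [x]) = ∑ v ∈ Finset.Icc (-(n : ℤ)) n, word k [(x, v)] := by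
  rw [label, word, MonoidAlgebra.lift_of]
  exact FreeMonoid.lift_eval_of _ _

/-- The labels of a labelled word form a face of type `J`, the weight of a letter being its
value. -/
structure IsLabelled (J : Set (Fin n)) (z : List (ℕ × ℤ)) : Prop where
  label : ∀ p ∈ z, p.2 ≠ 0 → ∃ i : Fin n, i ∉ J ∧ |p.2| = (i : ℤ) + 1
  tail : ∀ i : Fin n, i ∉ J →
    (z.map fun p => if (i : ℤ) + 1 ≤ |p.2| then p.1 else 0).sum + i = n

/-- The word obtained from a labelled word by the action of its labels. -/
def arrange (n : ℕ) (z : List (ℕ × ℤ)) : List ℕ :=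
  (arr n (fun p => (p.1, -p.2)) Prod.snd z).map Prod.fst

open Classical in
/-- The linear extension of `arrange` to the labelled words whose labels form a face of type
`J`; the other labelled words are sent to zero. -/
noncomputable def arrangeHom (J : Set (Fin n)) : WordAlg k (ℕ × ℤ) →ₗ[k] WordAlg k ℕ :=
  wordLift fun z => if IsLabelled J z then word k (arrange n z) else 0

/-- The operator on words which is the sum of the actions of all faces of type `J`. -/
noncomputable def faceOp (J : Set (Fin n)) : WordAlg k ℕ →ₗ[k] WordAlg k ℕ :=
  arrangeHom k J ∘ₗ (label k n).toLinearMap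

theorem prod_ofFn_sum {A ι : Type*} [Ring A] {m : ℕ} (S : Finset ι) (F : Fin m → ι → A) :
    (List.ofFn fun i => ∑ v ∈ S, F i v).prod =
      ∑ g ∈ Fintype.piFinset fun _ : Fin m => S, (List.ofFn fun i => F i (g i)).prod := by
  classical
  induction m with
  | zero => simp
  | succ m ih =>
    rw [List.ofFn_succ, List.prod_cons, ih, Finset.sum_mul_sum, ← Finset.sum_product']
    refine Finset.sum_bij' (fun x _ => Fin.cons x.1 x.2) (fun g _ => (g 0, Fin.tail g)) ?_ ?_ ?_
      ?_ ?_
    · rintro ⟨v, g⟩ h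
      rw [Finset.mem_product, Fintype.mem_piFinset] at h
      rw [Fintype.mem_piFinset]
      intro i
      refine Fin.cases ?_ (fun i => ?_) i
      · exact h.1
      · exact h.2 i
    · intro g h
      rw [Fintype.mem_piFinset] at h
      rw [Finset.mem_product, Fintype.mem_piFinset]
      exact ⟨h 0, fun i => h i.succ⟩
    · intro x _
      simp
    · intro g _
      simp
    · intro x _
      simp [List.ofFn_succ]

theorem map_eq_ofFn {β γ : Type*} (L : List β) (F : β → γ) :
    L.map F = List.ofFn fun i : Fin L.length => F (L.get i) := by
  conv_lhs => rw [← List.ofFn_get L]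
  rw [List.map_ofFn]
  rfl

theorem oddExt_ne_zero_iff {r : ℕ} {f : Fin r → ℤ} {e : SignedLetter r} :
    oddExt f e ≠ 0 ↔ f e.1 ≠ 0 := by
  rw [← abs_pos, abs_oddExt, abs_pos]

/-- `L` lists each letter exactly once, with a sign. -/
structure IsSignedList {r : ℕ} (L : List (SignedLetter r)) : Prop where
  nodup : (L.map Prod.fst).Nodup
  mem : ∀ l, l ∈ L.map Prod.fst

theorem IsChamber.isSignedList {r : ℕ} {K : Type*} [AddCommGroup K] [LinearOrder K]
    [IsOrderedAddMonoid K] {κ : SignedLetter r → K} {L : List (SignedLetter r)}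
    (h : IsChamber κ L) (hκ : ∀ e, κ (bar e) = -κ e) (hκ0 : ∀ e, κ e ≠ 0) : IsSignedList L := by
  constructor
  · rw [List.Nodup, List.pairwise_map]
    refine List.Pairwise.imp_of_mem (fun {e e'} he he' hlt heq => ?_) h.sorted
    have : e' = e ∨ e' = bar e := by
      rcases Int.units_eq_one_or e.2 with h1 | h1 <;> rcases Int.units_eq_one_or e'.2 with h2 | h2
      · exact Or.inl (Prod.ext heq.symm (h2.trans h1.symm))
      · exact Or.inr (Prod.ext heq.symm (by simp [bar, h1, h2]))
      · exact Or.inr (Prod.ext heq.symm (by simp [bar, h1, h2]))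
      · exact Or.inl (Prod.ext heq.symm (h2.trans h1.symm))
    rcases this with rfl | rfl
    · exact lt_irrefl _ hlt
    · have h1 := (h.mem_iff _).1 he
      have h2 := (h.mem_iff _).1 he'
      rw [hκ] at h2
      exact lt_asymm h1 (neg_pos.1 h2)
  · intro l
    rw [List.mem_map]
    rcases lt_or_gt_of_ne (hκ0 (l, 1)) with h' | h'
    · refine ⟨bar (l, 1), (h.mem_iff _).2 ?_, rfl⟩
      rw [hκ]
      exact neg_pos.2 h'
    · exact ⟨(l, 1), (h.mem_iff _).2 h', rfl⟩

theorem IsSignedList.sum_map {r : ℕ} {L : List (SignedLetter r)} (hL : IsSignedList L)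
    {M : Type*} [AddCommMonoid M] (F : Fin r → M) : (L.map fun e => F e.1).sum = ∑ l, F l := by
  have h1 : (L.map fun e => F e.1) = (L.map Prod.fst).map F := by simp
  rw [h1, ← List.sum_toFinset _ hL.nodup]
  refine Finset.sum_congr (Finset.eq_univ_iff_forall.2 fun l => ?_) fun _ _ => rfl
  exact List.mem_toFinset.2 (hL.mem l)

theorem label_word_of_isSignedList {r : ℕ} {L : List (SignedLetter r)} (hL : IsSignedList L)
    (x : Fin r → ℕ) : label k n (word k (L.map fun e => x e.1)) =
      ∑ f ∈ Fintype.piFinset fun _ : Fin r => Finset.Icc (-(n : ℤ)) n,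
        word k (L.map fun e => (x e.1, oddExt f e)) := by
  have h1 : label k n (word k (L.map fun e => x e.1)) = (List.ofFn fun i : Fin L.length =>
      ∑ v ∈ Finset.Icc (-(n : ℤ)) n, word k [(x (L.get i).1, v)]).prod := by
    rw [word_eq_prod, map_list_prod, List.map_map, List.map_map, map_eq_ofFn]
    congr 2
    funext i
    exact label_letter k _
  rw [h1, prod_ofFn_sum]
  have hbij : Function.Bijective fun i : Fin L.length => (L.get i).1 := by
    constructor
    · intro i j hij
      have := List.nodup_iff_injective_get.1 hL.nodup (a₁ := Fin.cast (by simp) i)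
        (a₂ := Fin.cast (by simp) j) (by simpa using hij)
      simpa [Fin.ext_iff] using this
    · intro l
      obtain ⟨e, he, rfl⟩ := List.mem_map.1 (hL.mem l)
      obtain ⟨i, rfl⟩ := List.get_of_mem he
      exact ⟨i, rfl⟩
  let b := Equiv.ofBijective _ hbij
  have hb (i : Fin L.length) : b i = (L.get i).1 := rfl
  have hsign (ε : ℤˣ) (v : ℤ) : ((ε : ℤ) * v ∈ Finset.Icc (-(n : ℤ)) n) ↔
      v ∈ Finset.Icc (-(n : ℤ)) n := by
    rcases Int.units_eq_one_or ε with rfl | rfl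
    · simp
    · simp only [Units.val_neg, Units.val_one, neg_mul, one_mul, Finset.mem_Icc]
      omega
  have hss (ε : ℤˣ) (v : ℤ) : (ε : ℤ) * ((ε : ℤ) * v) = v := by
    rw [← mul_assoc, ← Units.val_mul, Int.units_mul_self]
    simp
  refine Finset.sum_bij' (fun g _ l => ((L.get (b.symm l)).2 : ℤ) * g (b.symm l))
    (fun f _ i => oddExt f (L.get i)) ?_ ?_ ?_ ?_ ?_
  · intro g hg
    rw [Fintype.mem_piFinset] at hg ⊢
    intro l
    rw [hsign]
    exact hg _
  · intro f hf
    rw [Fintype.mem_piFinset] at hf ⊢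
    intro i
    rw [oddExt, hsign]
    exact hf _
  · intro g _
    funext i
    simp only [oddExt]
    rw [← hb, b.symm_apply_apply, hss]
  · intro f _
    funext l
    simp only [oddExt]
    rw [hss, ← hb, b.apply_symm_apply]
  · intro g _
    rw [word_eq_prod, List.map_map, map_eq_ofFn]
    congr 2
    funext i
    simp only [Function.comp_apply, oddExt]
    rw [← hb, b.symm_apply_apply, hss]

theorem isLabelled_map_iff {r : ℕ} {L : List (SignedLetter r)} (hL : IsSignedList L)
    (J : Set (Fin n)) (x : Fin r → ℕ) (f : Fin r → ℤ) :
    IsLabelled J (L.map fun e => (x e.1, oddExt f e)) ↔ IsFace J x f := by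
  have h1 (i : Fin n) : ((L.map fun e => (x e.1, oddExt f e)).map
      fun p => if (i : ℤ) + 1 ≤ |p.2| then p.1 else 0).sum =
        ∑ l, if (i : ℤ) + 1 ≤ |f l| then x l else 0 := by
    rw [List.map_map, ← hL.sum_map fun l => if (i : ℤ) + 1 ≤ |f l| then x l else 0]
    congr 2
    funext e
    simp only [Function.comp_apply, abs_oddExt]
  constructor
  · intro h
    refine ⟨fun l hl => ?_, fun i hi => ?_⟩
    · obtain ⟨e, he, rfl⟩ := List.mem_map.1 (hL.mem l)
      obtain ⟨i, hi, h'⟩ := h.label _ (List.mem_map_of_mem he)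
        (oddExt_ne_zero_iff.2 hl)
      rw [abs_oddExt] at h'
      exact ⟨i, hi, h'⟩
    · have := h.tail i hi
      rwa [h1] at this
  · intro h
    refine ⟨fun p hp hp0 => ?_, fun i hi => ?_⟩
    · obtain ⟨e, he, rfl⟩ := List.mem_map.1 hp
      simp only [abs_oddExt]
      exact h.label _ (oddExt_ne_zero_iff.1 hp0)
    · rw [h1]
      exact h.tail i hi

theorem faceOp_word_of_isSignedList {r : ℕ} {L : List (SignedLetter r)} (hL : IsSignedList L)
    (J : Set (Fin n)) (x : Fin r → ℕ) : faceOp k J (word k (L.map fun e => x e.1)) =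
      ∑ f ∈ faces J x, word k ((arr n bar (oddExt f) L).map fun e => x e.1) := by
  classical
  rw [faceOp, LinearMap.comp_apply, AlgHom.toLinearMap_apply, label_word_of_isSignedList k hL,
    map_sum, faces, Finset.sum_filter]
  refine Finset.sum_congr rfl fun f _ => ?_
  rw [arrangeHom, wordLift_word]
  refine if_congr (isLabelled_map_iff hL J x f) ?_ rfl
  rw [arrange, arr_map n bar (fun p => (p.1, -p.2)) (fun e => (x e.1, oddExt f e)) fun e => by
    rw [oddExt_bar, bar], List.map_map]
  rfl

theorem isSignedList_stdList (r : ℕ) : IsSignedList (stdList r) :=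
  (isChamber_stdList r).isSignedList val_bar val_ne_zero

theorem map_stdList {r : ℕ} (x : Fin r → ℕ) : (stdList r).map (fun e => x e.1) = List.ofFn x := by
  rw [stdList, List.map_map, List.ofFn_eq_map]
  rfl

theorem faceOp_ofFn (J : Set (Fin n)) {r : ℕ} (x : Fin r → ℕ) :
    faceOp k J (word k (List.ofFn x)) =
      ∑ f ∈ faces J x, word k ((arr n bar (oddExt f) (stdList r)).map fun e => x e.1) := by
  rw [← map_stdList, faceOp_word_of_isSignedList k (isSignedList_stdList r)]

theorem isSignedList_arr {J : Set (Fin n)} {r : ℕ} {x : Fin r → ℕ} {f : Fin r → ℤ}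
    (hf : IsFace J x f) : IsSignedList (arr n bar (oddExt f) (stdList r)) :=
  ((isChamber_stdList r).arr val_bar val_ne_zero (oddExt_bar f) hf.oddExt_le).isSignedList
    (lexKey_bar (oddExt_bar f) val_bar) (lexKey_ne_zero val_ne_zero)

/-- A word is valid if its letters are positive and its weight is at most `n`. -/
def IsValid (n : ℕ) (w : List ℕ) : Prop := (∀ x ∈ w, 0 < x) ∧ w.sum ≤ n

/-- The operators multiply in the same way as the elements `x_J`, but in the opposite order. -/
theorem faceOp_faceOp (J K : Set (Fin n)) {w : List ℕ} (hw : IsValid n w) :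
    faceOp k J (faceOp k K (word k w)) =
      ∑ I : Set (Fin n), structConst J K I • faceOp k I (word k w) := by
  obtain ⟨hpos, hsum⟩ := hw
  obtain ⟨r, x, rfl⟩ : ∃ (r : ℕ) (x : Fin r → ℕ), w = List.ofFn x :=
    ⟨w.length, w.get, (List.ofFn_get w).symm⟩
  rw [List.sum_ofFn] at hsum
  have h1 := sum_faces_faces (M := WordAlg k ℕ) (fun l => hpos (x l) (by simp [List.mem_ofFn]))
    hsum J K fun L => word k (L.map fun e => x e.1)
  have h2 : ∑ I : Set (Fin n), structConst J K I • faceOp k I (word k (List.ofFn x)) =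
      ∑ I : Set (Fin n), structConst J K I • ∑ f ∈ faces I x,
        word k ((arr n bar (oddExt f) (stdList r)).map fun e => x e.1) :=
    Finset.sum_congr rfl fun I _ => by rw [faceOp_ofFn]
  rw [h2, ← h1, faceOp_ofFn, map_sum]
  refine Finset.sum_congr rfl fun g hg => ?_
  exact faceOp_word_of_isSignedList k (isSignedList_arr (mem_faces.1 hg)) J x

theorem faceOp_univ (w : List ℕ) : faceOp k (Set.univ : Set (Fin n)) (word k w) = word k w := by
  obtain ⟨r, x, rfl⟩ : ∃ (r : ℕ) (x : Fin r → ℕ), w = List.ofFn x :=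
    ⟨w.length, w.get, (List.ofFn_get w).symm⟩
  have h1 : oddExt (0 : Fin r → ℤ) = fun _ => 0 := by
    funext e
    simp [oddExt]
  rw [faceOp_ofFn, faces_univ, Finset.sum_singleton, h1, arr_zero, map_stdList]

end

end DescentAlg

/-! ### Compatibility of the operators with commutators -/

namespace DescentAlg

section

variable {n : ℕ}

/-- The letters with a given label in a labelled word. -/
def select (v : ℤ) (z : List (ℕ × ℤ)) : List ℕ := (z.filter fun p => p.2 = v).map Prod.fst

theorem select_append (v : ℤ) (z z' : List (ℕ × ℤ)) :
    select v (z ++ z') = select v z ++ select v z' := by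
  simp [select]

theorem select_map_self (v : ℤ) (ys : List ℕ) : select v (ys.map fun y => (y, v)) = ys := by
  simp [select, List.filter_map, Function.comp_def]

theorem select_map_of_ne {v v' : ℤ} (h : v ≠ v') (ys : List ℕ) :
    select v' (ys.map fun y => (y, v)) = [] := by
  simp [select, List.filter_map, Function.comp_def, h]

theorem mem_of_mem_select {v : ℤ} {z : List (ℕ × ℤ)} {x : ℕ} (h : x ∈ select v z) :
    x ∈ z.map Prod.fst := by
  obtain ⟨p, hp, rfl⟩ := List.mem_map.1 h
  exact List.mem_map_of_mem (List.mem_of_mem_filter hp)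

theorem arrange_eq (z : List (ℕ × ℤ)) : arrange n z = select 0 z ++
    (List.range n).flatMap fun (m : ℕ) =>
      (select (-((m : ℤ) + 1)) z).reverse ++ select ((m : ℤ) + 1) z := by
  simp [arrange, arr, select, List.map_flatMap, Function.comp_def]

theorem mem_of_mem_arrange {z : List (ℕ × ℤ)} {x : ℕ} (h : x ∈ arrange n z) :
    x ∈ z.map Prod.fst := by
  rw [arrange_eq, List.mem_append, List.mem_flatMap] at h
  rcases h with h | ⟨m, -, h⟩
  · exact mem_of_mem_select h
  · rw [List.mem_append, List.mem_reverse] at h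
    rcases h with h | h
    · exact mem_of_mem_select h
    · exact mem_of_mem_select h

/-- Neighbouring letters with different labels may be interchanged. -/
theorem arrange_swap {v v' : ℤ} (h : v ≠ v') (x y : ℕ) (z₁ z₂ : List (ℕ × ℤ)) :
    arrange n (z₁ ++ [(x, v), (y, v')] ++ z₂) = arrange n (z₁ ++ [(y, v'), (x, v)] ++ z₂) := by
  have key (u : ℤ) : select u (z₁ ++ [(x, v), (y, v')] ++ z₂) =
      select u (z₁ ++ [(y, v'), (x, v)] ++ z₂) := by
    have : select u [(x, v), (y, v')] = select u [(y, v'), (x, v)] := by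
      by_cases h1 : v = u
      · have h2 : v' ≠ u := fun h' => h (h1.trans h'.symm)
        simp [select, h1, h2]
      · simp [select, List.filter_cons, h1]
    rw [select_append, select_append, select_append, select_append, this]
  simp only [arrange_eq, key]

theorem exists_arrange_zero (z₁ z₂ : List (ℕ × ℤ)) : ∃ Q : List ℕ, ∀ ys : List ℕ,
    arrange n (z₁ ++ ys.map (fun y => (y, 0)) ++ z₂) = select 0 z₁ ++ ys ++ (select 0 z₂ ++ Q) := by
  refine ⟨(List.range n).flatMap fun (m : ℕ) => (select (-((m : ℤ) + 1)) (z₁ ++ z₂)).reverse ++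
    select ((m : ℤ) + 1) (z₁ ++ z₂), fun ys => ?_⟩
  have h1 (m : ℕ) : (0 : ℤ) ≠ -((m : ℤ) + 1) := by omega
  have h2 (m : ℕ) : (0 : ℤ) ≠ (m : ℤ) + 1 := by omega
  simp only [arrange_eq, select_append, select_map_self, select_map_of_ne (h1 _),
    select_map_of_ne (h2 _), List.nil_append, List.append_assoc]

/-- A sequence of neighbouring letters with a common nonzero label stays together; it is reversed
if the label is negative. -/
theorem exists_arrange_of_lt {m : ℕ} (hm : m < n) (z₁ z₂ : List (ℕ × ℤ)) :
    ∃ A B : List ℕ, ∀ ys : List ℕ,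
      arrange n (z₁ ++ ys.map (fun y => (y, (m : ℤ) + 1)) ++ z₂) =
        (A ++ (select (-((m : ℤ) + 1)) (z₁ ++ z₂)).reverse ++ select ((m : ℤ) + 1) z₁) ++ ys ++
          (select ((m : ℤ) + 1) z₂ ++ B) ∧
      arrange n (z₁ ++ ys.map (fun y => (y, -((m : ℤ) + 1))) ++ z₂) =
        (A ++ (select (-((m : ℤ) + 1)) z₂).reverse) ++ ys.reverse ++
          ((select (-((m : ℤ) + 1)) z₁).reverse ++ select ((m : ℤ) + 1) (z₁ ++ z₂) ++ B) := by
  obtain ⟨A, B, hAB⟩ := List.append_of_mem (List.mem_range.2 hm)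
  have hnd : (A ++ m :: B).Nodup := hAB ▸ List.nodup_range
  rw [List.nodup_append, List.nodup_cons] at hnd
  have hA : ∀ j ∈ A, j ≠ m := fun j hj => hnd.2.2 j hj m List.mem_cons_self
  have hB : ∀ j ∈ B, j ≠ m := fun j hj h => hnd.2.1.1 (h ▸ hj)
  let block (z : List (ℕ × ℤ)) (m : ℕ) : List ℕ :=
    (select (-((m : ℤ) + 1)) z).reverse ++ select ((m : ℤ) + 1) z
  have hblock {v : ℤ} {j : ℕ} (h1 : v ≠ -((j : ℤ) + 1)) (h2 : v ≠ (j : ℤ) + 1) (ys : List ℕ) :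
      block (z₁ ++ ys.map (fun y => (y, v)) ++ z₂) j = block (z₁ ++ z₂) j := by
    simp only [block, select_append, select_map_of_ne h1, select_map_of_ne h2, List.append_nil]
  have hflat {v : ℤ} (hv : v = (m : ℤ) + 1 ∨ v = -((m : ℤ) + 1)) (C : List ℕ)
      (hC : ∀ j ∈ C, j ≠ m) (ys : List ℕ) :
      C.flatMap (block (z₁ ++ ys.map (fun y => (y, v)) ++ z₂)) = C.flatMap (block (z₁ ++ z₂)) := by
    rw [List.flatMap_def, List.flatMap_def]
    congr 1
    refine List.map_congr_left fun j hj => ?_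
    have := hC j hj
    exact hblock (by omega) (by omega) ys
  have harr (z : List (ℕ × ℤ)) : arrange n z =
      select 0 z ++ (A.flatMap (block z) ++ (block z m ++ B.flatMap (block z))) := by
    rw [arrange_eq, hAB, List.flatMap_append, List.flatMap_cons]
  refine ⟨select 0 (z₁ ++ z₂) ++ A.flatMap (block (z₁ ++ z₂)), B.flatMap (block (z₁ ++ z₂)),
    fun ys => ⟨?_, ?_⟩⟩
  · have h0 : (m : ℤ) + 1 ≠ 0 := by omega
    have h1 : (m : ℤ) + 1 ≠ -((m : ℤ) + 1) := by omega
    rw [harr, hflat (Or.inl rfl) A hA, hflat (Or.inl rfl) B hB]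
    simp only [block, select_append, select_map_self, select_map_of_ne h0, select_map_of_ne h1,
      List.nil_append, List.append_assoc, List.reverse_append]
  · have h0 : -((m : ℤ) + 1) ≠ 0 := by omega
    have h1 : -((m : ℤ) + 1) ≠ (m : ℤ) + 1 := by omega
    rw [harr, hflat (Or.inr rfl) A hA, hflat (Or.inr rfl) B hB]
    simp only [block, select_append, select_map_self, select_map_of_ne h0, select_map_of_ne h1,
      List.nil_append, List.append_assoc, List.reverse_append]

theorem IsLabelled.perm {J : Set (Fin n)} {z z' : List (ℕ × ℤ)} (h : IsLabelled J z)
    (hz : z.Perm z') : IsLabelled J z' :=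
  ⟨fun p hp => h.label p (hz.mem_iff.2 hp), fun i hi => by
    rw [← (hz.map _).sum_eq]
    exact h.tail i hi⟩

theorem sum_map_ite (ys : List ℕ) (c : Prop) [Decidable c] :
    (ys.map fun y => if c then y else 0).sum = if c then ys.sum else 0 := by
  split_ifs <;> simp

/-- Whether the labels form a face of a given type is not affected by splitting a letter. -/
theorem isLabelled_split_iff (J : Set (Fin n)) (z₁ z₂ : List (ℕ × ℤ)) (v : ℤ) {ys : List ℕ}
    (hys : ys ≠ []) : IsLabelled J (z₁ ++ ys.map (fun y => (y, v)) ++ z₂) ↔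
      IsLabelled J (z₁ ++ [(ys.sum, v)] ++ z₂) := by
  have h1 (i : ℤ) : ((z₁ ++ ys.map (fun y => (y, v)) ++ z₂).map
      fun p => if i + 1 ≤ |p.2| then p.1 else 0).sum =
      ((z₁ ++ [(ys.sum, v)] ++ z₂).map fun p => if i + 1 ≤ |p.2| then p.1 else 0).sum := by
    simp only [List.map_append, List.map_map, List.sum_append, Function.comp_def, List.map_cons,
      List.map_nil, List.sum_cons, List.sum_nil, add_zero, sum_map_ite ys]
  have h2 (q : ℤ → Prop) : (∀ p ∈ z₁ ++ ys.map (fun y => (y, v)) ++ z₂, q p.2) ↔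
      ∀ p ∈ z₁ ++ [(ys.sum, v)] ++ z₂, q p.2 := by
    obtain ⟨y, hy⟩ := List.exists_mem_of_ne_nil ys hys
    simp only [List.mem_append, List.mem_map, List.mem_singleton]
    constructor
    · rintro h p ((hp | rfl) | hp)
      · exact h p (Or.inl (Or.inl hp))
      · exact h (y, v) (Or.inl (Or.inr ⟨y, hy, rfl⟩))
      · exact h p (Or.inr hp)
    · rintro h p ((hp | ⟨y, _, rfl⟩) | hp)
      · exact h p (Or.inl (Or.inl hp))
      · exact h (ys.sum, v) (Or.inl (Or.inr rfl))
      · exact h p (Or.inr hp)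
  have h3 := h2 fun v => v ≠ 0 → ∃ i : Fin n, i ∉ J ∧ |v| = (i : ℤ) + 1
  constructor
  · intro h
    exact ⟨h3.1 h.label, fun i hi => by rw [← h1]; exact h.tail i hi⟩
  · intro h
    exact ⟨h3.2 h.label, fun i hi => by rw [h1]; exact h.tail i hi⟩

theorem isLabelled_neg_iff (J : Set (Fin n)) (x : ℕ) (v : ℤ) (z : List (ℕ × ℤ)) :
    IsLabelled J ((x, -v) :: z) ↔ IsLabelled J ((x, v) :: z) := by
  have key : ∀ v : ℤ, IsLabelled J ((x, v) :: z) → IsLabelled J ((x, -v) :: z) := by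
    intro v h
    refine ⟨fun p hp hp0 => ?_, fun i hi => ?_⟩
    · rcases List.mem_cons.1 hp with rfl | hp
      · have := h.label (x, v) List.mem_cons_self (neg_ne_zero.1 hp0)
        simpa only [abs_neg] using this
      · exact h.label p (List.mem_cons_of_mem _ hp) hp0
    · have := h.tail i hi
      simpa only [List.map_cons, abs_neg] using this
  exact ⟨fun h => by simpa using key _ h, key v⟩

theorem isLabelled_zero_iff (J : Set (Fin n)) (x : ℕ) (z : List (ℕ × ℤ)) :
    IsLabelled J ((x, 0) :: z) ↔ IsLabelled J z := by
  have h1 (i : Fin n) : ((((x, 0) :: z).map fun p : ℕ × ℤ =>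
      if (i : ℤ) + 1 ≤ |p.2| then p.1 else 0).sum) =
        (z.map fun p : ℕ × ℤ => if (i : ℤ) + 1 ≤ |p.2| then p.1 else 0).sum := by
    rw [List.map_cons, List.sum_cons, abs_zero, if_neg (by omega), zero_add]
  constructor
  · intro h
    refine ⟨fun p hp => h.label p (List.mem_cons_of_mem _ hp), fun i hi => ?_⟩
    rw [← h1]
    exact h.tail i hi
  · intro h
    refine ⟨fun p hp hp0 => ?_, fun i hi => ?_⟩
    · rcases List.mem_cons.1 hp with rfl | hp
      · exact absurd rfl hp0
      · exact h.label p hp hp0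
    · rw [h1]
      exact h.tail i hi

variable (k : Type*) [CommRing k]

theorem arrangeHom_word_of (J : Set (Fin n)) {z : List (ℕ × ℤ)} (h : IsLabelled J z) :
    arrangeHom k J (word k z) = word k (arrange n z) := by
  rw [arrangeHom, wordLift_word, if_pos h]

theorem arrangeHom_word_of_not (J : Set (Fin n)) {z : List (ℕ × ℤ)} (h : ¬ IsLabelled J z) :
    arrangeHom k J (word k z) = 0 := by
  rw [arrangeHom, wordLift_word, if_neg h]

/-- The effect of the operators on a sequence of neighbouring letters with a common label. -/
theorem exists_arrangeHom_eq (J : Set (Fin n)) (z₁ z₂ : List (ℕ × ℤ)) (v : ℤ) (N : ℕ) :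
    ∃ (c : k) (P Q : List ℕ), (∀ x ∈ P ++ Q, x ∈ (z₁ ++ z₂).map Prod.fst) ∧
      ((∀ ys : List ℕ, ys ≠ [] → ys.sum = N →
        arrangeHom k J (word k (z₁ ++ ys.map (fun y => (y, v)) ++ z₂)) =
          c • (word k P * word k ys * word k Q)) ∨
      ∀ ys : List ℕ, ys ≠ [] → ys.sum = N →
        arrangeHom k J (word k (z₁ ++ ys.map (fun y => (y, v)) ++ z₂)) =
          c • (word k P * word k ys.reverse * word k Q)) := by
  by_cases hz : IsLabelled J (z₁ ++ [(N, v)] ++ z₂)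
  · have hlab : ∀ ys : List ℕ, ys ≠ [] → ys.sum = N →
        IsLabelled J (z₁ ++ ys.map (fun y => (y, v)) ++ z₂) := by
      rintro ys hys rfl
      exact (isLabelled_split_iff J z₁ z₂ v hys).2 hz
    have hPQ : ∀ P Q : List ℕ, arrange n (z₁ ++ z₂) = P ++ Q →
        ∀ x ∈ P ++ Q, x ∈ (z₁ ++ z₂).map Prod.fst := by
      intro P Q h x hx
      rw [← h] at hx
      exact mem_of_mem_arrange hx
    rcases eq_or_ne v 0 with rfl | hv
    · obtain ⟨Q, hQ⟩ := exists_arrange_zero (n := n) z₁ z₂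
      refine ⟨1, _, _, hPQ (select 0 z₁) (select 0 z₂ ++ Q) (by simpa using hQ []),
        Or.inl fun ys hys hN => ?_⟩
      rw [arrangeHom_word_of k J (hlab ys hys hN), hQ, word_append, word_append, one_smul]
    · obtain ⟨i, -, hi⟩ := hz.label (N, v) (by simp) hv
      obtain ⟨A, B, hAB⟩ := exists_arrange_of_lt i.2 z₁ z₂
      rcases abs_choice v with h | h
      · obtain rfl : v = (i : ℤ) + 1 := by rw [← hi]; exact h.symm
        refine ⟨1, _, _, hPQ _ _ (by
          have := (hAB []).1
          rwa [List.map_nil, List.append_nil, List.append_nil] at this), Or.inl fun ys hys hN => ?_⟩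
        rw [arrangeHom_word_of k J (hlab ys hys hN), (hAB ys).1, word_append, word_append,
          one_smul]
      · obtain rfl : v = -((i : ℤ) + 1) := by rw [← hi]; simp [h]
        refine ⟨1, _, _, hPQ _ _ (by
          have := (hAB []).2
          rwa [List.map_nil, List.append_nil, List.reverse_nil, List.append_nil] at this),
          Or.inr fun ys hys hN => ?_⟩
        rw [arrangeHom_word_of k J (hlab ys hys hN), (hAB ys).2, word_append, word_append,
          one_smul]
  · refine ⟨0, [], [], by simp, Or.inl ?_⟩
    rintro ys hys rfl
    rw [arrangeHom_word_of_not, zero_smul]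
    rwa [isLabelled_split_iff J z₁ z₂ v hys]

/-- To prove a property of all noncommutative polynomials it suffices to consider the words. -/
theorem wordAlg_induction {α : Type*} {p : WordAlg k α → Prop} (hword : ∀ l, p (word k l))
    (hadd : ∀ x y, p x → p y → p (x + y)) (hsmul : ∀ (c : k) (x), p x → p (c • x))
    (x : WordAlg k α) : p x := by
  have hx := (MonoidAlgebra.basis (FreeMonoid α) k).mem_span x
  refine Submodule.span_induction ?_ ?_ (fun x y _ _ => hadd x y) (fun c x _ => hsmul c x) hx
  · rintro _ ⟨m, rfl⟩
    rw [MonoidAlgebra.basis_apply]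
    exact hword m.toList
  · simpa using hsmul 0 _ (hword [])

/-- The commutator of letters with different labels is annihilated. -/
theorem arrangeHom_lie_of_ne (J : Set (Fin n)) {v v' : ℤ} (h : v ≠ v') (x y : ℕ)
    (Z₁ Z₂ : WordAlg k (ℕ × ℤ)) :
    arrangeHom k J (Z₁ * ⁅word k [(x, v)], word k [(y, v')]⁆ * Z₂) = 0 := by
  refine wordAlg_induction k (p := fun Z₁ =>
    arrangeHom k J (Z₁ * ⁅word k [(x, v)], word k [(y, v')]⁆ * Z₂) = 0) (fun z₁ => ?_) ?_ ?_ Z₁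
  · refine wordAlg_induction k (p := fun Z₂ => arrangeHom k J (word k z₁ *
      ⁅word k [(x, v)], word k [(y, v')]⁆ * Z₂) = 0) (fun z₂ => ?_) ?_ ?_ Z₂
    · rw [Ring.lie_def, mul_sub, sub_mul, map_sub, ← word_append, ← word_append, ← word_append,
        ← word_append, ← word_append, ← word_append, sub_eq_zero, List.singleton_append,
        List.singleton_append]
      have hp : (z₁ ++ [(x, v), (y, v')] ++ z₂).Perm (z₁ ++ [(y, v'), (x, v)] ++ z₂) :=
        ((List.Perm.swap _ _ _).append_left _).append_right _
      by_cases hz : IsLabelled J (z₁ ++ [(x, v), (y, v')] ++ z₂)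
      · rw [arrangeHom_word_of k J hz, arrangeHom_word_of k J (hz.perm hp), arrange_swap h]
      · rw [arrangeHom_word_of_not k J hz,
          arrangeHom_word_of_not k J fun h' => hz (h'.perm hp.symm)]
    · intro a b ha hb
      rw [mul_add, map_add, ha, hb, add_zero]
    · intro c a ha
      rw [mul_smul_comm, map_smul, ha, smul_zero]
  · intro a b ha hb
    rw [add_mul, add_mul, map_add, ha, hb, add_zero]
  · intro c a ha
    rw [smul_mul_assoc, smul_mul_assoc, map_smul, ha, smul_zero]

/-- The iterated commutator `[a, [b, c]]` of three letters. -/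
noncomputable def lie3 {α : Type*} (a b c : α) : WordAlg k α :=
  ⁅word k [a], ⁅word k [b], word k [c]⁆⁆

theorem lie3_eq {α : Type*} (a b c : α) : lie3 k a b c =
    word k [a, b, c] - word k [a, c, b] - word k [b, c, a] + word k [c, b, a] := by
  have h (a b c : α) : word k [a, b, c] = word k [a] * (word k [b] * word k [c]) := by
    rw [← word_append, ← word_append]
    rfl
  rw [h, h, h, h, lie3, Ring.lie_def, Ring.lie_def]
  noncomm_ring

theorem arrangeHom_lie3 (J : Set (Fin n)) (a b c : ℕ) (u v w : ℤ) (h : ¬ (u = v ∧ v = w))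
    (Z₁ Z₂ : WordAlg k (ℕ × ℤ)) :
    arrangeHom k J (Z₁ * lie3 k (a, u) (b, v) (c, w) * Z₂) = 0 := by
  by_cases hvw : v = w
  · subst hvw
    have huv : u ≠ v := fun h' => h ⟨h', rfl⟩
    have key : Z₁ * lie3 k (a, u) (b, v) (c, v) * Z₂ =
        Z₁ * ⁅word k [(a, u)], word k [(b, v)]⁆ * (word k [(c, v)] * Z₂) +
        (Z₁ * word k [(b, v)]) * ⁅word k [(a, u)], word k [(c, v)]⁆ * Z₂ -
        Z₁ * ⁅word k [(a, u)], word k [(c, v)]⁆ * (word k [(b, v)] * Z₂) -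
        (Z₁ * word k [(c, v)]) * ⁅word k [(a, u)], word k [(b, v)]⁆ * Z₂ := by
      simp only [lie3, Ring.lie_def]
      noncomm_ring
    rw [key, map_sub, map_sub, map_add]
    simp only [arrangeHom_lie_of_ne k J huv, add_zero, sub_zero]
  · have key : Z₁ * lie3 k (a, u) (b, v) (c, w) * Z₂ =
        (Z₁ * word k [(a, u)]) * ⁅word k [(b, v)], word k [(c, w)]⁆ * Z₂ -
        Z₁ * ⁅word k [(b, v)], word k [(c, w)]⁆ * (word k [(a, u)] * Z₂) := by
      simp only [lie3, Ring.lie_def]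
      noncomm_ring
    rw [key, map_sub, arrangeHom_lie_of_ne k J hvw, arrangeHom_lie_of_ne k J hvw, sub_zero]

/-- The substitution of a polynomial `B` for the letter `N`. -/
noncomputable def subst (N : ℕ) (B : WordAlg k ℕ) : WordAlg k ℕ →ₐ[k] WordAlg k ℕ :=
  MonoidAlgebra.lift k _ _ (FreeMonoid.lift fun x => if x = N then B else word k [x])

theorem subst_letter (N : ℕ) (B : WordAlg k ℕ) (x : ℕ) :
    subst k N B (word k [x]) = if x = N then B else word k [x] := by
  rw [subst, word, MonoidAlgebra.lift_of]
  exact FreeMonoid.lift_eval_of _ _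

theorem subst_word_of_notMem {N : ℕ} (B : WordAlg k ℕ) {w : List ℕ} (h : N ∉ w) :
    subst k N B (word k w) = word k w := by
  induction w with
  | nil => rw [word_nil, map_one]
  | cons x w ih =>
    rw [List.mem_cons, not_or] at h
    rw [← List.singleton_append, word_append, map_mul, ih h.2, subst_letter,
      if_neg (Ne.symm h.1)]

theorem subst_word {N : ℕ} (B : WordAlg k ℕ) {w₁ w₂ : List ℕ} (h₁ : N ∉ w₁) (h₂ : N ∉ w₂) :
    subst k N B (word k (w₁ ++ [N] ++ w₂)) = word k w₁ * B * word k w₂ := by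
  rw [word_append, word_append, map_mul, map_mul, subst_word_of_notMem k B h₁,
    subst_word_of_notMem k B h₂, subst_letter, if_pos rfl]

/-- Splitting a letter into an iterated commutator of letters with the same label. The iterated
commutator of three letters is invariant under the reversal of words, whence negative labels
behave in the same way as positive ones. -/
theorem arrangeHom_lie3_self (J : Set (Fin n)) (a b c : ℕ) (v : ℤ) {z₁ z₂ : List (ℕ × ℤ)}
    (h₁ : a + b + c ∉ z₁.map Prod.fst) (h₂ : a + b + c ∉ z₂.map Prod.fst) :
    arrangeHom k J (word k z₁ * lie3 k (a, v) (b, v) (c, v) * word k z₂) =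
      subst k (a + b + c) (lie3 k a b c)
        (arrangeHom k J (word k z₁ * word k [(a + b + c, v)] * word k z₂)) := by
  obtain ⟨r, P, Q, hPQ, h⟩ := exists_arrangeHom_eq k J z₁ z₂ v (a + b + c)
  have hN : a + b + c ∉ P ++ Q := fun hx => by
    have := hPQ _ hx
    rw [List.map_append, List.mem_append] at this
    exact this.elim h₁ h₂
  rw [List.mem_append, not_or] at hN
  have hexp : word k z₁ * lie3 k (a, v) (b, v) (c, v) * word k z₂ =
      word k (z₁ ++ [a, b, c].map (fun y => (y, v)) ++ z₂) -
      word k (z₁ ++ [a, c, b].map (fun y => (y, v)) ++ z₂) -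
      word k (z₁ ++ [b, c, a].map (fun y => (y, v)) ++ z₂) +
      word k (z₁ ++ [c, b, a].map (fun y => (y, v)) ++ z₂) := by
    rw [lie3_eq]
    simp only [word_append, mul_sub, mul_add, sub_mul, add_mul]
    rfl
  have hN' : word k z₁ * word k [(a + b + c, v)] * word k z₂ =
      word k (z₁ ++ [a + b + c].map (fun y => (y, v)) ++ z₂) := by
    rw [word_append, word_append]
    rfl
  have s1 : [a, b, c].sum = a + b + c := by simp [add_assoc]
  have s2 : [a, c, b].sum = a + b + c := by simp; omega
  have s3 : [b, c, a].sum = a + b + c := by simp; omega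
  have s4 : [c, b, a].sum = a + b + c := by simp; omega
  have hs : word k P * lie3 k a b c * word k Q =
      subst k (a + b + c) (lie3 k a b c) (word k P * word k [a + b + c] * word k Q) := by
    rw [← subst_word k _ hN.1 hN.2, word_append, word_append]
  rw [hexp, hN', map_add, map_sub, map_sub]
  rcases h with h | h
  · rw [h _ (by simp) s1, h _ (by simp) s2, h _ (by simp) s3, h _ (by simp) s4,
      h [a + b + c] (by simp) (by simp), map_smul, ← hs, lie3_eq]
    simp only [← smul_sub, ← smul_add]
    congr 1
    noncomm_ring
  · rw [h _ (by simp) s1, h _ (by simp) s2, h _ (by simp) s3, h _ (by simp) s4,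
      h [a + b + c] (by simp) (by simp), map_smul, List.reverse_singleton, ← hs, lie3_eq]
    simp only [← smul_sub, ← smul_add]
    congr 1
    simp only [List.reverse_cons, List.reverse_nil, List.nil_append, List.cons_append]
    noncomm_ring

theorem label_word_mem (w : List ℕ) : label k n (word k w) ∈
    Submodule.span k {Z | ∃ z : List (ℕ × ℤ), z.map Prod.fst = w ∧ word k z = Z} := by
  induction w with
  | nil =>
    rw [word_nil, map_one]
    exact Submodule.subset_span ⟨[], rfl, word_nil k⟩
  | cons x w ih =>
    rw [← List.singleton_append, word_append, map_mul, label_letter, Finset.sum_mul]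
    refine Submodule.sum_mem _ fun v _ => ?_
    refine Submodule.span_induction (p := fun Z _ => word k [(x, v)] * Z ∈ Submodule.span k
      {Z | ∃ z : List (ℕ × ℤ), z.map Prod.fst = [x] ++ w ∧ word k z = Z}) ?_ ?_ ?_ ?_ ih
    · rintro _ ⟨z, hz, rfl⟩
      rw [← word_append]
      exact Submodule.subset_span ⟨_, by simp [hz], rfl⟩
    · simp
    · intro a b _ _ ha hb
      rw [mul_add]
      exact Submodule.add_mem _ ha hb
    · intro r a _ ha
      rw [mul_smul_comm]
      exact Submodule.smul_mem _ _ ha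

theorem lie_sum_sum {A ι κ : Type*} [Ring A] (S : Finset ι) (T : Finset κ) (f : ι → A)
    (g : κ → A) : ⁅∑ i ∈ S, f i, ∑ j ∈ T, g j⁆ = ∑ i ∈ S, ∑ j ∈ T, ⁅f i, g j⁆ := by
  simp only [Ring.lie_def, Finset.sum_mul_sum, Finset.sum_sub_distrib]
  rw [Finset.sum_comm (s := T)]

theorem label_lie3 (a b c : ℕ) : label k n (lie3 k a b c) =
    ∑ u ∈ Finset.Icc (-(n : ℤ)) n, ∑ v ∈ Finset.Icc (-(n : ℤ)) n, ∑ w ∈ Finset.Icc (-(n : ℤ)) n,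
      lie3 k (a, u) (b, v) (c, w) := by
  rw [lie3, Ring.lie_def, Ring.lie_def, map_sub, map_mul, map_mul, map_sub, map_mul, map_mul,
    label_letter, label_letter, label_letter, ← Ring.lie_def, ← Ring.lie_def, lie_sum_sum,
    lie_sum_sum]
  refine Finset.sum_congr rfl fun u _ => Finset.sum_congr rfl fun v _ => ?_
  have := lie_sum_sum {u} (Finset.Icc (-(n : ℤ)) n) (fun u => word k [(a, u)]) fun w =>
    ⁅word k [(b, v)], word k [(c, w)]⁆
  rw [Finset.sum_singleton, Finset.sum_singleton] at this
  exact this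

/-- The operators commute with the substitution of `[a, [b, c]]` for a letter `a + b + c` which
occurs only once. -/
theorem faceOp_lie3 (J : Set (Fin n)) (a b c : ℕ) {w₁ w₂ : List ℕ} (h₁ : a + b + c ∉ w₁)
    (h₂ : a + b + c ∉ w₂) : faceOp k J (word k w₁ * lie3 k a b c * word k w₂) =
      subst k (a + b + c) (lie3 k a b c) (faceOp k J (word k (w₁ ++ [a + b + c] ++ w₂))) := by
  rw [faceOp, LinearMap.comp_apply, LinearMap.comp_apply, AlgHom.toLinearMap_apply,
    AlgHom.toLinearMap_apply, word_append, word_append, map_mul (label k n), map_mul (label k n),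
    map_mul (label k n), map_mul (label k n)]
  have hw₁ := label_word_mem (n := n) k w₁
  have hw₂ := label_word_mem (n := n) k w₂
  refine Submodule.span_induction (p := fun Z₁ _ =>
    arrangeHom k J (Z₁ * label k n (lie3 k a b c) * label k n (word k w₂)) =
      subst k (a + b + c) (lie3 k a b c) (arrangeHom k J
        (Z₁ * label k n (word k [a + b + c]) * label k n (word k w₂)))) ?_ ?_ ?_ ?_ hw₁
  · rintro _ ⟨z₁, hz₁, rfl⟩
    refine Submodule.span_induction (p := fun Z₂ _ =>
      arrangeHom k J (word k z₁ * label k n (lie3 k a b c) * Z₂) =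
        subst k (a + b + c) (lie3 k a b c) (arrangeHom k J
          (word k z₁ * label k n (word k [a + b + c]) * Z₂))) ?_ ?_ ?_ ?_ hw₂
    · rintro _ ⟨z₂, hz₂, rfl⟩
      rw [label_lie3, label_letter]
      simp only [Finset.mul_sum, Finset.sum_mul, map_sum]
      refine Finset.sum_congr rfl fun u hu => ?_
      rw [Finset.sum_eq_single u, Finset.sum_eq_single u]
      · exact arrangeHom_lie3_self k J a b c u (hz₁ ▸ h₁) (hz₂ ▸ h₂)
      · intro w _ hw
        exact arrangeHom_lie3 k J a b c u u w (fun h => hw h.2.symm) _ _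
      · exact fun h => absurd hu h
      · intro v _ hv
        exact Finset.sum_eq_zero fun w _ =>
          arrangeHom_lie3 k J a b c u v w (fun h => hv h.1.symm) _ _
      · exact fun h => absurd hu h
    · simp
    · intro x y _ _ hx hy
      rw [mul_add, mul_add, map_add, map_add, map_add, hx, hy]
    · intro r x _ hx
      rw [mul_smul_comm, mul_smul_comm, map_smul, map_smul, map_smul, hx]
  · simp
  · intro x y _ _ hx hy
    simp only [add_mul, map_add, hx, hy]
  · intro r x _ hx
    simp only [smul_mul_assoc, map_smul, hx]

/-- A commutator at the beginning of a word is reversed by a negative label. -/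
theorem arrangeHom_lie_neg (J : Set (Fin n)) (s t : ℕ) {v : ℤ} (hv : 0 < v)
    (z : List (ℕ × ℤ)) :
    arrangeHom k J (⁅word k [(s, v)], word k [(t, v)]⁆ * word k z) +
      arrangeHom k J (⁅word k [(s, -v)], word k [(t, -v)]⁆ * word k z) = 0 := by
  have hexp (v : ℤ) : ⁅word k [(s, v)], word k [(t, v)]⁆ * word k z =
      word k ([] ++ [s, t].map (fun y => (y, v)) ++ z) -
        word k ([] ++ [t, s].map (fun y => (y, v)) ++ z) := by
    rw [Ring.lie_def, sub_mul, ← word_append, ← word_append, ← word_append, ← word_append]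
    rfl
  have h1 (v : ℤ) : IsLabelled J ([] ++ [t, s].map (fun y => (y, v)) ++ z) ↔
      IsLabelled J ([] ++ [s, t].map (fun y => (y, v)) ++ z) := by
    rw [isLabelled_split_iff J _ _ _ (by simp), isLabelled_split_iff J _ _ _ (by simp)]
    simp [add_comm]
  have h2 : IsLabelled J ([] ++ [s, t].map (fun y => (y, -v)) ++ z) ↔
      IsLabelled J ([] ++ [s, t].map (fun y => (y, v)) ++ z) := by
    rw [isLabelled_split_iff J _ _ _ (by simp), isLabelled_split_iff J _ _ _ (by simp)]
    exact isLabelled_neg_iff J _ v z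
  rw [hexp, hexp, map_sub, map_sub]
  by_cases hz : IsLabelled J ([] ++ [s, t].map (fun y => (y, v)) ++ z)
  · obtain ⟨i, -, hi⟩ := hz.label (s, v) (by simp) hv.ne'
    rw [abs_of_pos hv] at hi
    rw [arrangeHom_word_of k J hz, arrangeHom_word_of k J ((h1 v).2 hz),
      arrangeHom_word_of k J (h2.2 hz), arrangeHom_word_of k J ((h1 _).2 (h2.2 hz))]
    obtain ⟨A, B, hAB⟩ := exists_arrange_of_lt i.2 [] z
    obtain rfl : v = (i : ℤ) + 1 := hi
    rw [(hAB _).1, (hAB _).1, (hAB _).2, (hAB _).2]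
    simp [select]
  · rw [arrangeHom_word_of_not k J hz, arrangeHom_word_of_not k J (mt (h1 v).1 hz),
      arrangeHom_word_of_not k J (mt h2.1 hz),
      arrangeHom_word_of_not k J (mt (fun h => h2.1 ((h1 _).1 h)) hz)]
    simp

theorem arrangeHom_lie_zero (J : Set (Fin n)) (s t : ℕ) (z : List (ℕ × ℤ)) :
    arrangeHom k J (⁅word k [(s, (0 : ℤ))], word k [(t, (0 : ℤ))]⁆ * word k z) =
      ⁅word k [s], word k [t]⁆ * arrangeHom k J (word k z) := by
  have key (s t : ℕ) : arrangeHom k J (word k [(s, 0)] * word k [(t, 0)] * word k z) =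
      word k [s] * word k [t] * arrangeHom k J (word k z) := by
    rw [← word_append, ← word_append, ← word_append]
    have hl : IsLabelled J ([(s, 0)] ++ [(t, 0)] ++ z) ↔ IsLabelled J z := by
      rw [List.append_assoc, List.singleton_append, List.singleton_append, isLabelled_zero_iff,
        isLabelled_zero_iff]
    by_cases hz : IsLabelled J z
    · rw [arrangeHom_word_of k J hz, arrangeHom_word_of k J (hl.2 hz), ← word_append]
      obtain ⟨Q, hQ⟩ := exists_arrange_zero (n := n) [] z
      have hQ1 := hQ [s, t]
      have hQ2 := hQ []
      simp only [List.map_nil, List.map_cons, List.nil_append, select, List.filter_nil,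
        List.append_nil] at hQ1 hQ2
      rw [hQ2]
      exact congrArg (word k) hQ1
    · rw [arrangeHom_word_of_not k J hz, arrangeHom_word_of_not k J (mt hl.1 hz), mul_zero]
  rw [Ring.lie_def, Ring.lie_def, sub_mul, sub_mul, map_sub, key, key]

/-- The operators commute with the multiplication by a commutator of two letters from the left: the
contributions of opposite labels cancel, and what remains is the contribution of the label `0`. -/
theorem faceOp_lie_mul (J : Set (Fin n)) (s t : ℕ) (y : WordAlg k ℕ) :
    faceOp k J (⁅word k [s], word k [t]⁆ * y) = ⁅word k [s], word k [t]⁆ * faceOp k J y := by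
  rw [faceOp, LinearMap.comp_apply, LinearMap.comp_apply, AlgHom.toLinearMap_apply,
    AlgHom.toLinearMap_apply, map_mul]
  have h1 : label k n ⁅word k [s], word k [t]⁆ = ∑ u ∈ Finset.Icc (-(n : ℤ)) n,
      ∑ v ∈ Finset.Icc (-(n : ℤ)) n, ⁅word k [(s, u)], word k [(t, v)]⁆ := by
    rw [Ring.lie_def, map_sub, map_mul, map_mul, label_letter, label_letter, ← Ring.lie_def,
      lie_sum_sum]
  rw [h1]
  refine wordAlg_induction k (p := fun Z => arrangeHom k J ((∑ u ∈ Finset.Icc (-(n : ℤ)) n,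
      ∑ v ∈ Finset.Icc (-(n : ℤ)) n, ⁅word k [(s, u)], word k [(t, v)]⁆) * Z) =
        ⁅word k [s], word k [t]⁆ * arrangeHom k J Z) ?_ ?_ ?_ (label k n y)
  · intro z
    have h0 : (0 : ℤ) ∈ Finset.Icc (-(n : ℤ)) n := by simp
    have h2 : arrangeHom k J ((∑ u ∈ Finset.Icc (-(n : ℤ)) n, ∑ v ∈ Finset.Icc (-(n : ℤ)) n,
        ⁅word k [(s, u)], word k [(t, v)]⁆) * word k z) = ∑ u ∈ Finset.Icc (-(n : ℤ)) n,
          arrangeHom k J (⁅word k [(s, u)], word k [(t, u)]⁆ * word k z) := by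
      simp only [Finset.sum_mul, map_sum]
      refine Finset.sum_congr rfl fun u hu => ?_
      rw [Finset.sum_eq_single u]
      · intro v _ hv
        simpa only [one_mul] using arrangeHom_lie_of_ne k J hv.symm s t 1 (word k z)
      · exact fun h => absurd hu h
    rw [h2, ← Finset.add_sum_erase _ _ h0, arrangeHom_lie_zero, add_eq_left]
    refine Finset.sum_involution (fun v _ => -v) ?_ ?_ ?_ ?_
    · intro v hv
      rcases lt_or_gt_of_ne (Finset.ne_of_mem_erase hv) with h | h
      · have := arrangeHom_lie_neg k J s t (neg_pos.2 h) z
        rwa [neg_neg, add_comm] at this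
      · exact arrangeHom_lie_neg k J s t h z
    · intro v hv _ h
      have := Finset.ne_of_mem_erase hv
      omega
    · intro v hv
      rw [Finset.mem_erase, Finset.mem_Icc] at hv ⊢
      omega
    · intro v _
      exact neg_neg v
  · intro x y hx hy
    rw [mul_add, map_add, hx, hy, map_add, mul_add]
  · intro c x hx
    rw [mul_smul_comm, map_smul, hx, map_smul, mul_smul_comm]

end

end DescentAlg

/-! ### The operators are linearly independent and preserve the content of words -/

namespace DescentAlg

section

variable {n : ℕ}

theorem sum_drop_ofFn {r : ℕ} (x : Fin r → ℕ) (m : ℕ) :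
    ((List.ofFn x).drop m).sum = ∑ l, if m ≤ l.val then x l else 0 := by
  induction r generalizing m with
  | zero => simp
  | succ r ih =>
    cases m with
    | zero => simp only [List.drop_zero, List.sum_ofFn, Nat.zero_le, if_true]
    | succ m =>
      rw [List.ofFn_succ, List.drop_succ_cons, ih, Fin.sum_univ_succ]
      simp

theorem sum_map_filter {α : Type*} (p : α → Bool) (F : α → ℕ) (L : List α) :
    ((L.filter p).map F).sum = (L.map fun a => if p a then F a else 0).sum := by
  induction L with
  | nil => rfl
  | cons a L ih => cases h : p a <;> simp [h, ih]

theorem filter_append_filter_of_pairwise {α : Type*} {p : α → Bool} {L : List α}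
    (h : L.Pairwise fun a b => p a → p b) : L = L.filter (fun a => !p a) ++ L.filter p := by
  induction L with
  | nil => rfl
  | cons a L ih =>
    rw [List.pairwise_cons] at h
    cases ha : p a
    · rw [List.filter_cons_of_pos (by simp [ha]), List.filter_cons_of_neg (by simp [ha]),
        List.cons_append, ← ih h.2]
    · have h1 : ∀ b ∈ L, p b = true := fun b hb => h.1 b hb ha
      rw [List.filter_cons_of_neg (by simp [ha]), List.filter_cons_of_pos ha,
        List.filter_eq_self.2 h1, List.filter_eq_nil_iff.2 fun b hb => by simp [h1 b hb],
        List.nil_append]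

/-- The words produced by a face of type `J` have suffixes of weight `n - i` for all `i ∉ J`: these
are formed by the letters whose label exceeds `i` in absolute value. -/
theorem IsFace.exists_suffix {J : Set (Fin n)} {r : ℕ} {x : Fin r → ℕ} {f : Fin r → ℤ}
    (hf : IsFace J x f) {i : Fin n} (hi : i ∉ J) :
    ∃ m, ((((arr n bar (oddExt f) (stdList r)).map fun e => x e.1).drop m).sum) + i = n := by
  set L := arr n bar (oddExt f) (stdList r) with hL
  have hch : IsChamber (lexKey (oddExt f) val) L :=
    (isChamber_stdList r).arr val_bar val_ne_zero (oddExt_bar f) hf.oddExt_le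
  have hsplit := filter_append_filter_of_pairwise (L := L)
    (p := fun e => decide ((i : ℤ) + 1 ≤ oddExt f e)) (hch.sorted.imp fun {e e'} hlt he => by
      rw [lexKey_lt] at hlt
      rw [decide_eq_true_eq] at he ⊢
      omega)
  have habs : ∀ e ∈ L, oddExt f e = |f e.1| := fun e he => by
    have h0 : 0 ≤ oddExt f e := by
      have := (hch.mem_iff e).1 he
      rw [lexKey_pos] at this
      omega
    rw [← abs_oddExt, abs_of_nonneg h0]
  have hsum : ((L.filter fun e => decide ((i : ℤ) + 1 ≤ oddExt f e)).map fun e => x e.1).sum =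
      (L.map fun e => if (i : ℤ) + 1 ≤ |f e.1| then x e.1 else 0).sum := by
    rw [sum_map_filter]
    congr 1
    refine List.map_congr_left fun e he => ?_
    simp only [habs e he, decide_eq_true_eq]
  refine ⟨(L.filter fun e => !decide ((i : ℤ) + 1 ≤ oddExt f e)).length, ?_⟩
  have hdrop : L.drop (L.filter fun e => !decide ((i : ℤ) + 1 ≤ oddExt f e)).length =
      L.filter fun e => decide ((i : ℤ) + 1 ≤ oddExt f e) := by
    conv_lhs => arg 2; rw [hsplit]
    exact List.drop_left' rfl
  rw [← List.map_drop, hdrop, hsum,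
    (isSignedList_arr hf).sum_map fun l => if (i : ℤ) + 1 ≤ |f l| then x l else 0]
  exact hf.tail i hi

/-- The coarsest labelled word of type `J`: its labels are the elements of the complement of `J`,
increased by one, in increasing order. -/
theorem exists_strictMono_face (J : Set (Fin n)) : ∃ (r : ℕ) (e : Fin r → Fin n) (x : Fin r → ℕ),
    StrictMono e ∧ (∀ l, e l ∉ J) ∧ (∀ i ∉ J, ∃ l, e l = i) ∧ IsValid n (List.ofFn x) ∧
      IsFace J x fun l => (e l : ℤ) + 1 := by
  classical
  let D : Finset (Fin n) := Finset.univ.filter (· ∉ J)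
  let e := D.orderEmbOfFin rfl
  have hD : ∀ i, i ∈ D ↔ i ∉ J := fun i => by simp [D]
  have he : ∀ l, e l ∉ J := fun l => (hD _).1 (D.orderEmbOfFin_mem rfl l)
  have hex : ∀ i ∉ J, ∃ l, e l = i := fun i hi => by
    have : i ∈ Set.range e := by
      rw [Finset.range_orderEmbOfFin]
      exact Finset.mem_coe.2 ((hD i).2 hi)
    exact this
  let x : Fin D.card → ℕ := fun l => ∑ p, if stdFace J p = (e l : ℤ) + 1 then 1 else 0
  have hx (q : ℤ → Prop) [DecidablePred q] (hq : ¬ q 0) : (∑ l, if q ((e l : ℤ) + 1) then x l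
      else 0) = ∑ p, if q (stdFace J p) then 1 else 0 := by
    have h1 : ∀ l, (if q ((e l : ℤ) + 1) then x l else 0) =
        ∑ p, if stdFace J p = (e l : ℤ) + 1 then (if q (stdFace J p) then 1 else 0) else 0 := by
      intro l
      split_ifs with h
      · refine Finset.sum_congr rfl fun p _ => ?_
        split_ifs with h1 h2
        · rfl
        · exact absurd (h1 ▸ h) h2
        · rfl
      · refine (Finset.sum_eq_zero fun p _ => ?_).symm
        split_ifs with h1 h2
        · exact absurd (h1 ▸ h2) h
        · rfl
        · rfl
    rw [Finset.sum_congr rfl fun l _ => h1 l, Finset.sum_comm]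
    refine Finset.sum_congr rfl fun p _ => ?_
    rcases stdFace_cases J p with h0 | ⟨i, hi, -, h0⟩
    · rw [h0, if_neg hq]
      simp
    · obtain ⟨l, rfl⟩ := hex i hi
      rw [Finset.sum_eq_single l, if_pos h0]
      · intro l' _ hl'
        refine if_neg fun h => hl' (e.injective (Fin.ext ?_))
        rw [h0] at h
        omega
      · simp
  refine ⟨D.card, e, x, e.strictMono, he, hex, ⟨?_, ?_⟩, ?_⟩
  · intro y hy
    obtain ⟨l, rfl⟩ := List.mem_ofFn.1 hy
    refine Finset.sum_pos' (fun _ _ => Nat.zero_le _) ⟨e l, Finset.mem_univ _, ?_⟩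
    rw [if_pos (stdFace_self (he l))]
    exact one_pos
  · have h1 := hx (fun v => v ≠ 0) (by simp)
    have h2 : ∀ l, (e l : ℤ) + 1 ≠ 0 := fun l => by omega
    simp only [h2, ne_eq, not_false_eq_true, if_true] at h1
    rw [List.sum_ofFn, h1]
    refine (Finset.sum_le_card_nsmul _ _ 1 fun p _ => ?_).trans (by simp)
    split_ifs <;> omega
  · constructor
    · intro l _
      exact ⟨e l, he l, abs_of_nonneg (by omega)⟩
    · intro i hi
      have h1 := hx (fun v => (i : ℤ) + 1 ≤ |v|) (by rw [abs_zero]; omega)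
      rw [h1]
      exact (isFace_stdFace J).tail i hi

variable (k : Type*)

theorem coeff_faceOp_ofFn [CommRing k] (J : Set (Fin n)) {r : ℕ} (x : Fin r → ℕ) (w : List ℕ) :
    (faceOp k J (word k (List.ofFn x))).coeff (FreeMonoid.ofList w) =
      (((faces J x).filter fun f =>
        ((arr n bar (oddExt f) (stdList r)).map fun e => x e.1) = w).card : k) := by
  classical
  rw [faceOp_ofFn, MonoidAlgebra.coeff_sum, Finsupp.finsetSum_apply, Finset.card_filter,
    Nat.cast_sum]
  refine Finset.sum_congr rfl fun f _ => ?_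
  rw [coeff_word]
  push_cast
  exact if_congr Iff.rfl rfl rfl

/-- For each `J` there is a valid word whose coefficient in its own image distinguishes the operator
of type `J` from those of types which do not contain `J`. -/
theorem exists_coeff_faceOp_ne_zero [Field k] [CharZero k] (J : Set (Fin n)) :
    ∃ w : List ℕ, IsValid n w ∧
      (faceOp k J (word k w)).coeff (FreeMonoid.ofList w) ≠ 0 ∧
      ∀ J' : Set (Fin n), (faceOp k J' (word k w)).coeff (FreeMonoid.ofList w) ≠ 0 → J ⊆ J' := by
  obtain ⟨r, e, x, hmono, he, hex, hvalid, hface⟩ := exists_strictMono_face J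
  refine ⟨List.ofFn x, hvalid, ?_, ?_⟩
  · rw [coeff_faceOp_ofFn, Nat.cast_ne_zero, ← Nat.pos_iff_ne_zero, Finset.card_pos]
    refine ⟨_, Finset.mem_filter.2 ⟨mem_faces.2 hface, ?_⟩⟩
    rw [← map_stdList]
    congr 1
    have h1 := (isChamber_stdList r).arr val_bar val_ne_zero
      (oddExt_bar fun l => (e l : ℤ) + 1) hface.oddExt_le
    refine h1.unique ((isChamber_stdList r).congr ?_ ?_)
    · rintro ⟨l, ε⟩ ⟨l', ε'⟩
      have h2 : l < l' ↔ e l < e l' := hmono.lt_iff_lt.symm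
      have h3 : l' < l ↔ e l' < e l := hmono.lt_iff_lt.symm
      have h4 : e l = e l' ↔ l = l' := hmono.injective.eq_iff
      simp only [Fin.lt_def, Fin.ext_iff] at h2 h3 h4
      rw [lexKey_lt]
      rcases Int.units_eq_one_or ε with rfl | rfl <;>
        rcases Int.units_eq_one_or ε' with rfl | rfl <;>
          simp only [val_one, val_neg_one, oddExt_one, oddExt_neg_one] <;> omega
    · rintro ⟨l, ε⟩
      rw [lexKey_pos]
      rcases Int.units_eq_one_or ε with rfl | rfl <;>
        simp only [val_one, val_neg_one, oddExt_one, oddExt_neg_one] <;> omega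
  · intro J' h
    rw [coeff_faceOp_ofFn, Nat.cast_ne_zero, ← Nat.pos_iff_ne_zero, Finset.card_pos] at h
    obtain ⟨f, hf⟩ := h
    rw [Finset.mem_filter, mem_faces] at hf
    intro i hiJ
    by_contra hi
    obtain ⟨m, hm⟩ := hf.1.exists_suffix hi
    rw [hf.2, sum_drop_ofFn] at hm
    by_cases hmr : m < r
    · have h1 := hface.tail (e ⟨m, hmr⟩) (he _)
      have h2 : (∑ l, if ((e ⟨m, hmr⟩ : ℕ) : ℤ) + 1 ≤ |((e l : ℕ) : ℤ) + 1| then x l else 0) =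
          ∑ l : Fin r, if m ≤ l.val then x l else 0 := by
        refine Finset.sum_congr rfl fun l _ => if_congr ?_ rfl rfl
        have h3 : (⟨m, hmr⟩ : Fin r) ≤ l ↔ e ⟨m, hmr⟩ ≤ e l := hmono.le_iff_le.symm
        rw [Fin.le_def, Fin.le_def] at h3
        rw [abs_of_nonneg (by omega)]
        dsimp only at h3
        omega
      rw [h2] at h1
      have h4 : e ⟨m, hmr⟩ = i := Fin.ext (by omega)
      exact he _ (h4 ▸ hiJ)
    · rw [Finset.sum_eq_zero fun l _ => if_neg (by omega)] at hm
      omega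

/-- A linear combination of the operators which vanishes on the valid words is trivial. -/
theorem eq_zero_of_sum_faceOp [Field k] [CharZero k] {c : Set (Fin n) → k}
    (h : ∀ w, IsValid n w → ∑ J, c J • faceOp k J (word k w) = 0) : c = 0 := by
  by_contra hc
  have hne : {J | c J ≠ 0}.Nonempty := by
    by_contra h0
    rw [Set.not_nonempty_iff_eq_empty] at h0
    refine hc (funext fun J => ?_)
    by_contra hJ
    exact (h0 ▸ (show J ∈ {J | c J ≠ 0} from hJ) : J ∈ (∅ : Set (Set (Fin n))))
  obtain ⟨J, hJ⟩ := (Set.toFinite {J | c J ≠ 0}).exists_maximal hne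
  obtain ⟨w, hw, hw0, hw1⟩ := exists_coeff_faceOp_ne_zero k J
  have h1 := congrArg (fun z => z.coeff (FreeMonoid.ofList w)) (h w hw)
  simp only [MonoidAlgebra.coeff_sum, Finsupp.finsetSum_apply, MonoidAlgebra.coeff_smul_apply,
    MonoidAlgebra.coeff_zero, Finsupp.zero_apply] at h1
  rw [Finset.sum_eq_single J] at h1
  · rcases smul_eq_zero.1 h1 with h1 | h1
    · exact hJ.1 h1
    · exact hw0 h1
  · intro J' _ hJ'
    rw [smul_eq_zero]
    by_contra! hcon
    exact hJ' (le_antisymm (hJ.2 hcon.1 (hw1 J' hcon.2)) (hw1 J' hcon.2))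
  · simp

/-- The span of the words with a given multiset of letters. -/
noncomputable def contentSpace [CommRing k] (q : Multiset ℕ) : Submodule k (WordAlg k ℕ) :=
  Submodule.span k {z | ∃ w : List ℕ, (w : Multiset ℕ) = q ∧ word k w = z}

variable {k}

theorem word_mem_contentSpace [CommRing k] {w : List ℕ} {q : Multiset ℕ}
    (h : (w : Multiset ℕ) = q) : word k w ∈ contentSpace k q :=
  Submodule.subset_span ⟨w, h, rfl⟩

theorem faceOp_word_mem [CommRing k] (J : Set (Fin n)) (w : List ℕ) :
    faceOp k J (word k w) ∈ contentSpace k (w : Multiset ℕ) := by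
  obtain ⟨r, x, rfl⟩ : ∃ (r : ℕ) (x : Fin r → ℕ), w = List.ofFn x :=
    ⟨w.length, w.get, (List.ofFn_get w).symm⟩
  rw [faceOp_ofFn]
  refine Submodule.sum_mem _ fun f hf => word_mem_contentSpace ?_
  have h := isSignedList_arr (mem_faces.1 hf)
  have h1 : ((arr n bar (oddExt f) (stdList r)).map Prod.fst).Perm (List.finRange r) :=
    (List.perm_ext_iff_of_nodup h.nodup (List.nodup_finRange r)).2 fun l => by simp [h.mem l]
  have h2 := h1.map x
  rw [List.map_map, ← List.ofFn_eq_map] at h2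
  exact Multiset.coe_eq_coe.2 h2

end

end DescentAlg

/-! ### The action of the path algebra on words -/

namespace DescentAlg

section

variable {k : Type*} [CommRing k]

variable (k) in
/-- The projection to the span of the words with a given multiset of letters. -/
noncomputable def contentProj (q : Multiset ℕ) : WordAlg k ℕ →ₗ[k] WordAlg k ℕ :=
  wordLift fun w => if (w : Multiset ℕ) = q then word k w else 0

theorem contentSpace_induction {q : Multiset ℕ} {p : WordAlg k ℕ → Prop}
    (hword : ∀ w : List ℕ, (w : Multiset ℕ) = q → p (word k w)) (hzero : p 0)
    (hadd : ∀ x y, p x → p y → p (x + y)) (hsmul : ∀ (c : k) (x), p x → p (c • x))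
    {z : WordAlg k ℕ} (hz : z ∈ contentSpace k q) : p z := by
  refine Submodule.span_induction ?_ hzero (fun x y _ _ => hadd x y) (fun c x _ => hsmul c x) hz
  rintro _ ⟨w, hw, rfl⟩
  exact hword w hw

theorem contentProj_of_mem {q : Multiset ℕ} {z : WordAlg k ℕ} (hz : z ∈ contentSpace k q) :
    contentProj k q z = z := by
  refine contentSpace_induction (p := fun z => contentProj k q z = z)
    (fun w hw => ?_) (map_zero _) (fun x y hx hy => ?_) (fun c x hx => ?_) hz
  · rw [contentProj, wordLift_word, if_pos hw]
  · rw [map_add, hx, hy]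
  · rw [map_smul, hx]

theorem contentProj_of_mem_of_ne {q q' : Multiset ℕ} (h : q' ≠ q) {z : WordAlg k ℕ}
    (hz : z ∈ contentSpace k q') : contentProj k q z = 0 := by
  refine contentSpace_induction (p := fun z => contentProj k q z = 0)
    (fun w hw => ?_) (map_zero _) (fun x y hx hy => ?_) (fun c x hx => ?_) hz
  · rw [contentProj, wordLift_word, if_neg (hw.trans_ne h)]
  · rw [map_add, hx, hy, add_zero]
  · rw [map_smul, hx, smul_zero]

theorem contentProj_mem (q : Multiset ℕ) (z : WordAlg k ℕ) :
    contentProj k q z ∈ contentSpace k q := by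
  refine wordAlg_induction k (p := fun z => contentProj k q z ∈ contentSpace k q) (fun w => ?_)
    (fun x y hx hy => ?_) (fun c x hx => ?_) z
  · rw [contentProj, wordLift_word]
    split_ifs with h
    · exact word_mem_contentSpace h
    · exact Submodule.zero_mem _
  · rw [map_add]
    exact Submodule.add_mem _ hx hy
  · rw [map_smul]
    exact Submodule.smul_mem _ _ hx

theorem faceOp_contentProj {n : ℕ} (J : Set (Fin n)) (q : Multiset ℕ) (z : WordAlg k ℕ) :
    faceOp k J (contentProj k q z) = contentProj k q (faceOp k J z) := by
  refine wordAlg_induction k (p := fun z =>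
    faceOp k J (contentProj k q z) = contentProj k q (faceOp k J z)) (fun w => ?_)
    (fun x y hx hy => ?_) (fun c x hx => ?_) z
  · by_cases h : (w : Multiset ℕ) = q
    · rw [contentProj_of_mem (word_mem_contentSpace h),
        contentProj_of_mem (h ▸ faceOp_word_mem J w)]
    · rw [contentProj_of_mem_of_ne h (word_mem_contentSpace rfl),
        contentProj_of_mem_of_ne h (faceOp_word_mem J w), map_zero]
  · rw [map_add, map_add, hx, hy, map_add, map_add]
  · rw [map_smul, map_smul, hx, map_smul, map_smul]

/-- The operator given by an arrow from `u` to `v`: it maps words with content `v` to linear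
combinations of words with content `u`. -/
noncomputable def arrowOp (k : Type*) [CommRing k] {n : ℕ} {u v : QVertex n} :
    QArrow n u v → (WordAlg k ℕ →ₗ[k] WordAlg k ℕ)
  | .first _ b c _ _ _ _ _ =>
    LinearMap.mulLeft k ⁅word k [b], word k [c]⁆ ∘ₗ contentProj k v.parts
  | .other a b c _ _ _ _ _ _ _ =>
    (subst k (a + b + c) (lie3 k a b c)).toLinearMap ∘ₗ contentProj k v.parts

theorem exists_split {w : List ℕ} {N : ℕ} {q : Multiset ℕ} (h : (w : Multiset ℕ) = N ::ₘ q)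
    (hN : N ∉ q) : ∃ w₁ w₂ : List ℕ, w = w₁ ++ [N] ++ w₂ ∧ N ∉ w₁ ∧ N ∉ w₂ ∧
      ((w₁ ++ w₂ : List ℕ) : Multiset ℕ) = q := by
  have hmem : N ∈ w := Multiset.mem_coe.1 (h ▸ Multiset.mem_cons_self N q)
  obtain ⟨w₁, w₂, rfl⟩ := List.append_of_mem hmem
  have hq : ((w₁ ++ w₂ : List ℕ) : Multiset ℕ) = q := by
    have h1 : ((w₁ ++ N :: w₂ : List ℕ) : Multiset ℕ) = N ::ₘ ((w₁ ++ w₂ : List ℕ) : Multiset ℕ) :=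
      Multiset.coe_eq_coe.2 List.perm_middle
    rw [h1] at h
    exact (Multiset.cons_inj_right N).1 h
  have hN' : N ∉ w₁ ++ w₂ := fun h' => hN (hq ▸ Multiset.mem_coe.2 h')
  rw [List.mem_append, not_or] at hN'
  exact ⟨w₁, w₂, by simp, hN'.1, hN'.2, hq⟩

theorem lie3_mem (a b c : ℕ) {w₁ w₂ : List ℕ} {q : Multiset ℕ}
    (hq : ((w₁ ++ w₂ : List ℕ) : Multiset ℕ) = q) :
    word k w₁ * lie3 k a b c * word k w₂ ∈ contentSpace k (a ::ₘ b ::ₘ c ::ₘ q) := by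
  have key (l : List ℕ) (hl : l.Perm [a, b, c]) :
      word k w₁ * word k l * word k w₂ ∈ contentSpace k (a ::ₘ b ::ₘ c ::ₘ q) := by
    rw [← word_append, ← word_append]
    refine word_mem_contentSpace ?_
    rw [← hq]
    refine Multiset.coe_eq_coe.2 (((hl.append_left w₁).append_right w₂).trans ?_)
    rw [List.append_assoc]
    exact List.perm_append_comm_assoc w₁ [a, b, c] w₂
  rw [lie3_eq, mul_add, mul_sub, mul_sub, add_mul, sub_mul, sub_mul]
  refine Submodule.add_mem _ (Submodule.sub_mem _ (Submodule.sub_mem _ (key _ ?_) (key _ ?_))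
    (key _ ?_)) (key _ ?_)
  · exact List.Perm.refl _
  · exact (List.Perm.swap _ _ _).cons _
  · exact ((List.Perm.swap _ _ _).cons _).trans (List.Perm.swap _ _ _)
  · exact (List.Perm.swap _ _ _).trans (((List.Perm.swap _ _ _).cons _).trans
      (List.Perm.swap _ _ _))

theorem sum_parts_le {n : ℕ} (u : QVertex n) : u.parts.sum ≤ n := by
  obtain ⟨m, p⟩ := u
  exact p.parts_sum.trans_le (Nat.lt_succ_iff.1 m.2)

theorem parts_pos {n : ℕ} (u : QVertex n) {i : ℕ} (hi : i ∈ u.parts) : 0 < i := u.2.parts_pos hi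

theorem parts_injective {n : ℕ} : Function.Injective (QVertex.parts (n := n)) := by
  rintro ⟨m, p⟩ ⟨m', p'⟩ h
  change p.parts = p'.parts at h
  obtain rfl : m = m' := Fin.ext (by rw [← p.parts_sum, ← p'.parts_sum, h])
  exact congrArg _ (Nat.Partition.ext h)

/-- For `n = 6` the letter which is split by an arrow occurs only once. -/
theorem notMem_of_parts_eq {v : QVertex 6} {a b c : ℕ} {q : Multiset ℕ} (ha : 0 < a) (hb : 0 < b)
    (hbc : b < c) (h : v.parts = (a + b + c) ::ₘ q) : a + b + c ∉ q := by
  intro hN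
  have h1 := sum_parts_le v
  have h2 := Multiset.single_le_sum (fun _ _ => Nat.zero_le _) _ hN
  rw [h, Multiset.sum_cons] at h1
  omega

theorem arrowOp_mem {u v : QVertex 6} (e : QArrow 6 u v) (z : WordAlg k ℕ) :
    arrowOp k e z ∈ contentSpace k u.parts := by
  cases e with
  | first a b c ha hb hbc hvalue hsource =>
    rw [arrowOp, LinearMap.comp_apply]
    refine contentSpace_induction (p := fun z => LinearMap.mulLeft k ⁅word k [b], word k [c]⁆ z ∈
      contentSpace k u.parts) (fun w hw => ?_) ?_ (fun x y hx hy => ?_) (fun c x hx => ?_)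
      (contentProj_mem v.parts z)
    · rw [LinearMap.mulLeft_apply, Ring.lie_def, sub_mul, ← word_append, ← word_append,
        ← word_append, ← word_append, hsource, ← hw]
      exact Submodule.sub_mem _ (word_mem_contentSpace rfl)
        (word_mem_contentSpace (Multiset.coe_eq_coe.2 (List.Perm.swap b c w)))
    · rw [map_zero]
      exact Submodule.zero_mem _
    · rw [map_add]
      exact Submodule.add_mem _ hx hy
    · rw [map_smul]
      exact Submodule.smul_mem _ _ hx
  | other a b c q ha hb hbc hac hdestination hsource =>
    rw [arrowOp, LinearMap.comp_apply]
    refine contentSpace_induction (p := fun z =>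
      (subst k (a + b + c) (lie3 k a b c)).toLinearMap z ∈ contentSpace k u.parts)
      (fun w hw => ?_) ?_ (fun x y hx hy => ?_) (fun c x hx => ?_) (contentProj_mem v.parts z)
    · obtain ⟨w₁, w₂, rfl, h₁, h₂, hq⟩ := exists_split (hw.trans hdestination)
        (notMem_of_parts_eq ha hb hbc hdestination)
      rw [AlgHom.toLinearMap_apply, subst_word k _ h₁ h₂, hsource]
      exact lie3_mem a b c hq
    · rw [map_zero]
      exact Submodule.zero_mem _
    · rw [map_add]
      exact Submodule.add_mem _ hx hy
    · rw [map_smul]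
      exact Submodule.smul_mem _ _ hx

theorem arrowOp_contentProj {n : ℕ} {u v : QVertex n} (e : QArrow n u v) (z : WordAlg k ℕ) :
    arrowOp k e (contentProj k v.parts z) = arrowOp k e z := by
  cases e <;> simp only [arrowOp, LinearMap.comp_apply, contentProj_of_mem (contentProj_mem _ _)]

/-- The operators commute with the arrows. -/
theorem faceOp_arrowOp (J : Set (Fin 6)) {u v : QVertex 6} (e : QArrow 6 u v) (z : WordAlg k ℕ) :
    faceOp k J (arrowOp k e z) = arrowOp k e (faceOp k J z) := by
  cases e with
  | first a b c ha hb hbc hvalue hsource =>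
    simp only [arrowOp, LinearMap.comp_apply, LinearMap.mulLeft_apply]
    rw [faceOp_lie_mul, faceOp_contentProj]
  | other a b c q ha hb hbc hac hdestination hsource =>
    simp only [arrowOp, LinearMap.comp_apply, AlgHom.toLinearMap_apply]
    rw [← faceOp_contentProj]
    refine contentSpace_induction (p := fun z =>
      faceOp k J (subst k (a + b + c) (lie3 k a b c) z) =
        subst k (a + b + c) (lie3 k a b c) (faceOp k J z))
      (fun w hw => ?_) ?_ (fun x y hx hy => ?_) (fun c x hx => ?_) (contentProj_mem v.parts z)
    · obtain ⟨w₁, w₂, rfl, h₁, h₂, -⟩ := exists_split (hw.trans hdestination)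
        (notMem_of_parts_eq ha hb hbc hdestination)
      rw [subst_word k _ h₁ h₂, faceOp_lie3 k J a b c h₁ h₂]
    · simp only [map_zero]
    · simp only [map_add, hx, hy]
    · simp only [map_smul, hx]

/-- The operator given by a path: the composition of the operators given by its arrows. -/
noncomputable def pathOp (k : Type*) [CommRing k] {n : ℕ} {u : QVertex n} :
    ∀ {v : QVertex n}, Quiver.Path u v → (WordAlg k ℕ →ₗ[k] WordAlg k ℕ)
  | _, .nil => contentProj k u.parts
  | _, .cons p e => pathOp k p ∘ₗ arrowOp k e

theorem pathOp_contentProj {n : ℕ} {u v : QVertex n} (p : Quiver.Path u v) (z : WordAlg k ℕ) :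
    pathOp k p (contentProj k v.parts z) = pathOp k p z := by
  cases p with
  | nil => exact contentProj_of_mem (contentProj_mem _ _)
  | cons p e => exact congrArg (pathOp k p) (arrowOp_contentProj e z)

theorem pathOp_mem {u v : QVertex 6} (p : Quiver.Path u v) (z : WordAlg k ℕ) :
    pathOp k p z ∈ contentSpace k u.parts := by
  induction p generalizing z with
  | nil => exact contentProj_mem _ _
  | cons p e ih => exact ih _

theorem pathOp_comp {u v w : QVertex 6} (p : Quiver.Path u v) (q : Quiver.Path v w)
    (z : WordAlg k ℕ) : pathOp k (p.comp q) z = pathOp k p (pathOp k q z) := by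
  induction q generalizing z with
  | nil => exact (pathOp_contentProj p z).symm
  | cons q e ih => exact ih _

theorem pathOp_pathOp_of_ne {u v v' w : QVertex 6} (h : v ≠ v') (p : Quiver.Path u v)
    (q : Quiver.Path v' w) (z : WordAlg k ℕ) : pathOp k p (pathOp k q z) = 0 := by
  rw [← pathOp_contentProj p, contentProj_of_mem_of_ne (fun h' => h (parts_injective h'.symm))
    (pathOp_mem q z), map_zero]

theorem faceOp_pathOp (J : Set (Fin 6)) {u v : QVertex 6} (p : Quiver.Path u v)
    (z : WordAlg k ℕ) : faceOp k J (pathOp k p z) = pathOp k p (faceOp k J z) := by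
  induction p generalizing z with
  | nil => exact faceOp_contentProj J _ z
  | cons p e ih => exact (ih _).trans (congrArg (pathOp k p) (faceOp_arrowOp J e z))

/-- The action of the path algebra on words. It maps the idempotent of a vertex to the projection
to the words whose content is this vertex. -/
noncomputable def rep (k : Type*) [CommRing k] :
    PathAlgebra k (QVertex 6) →ₗ[k] Module.End k (WordAlg k ℕ) :=
  (Finsupp.linearCombination k fun p => pathOp k p.2.2 :
    (QuiverPath (QVertex 6) →₀ k) →ₗ[k] Module.End k (WordAlg k ℕ))

theorem rep_ofPath (p : QuiverPath (QVertex 6)) :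
    rep k (PathAlgebra.ofPath k p) = pathOp k p.2.2 :=
  (Finsupp.linearCombination_single k _ _).trans (one_smul k _)

theorem pathAlgebra_induction {V : Type*} [Quiver V] {P : PathAlgebra k V → Prop}
    (hpath : ∀ p, P (PathAlgebra.ofPath k p)) (hzero : P 0)
    (hadd : ∀ x y, P x → P y → P (x + y)) (hsmul : ∀ (c : k) (x), P x → P (c • x))
    (x : PathAlgebra k V) : P x := by
  refine Finsupp.induction_linear (motive := P) x hzero hadd fun p c => ?_
  have h := hsmul c _ (hpath p)
  have h1 : c • PathAlgebra.ofPath k p = Finsupp.single p c := Finsupp.smul_single_one p c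
  rwa [h1] at h

theorem rep_mul (x y : PathAlgebra k (QVertex 6)) (z : WordAlg k ℕ) :
    rep k (x * y) z = rep k x (rep k y z) := by
  refine pathAlgebra_induction (P := fun x => rep k (x * y) z = rep k x (rep k y z))
    (fun p => ?_) ?_ (fun x x' hx hx' => ?_) (fun c x hx => ?_) x
  · refine pathAlgebra_induction (P := fun y => rep k (PathAlgebra.ofPath k p * y) z =
      rep k (PathAlgebra.ofPath k p) (rep k y z)) (fun q => ?_) ?_ (fun y y' hy hy' => ?_)
      (fun c y hy => ?_) y
    · rw [PathAlgebra.ofPath_mul_ofPath, rep_ofPath, rep_ofPath]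
      obtain ⟨u, v, p⟩ := p
      obtain ⟨v', w, q⟩ := q
      by_cases h : v = v'
      · subst h
        rw [PathAlgebra.mulPath_of_comp, rep_ofPath]
        exact pathOp_comp p q z
      · rw [PathAlgebra.mulPath_of_ne (by exact h), map_zero]
        exact (pathOp_pathOp_of_ne h p q z).symm
    · simp
    · simp [mul_add, hy, hy']
    · simp [hy]
  · simp
  · simp [add_mul, hx, hx']
  · simp [hx]

theorem faceOp_rep (J : Set (Fin 6)) (x : PathAlgebra k (QVertex 6)) (z : WordAlg k ℕ) :
    faceOp k J (rep k x z) = rep k x (faceOp k J z) := by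
  refine pathAlgebra_induction (P := fun x => faceOp k J (rep k x z) = rep k x (faceOp k J z))
    (fun p => ?_) ?_ (fun x x' hx hx' => ?_) (fun c x hx => ?_) x
  · rw [rep_ofPath]
    exact faceOp_pathOp J p.2.2 z
  · simp
  · simp [hx, hx']
  · simp [hx]

theorem rep_ofArrow {u v : QVertex 6} (e : u ⟶ v) (z : WordAlg k ℕ) :
    rep k (PathAlgebra.ofArrow k e) z = arrowOp k e z := by
  have h : pathOp k e.toPath z = contentProj k u.parts (arrowOp k e z) := rfl
  rw [PathAlgebra.ofArrow, rep_ofPath, h, contentProj_of_mem (arrowOp_mem e z)]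

theorem arrowOp_first {u v : QVertex 6} {a b c : ℕ} {ha : 0 < a} {hb : 0 < b} {hbc : b < c}
    {hvalue : a + b + c + v.parts.sum = 6 + 1} {hsource : u.parts = b ::ₘ c ::ₘ v.parts}
    {z : WordAlg k ℕ} (hz : z ∈ contentSpace k v.parts) :
    arrowOp k (QArrow.first a b c ha hb hbc hvalue hsource) z = ⁅word k [b], word k [c]⁆ * z :=
  congrArg (LinearMap.mulLeft k ⁅word k [b], word k [c]⁆) (contentProj_of_mem hz)

theorem arrowOp_other {u v : QVertex 6} {a b c : ℕ} {q : Multiset ℕ} {ha : 0 < a} {hb : 0 < b}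
    {hbc : b < c} {hac : a ≤ c} {hdestination : v.parts = (a + b + c) ::ₘ q}
    {hsource : u.parts = a ::ₘ b ::ₘ c ::ₘ q}
    {z : WordAlg k ℕ} (hz : z ∈ contentSpace k v.parts) :
    arrowOp k (QArrow.other a b c q ha hb hbc hac hdestination hsource) z =
      subst k (a + b + c) (lie3 k a b c) z :=
  congrArg (subst k (a + b + c) (lie3 k a b c)) (contentProj_of_mem hz)

/-- The relation holds because of the Jacobi identity `[1, [2, z]] - [2, [1, z]] = [[1, 2], z]`,
whose right hand side vanishes for `z = [1, 2]`. -/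
theorem rep_relationQ6 : rep k (relationQ6 k) = 0 := by
  have hA (N : ℕ) (h : 1 ≠ N) (B : WordAlg k ℕ) :
      subst k N B ⁅word k [1], word k [N]⁆ = ⁅word k [1], B⁆ := by
    rw [Ring.lie_def, map_sub, map_mul, map_mul, subst_letter, subst_letter, if_neg h, if_pos rfl,
      Ring.lie_def]
  have hB (N : ℕ) (h : 2 ≠ N) (B : WordAlg k ℕ) :
      subst k N B ⁅word k [2], word k [N]⁆ = ⁅word k [2], B⁆ := by
    rw [Ring.lie_def, map_sub, map_mul, map_mul, subst_letter, subst_letter, if_neg h, if_pos rfl,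
      Ring.lie_def]
  have hone : (1 : WordAlg k ℕ) ∈ contentSpace k vEmpty.parts :=
    word_nil (α := ℕ) k ▸ word_mem_contentSpace rfl
  have key : rep k (relationQ6 k) 1 = 0 := by
    rw [relationQ6, map_sub, LinearMap.sub_apply, rep_mul, rep_mul, rep_ofArrow, rep_ofArrow,
      rep_ofArrow, rep_ofArrow, sub_eq_zero]
    have hc : arrowOp k arrowC 1 ∈ contentSpace k v15.parts := arrowOp_mem arrowC 1
    have hd : arrowOp k arrowD 1 ∈ contentSpace k v24.parts := arrowOp_mem arrowD 1
    have ha := arrowOp_other (ha := by decide) (hb := by decide) (hbc := by decide)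
      (hac := by decide) (hdestination := by decide) (hsource := by decide) (u := v1122)
      (v := v15) (a := 2) (b := 1) (c := 2) (q := {1}) hc
    have hb := arrowOp_other (ha := by decide) (hb := by decide) (hbc := by decide)
      (hac := by decide) (hdestination := by decide) (hsource := by decide) (u := v1122)
      (v := v24) (a := 1) (b := 1) (c := 2) (q := {2}) hd
    rw [arrowC, arrowOp_first hone, mul_one, hA _ (by decide)] at ha
    rw [arrowD, arrowOp_first hone, mul_one, hB _ (by decide)] at hb
    rw [arrowA, arrowB, arrowC, arrowD, arrowOp_first hone, arrowOp_first hone, mul_one, mul_one,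
      ha, hb]
    simp only [lie3, Ring.lie_def]
    noncomm_ring
  have hcomp (x : PathAlgebra k (QVertex 6)) {u v : QVertex 6} (e : u ⟶ v) (z : WordAlg k ℕ) :
      rep k (x * PathAlgebra.ofArrow k e) (contentProj k v.parts z) =
        rep k (x * PathAlgebra.ofArrow k e) z := by
    rw [rep_mul, rep_mul, rep_ofArrow, rep_ofArrow, arrowOp_contentProj]
  refine LinearMap.ext fun z => ?_
  have h1 : rep k (relationQ6 k) z = rep k (relationQ6 k) (contentProj k vEmpty.parts z) := by
    rw [relationQ6, map_sub, LinearMap.sub_apply, LinearMap.sub_apply, hcomp, hcomp]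
  rw [h1]
  refine contentSpace_induction (p := fun z => rep k (relationQ6 k) z = 0) (fun w hw => ?_)
    (map_zero _) (fun x y hx hy => ?_) (fun c x hx => ?_) (contentProj_mem vEmpty.parts z)
  · obtain rfl : w = [] := (Multiset.coe_eq_zero _).1 hw
    rw [word_nil]
    exact key
  · rw [map_add, hx, hy, add_zero]
  · rw [map_smul, hx, smul_zero]

end

end DescentAlg

/-! ### The orbit of the sum of the sorted words -/

namespace DescentAlg

section

variable (k : Type*) [Field k]

/-- The span of the words with positive letters and weight at most `n`. -/
noncomputable def validSpace (n : ℕ) : Submodule k (WordAlg k ℕ) :=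
  Submodule.span k {z | ∃ w, IsValid n w ∧ word k w = z}

/-- The word formed by the parts of a vertex in increasing order. -/
def sortedWord {n : ℕ} (u : QVertex n) : List ℕ := u.parts.sort (· ≤ ·)

/-- The sum of the sorted words, one for each vertex. -/
noncomputable def sortedSum (n : ℕ) : WordAlg k ℕ := ∑ u : QVertex n, word k (sortedWord u)

/-- The action of the path algebra on the sum of the sorted words. -/
noncomputable def orbitMap : PathAlgebra k (QVertex 6) →ₗ[k] WordAlg k ℕ :=
  LinearMap.applyₗ (sortedSum k 6) ∘ₗ rep k

variable {k}

theorem orbitMap_apply (x : PathAlgebra k (QVertex 6)) : orbitMap k x = rep k x (sortedSum k 6) :=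
  rfl

theorem coe_sortedWord {n : ℕ} (u : QVertex n) : (sortedWord u : Multiset ℕ) = u.parts :=
  Multiset.sort_eq _ _

theorem isValid_of_coe_eq {n : ℕ} {w : List ℕ} (u : QVertex n) (h : (w : Multiset ℕ) = u.parts) :
    IsValid n w :=
  ⟨fun x hx => parts_pos u (h ▸ Multiset.mem_coe.2 hx), by
    rw [← Multiset.sum_coe, h]
    exact sum_parts_le u⟩

theorem exists_parts_eq {n : ℕ} {w : List ℕ} (hw : IsValid n w) :
    ∃ u : QVertex n, u.parts = (w : Multiset ℕ) :=
  ⟨QVertex.mk w (fun {i} hi => hw.1 i (Multiset.mem_coe.1 hi)) (by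
    rw [Multiset.sum_coe]
    exact hw.2), rfl⟩

theorem IsValid.perm {n : ℕ} {w w' : List ℕ} (h : IsValid n w) (hw : w.Perm w') : IsValid n w' :=
  ⟨fun x hx => h.1 x (hw.mem_iff.2 hx), hw.sum_eq ▸ h.2⟩

theorem contentSpace_le_validSpace {n : ℕ} (u : QVertex n) :
    contentSpace k u.parts ≤ validSpace k n := by
  refine Submodule.span_mono ?_
  rintro _ ⟨w, hw, rfl⟩
  exact ⟨w, isValid_of_coe_eq u hw, rfl⟩

theorem contentProj_sortedSum {n : ℕ} (u : QVertex n) :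
    contentProj k u.parts (sortedSum k n) = word k (sortedWord u) := by
  rw [sortedSum, map_sum, Finset.sum_eq_single u]
  · exact contentProj_of_mem (word_mem_contentSpace (coe_sortedWord u))
  · intro u' _ hu'
    exact contentProj_of_mem_of_ne (fun h => hu' (parts_injective h))
      (word_mem_contentSpace (coe_sortedWord u'))
  · simp

theorem sortedSum_mem {n : ℕ} : sortedSum k n ∈ validSpace k n :=
  Submodule.sum_mem _ fun u _ =>
    Submodule.subset_span ⟨_, isValid_of_coe_eq u (coe_sortedWord u), rfl⟩

theorem orbitMap_mem (x : PathAlgebra k (QVertex 6)) : orbitMap k x ∈ validSpace k 6 := by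
  refine pathAlgebra_induction (P := fun x => orbitMap k x ∈ validSpace k 6) (fun p => ?_) ?_
    (fun x x' hx hx' => ?_) (fun c x hx => ?_) x
  · rw [orbitMap_apply, rep_ofPath]
    exact contentSpace_le_validSpace _ (pathOp_mem p.2.2 _)
  · rw [map_zero]
    exact Submodule.zero_mem _
  · rw [map_add]
    exact Submodule.add_mem _ hx hx'
  · rw [map_smul]
    exact Submodule.smul_mem _ _ hx

theorem word_sortedWord_mem (u : QVertex 6) :
    word k (sortedWord u) ∈ LinearMap.range (orbitMap k) := by
  refine ⟨PathAlgebra.ofPath k ⟨u, u, Quiver.Path.nil⟩, ?_⟩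
  rw [orbitMap_apply, rep_ofPath]
  exact contentProj_sortedSum u

theorem arrowOp_mem_range {u v : QVertex 6} (e : u ⟶ v) {z : WordAlg k ℕ}
    (hz : z ∈ LinearMap.range (orbitMap k)) : arrowOp k e z ∈ LinearMap.range (orbitMap k) := by
  obtain ⟨x, rfl⟩ := hz
  refine ⟨PathAlgebra.ofArrow k e * x, ?_⟩
  rw [orbitMap_apply, rep_mul, rep_ofArrow]
  rfl

theorem lie_mul_word_mem {b c : ℕ} {w : List ℕ} (hw : IsValid 6 (b :: c :: w))
    (h : word k w ∈ LinearMap.range (orbitMap k)) :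
    ⁅word k [b], word k [c]⁆ * word k w ∈ LinearMap.range (orbitMap k) := by
  have key : ∀ {b c : ℕ}, IsValid 6 (b :: c :: w) → b < c →
      ⁅word k [b], word k [c]⁆ * word k w ∈ LinearMap.range (orbitMap k) := by
    intro b c hw hbc
    have hb : 0 < b := hw.1 b (by simp)
    have hsum := hw.2
    rw [List.sum_cons, List.sum_cons] at hsum
    obtain ⟨u, hu⟩ := exists_parts_eq hw
    obtain ⟨v, hv⟩ := exists_parts_eq (n := 6) (w := w)
      ⟨fun x hx => hw.1 x (by simp [hx]), by omega⟩
    have hmem := arrowOp_mem_range (QArrow.first (u := u) (v := v) (7 - b - c - w.sum) b c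
      (by omega) hb hbc (by rw [hv, Multiset.sum_coe]; omega) (by rw [hu, hv]; rfl)) h
    rwa [arrowOp_first (word_mem_contentSpace hv.symm)] at hmem
  rcases lt_trichotomy b c with hbc | rfl | hbc
  · exact key hw hbc
  · rw [Ring.lie_def, sub_self, zero_mul]
    exact Submodule.zero_mem _
  · have := Submodule.neg_mem _ (key (hw.perm (List.Perm.swap _ _ _)) hbc)
    rwa [← neg_mul, Ring.lie_def, neg_sub, ← Ring.lie_def] at this

theorem lie3_self {α : Type*} (a b : α) : lie3 k a b b = 0 := by
  rw [lie3, Ring.lie_def, Ring.lie_def]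
  noncomm_ring

theorem lie3_skew {α : Type*} (a b c : α) : lie3 k a b c = -lie3 k a c b := by
  simp only [lie3, Ring.lie_def]
  noncomm_ring

theorem lie3_jacobi {α : Type*} (a b c : α) : lie3 k a b c = lie3 k c b a - lie3 k b c a := by
  simp only [lie3, Ring.lie_def]
  noncomm_ring

/-- By antisymmetry and the Jacobi identity, every iterated commutator of three letters is a
combination of those which correspond to arrows. -/
theorem mul_lie3_mul_mem {a b c : ℕ} {w₁ w₂ : List ℕ} (hw : IsValid 6 (w₁ ++ [a, b, c] ++ w₂))
    (h : word k (w₁ ++ [a + b + c] ++ w₂) ∈ LinearMap.range (orbitMap k)) :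
    word k w₁ * lie3 k a b c * word k w₂ ∈ LinearMap.range (orbitMap k) := by
  have key : ∀ {a b c : ℕ}, IsValid 6 (w₁ ++ [a, b, c] ++ w₂) → b < c → a ≤ c →
      word k (w₁ ++ [a + b + c] ++ w₂) ∈ LinearMap.range (orbitMap k) →
      word k w₁ * lie3 k a b c * word k w₂ ∈ LinearMap.range (orbitMap k) := by
    intro a b c hw hbc hac h
    have ha : 0 < a := hw.1 a (by simp)
    have hb : 0 < b := hw.1 b (by simp)
    have hsum := hw.2
    simp only [List.sum_append, List.sum_cons, List.sum_nil] at hsum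
    have hperm : (w₁ ++ [a + b + c] ++ w₂).Perm ((a + b + c) :: (w₁ ++ w₂)) := by simp
    have hperm' : (w₁ ++ [a, b, c] ++ w₂).Perm (a :: b :: c :: (w₁ ++ w₂)) := by
      rw [List.append_assoc]
      exact List.perm_append_comm_assoc w₁ [a, b, c] w₂
    obtain ⟨u, hu⟩ := exists_parts_eq hw
    obtain ⟨v, hv⟩ := exists_parts_eq (n := 6) (w := w₁ ++ [a + b + c] ++ w₂)
      ⟨fun x hx => by
        rcases List.mem_cons.1 (hperm.mem_iff.1 hx) with rfl | hx
        · omega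
        · exact hw.1 x (hperm'.mem_iff.2 (by simp [List.mem_append.1 hx])), by
        simp only [List.sum_append, List.sum_cons, List.sum_nil]
        omega⟩
    have hN : ∀ w : List ℕ, w.sum ≤ 2 → a + b + c ∉ w := fun w hw hN => by
      have := List.single_le_sum (fun _ _ => Nat.zero_le _) _ hN
      omega
    have hmem := arrowOp_mem_range (QArrow.other (u := u) (v := v) a b c
      ((w₁ ++ w₂ : List ℕ) : Multiset ℕ) ha hb hbc hac
      (hv.trans (Multiset.coe_eq_coe.2 hperm)) (hu.trans (Multiset.coe_eq_coe.2 hperm'))) h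
    rwa [arrowOp_other (word_mem_contentSpace hv.symm), subst_word k _ (hN _ (by omega))
      (hN _ (by omega))] at hmem
  have hvalid : ∀ l : List ℕ, l.Perm [a, b, c] → IsValid 6 (w₁ ++ l ++ w₂) := fun l hl =>
    hw.perm ((hl.symm.append_left w₁).append_right w₂)
  have hacb : [a, c, b].Perm [a, b, c] := (List.Perm.swap _ _ _).cons _
  have hbac : [b, a, c].Perm [a, b, c] := List.Perm.swap _ _ _
  have hbca : [b, c, a].Perm [a, b, c] := ((List.Perm.swap _ _ _).cons _).trans hbac
  have hcba : [c, b, a].Perm [a, b, c] := (List.Perm.swap _ _ _).trans hbca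
  have hcab : [c, a, b].Perm [a, b, c] := (List.Perm.swap _ _ _).trans hacb
  have e1 : c + b + a = a + b + c := by omega
  have e2 : b + c + a = a + b + c := by omega
  have e3 : a + c + b = a + b + c := by omega
  rcases lt_trichotomy b c with hbc | rfl | hbc
  · rcases le_or_gt a c with hac | hac
    · exact key hw hbc hac h
    · rw [lie3_jacobi, mul_sub, sub_mul]
      exact Submodule.sub_mem _ (key (hvalid _ hcba) (hbc.trans hac) hac.le (e1 ▸ h))
        (key (hvalid _ hbca) hac (hbc.trans hac).le (e2 ▸ h))
  · rw [lie3_self, mul_zero, zero_mul]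
    exact Submodule.zero_mem _
  · rcases le_or_gt a b with hac | hac
    · rw [lie3_skew, mul_neg, neg_mul]
      exact Submodule.neg_mem _ (key (hvalid _ hacb) hbc hac (e3 ▸ h))
    · rw [lie3_jacobi, mul_sub, sub_mul]
      exact Submodule.sub_mem _ (key (hvalid _ hcba) hac (hbc.trans hac).le (e1 ▸ h))
        (key (hvalid _ hbca) (hbc.trans hac) hac.le (e2 ▸ h))

/-- A commutator of two letters inside a word can be moved to the left at the expense of iterated
commutators of three letters. -/
theorem mul_lie_mul_mem {L : ℕ} (hL : ∀ w : List ℕ, IsValid 6 w → w.length < L →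
    word k w ∈ LinearMap.range (orbitMap k)) (p : List ℕ) {b c : ℕ} {y : List ℕ}
    (hw : IsValid 6 (p ++ b :: c :: y)) (hlen : (p ++ b :: c :: y).length = L) :
    word k p * ⁅word k [b], word k [c]⁆ * word k y ∈ LinearMap.range (orbitMap k) := by
  induction p using List.reverseRecOn generalizing y with
  | nil =>
    rw [word_nil, one_mul]
    refine lie_mul_word_mem hw (hL y ⟨fun x hx => hw.1 x (by simp [hx]), ?_⟩ ?_)
    · have := hw.2
      simp only [List.nil_append, List.sum_cons] at this
      omega
    · simp only [List.nil_append, List.length_cons] at hlen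
      omega
  | append_singleton p x ih =>
    have hperm : (p ++ [x] ++ b :: c :: y).Perm (p ++ b :: c :: x :: y) := by
      rw [List.append_assoc]
      refine List.Perm.append_left p ?_
      exact (List.Perm.swap _ _ _).trans ((List.Perm.swap _ _ _).cons _)
    have key : word k (p ++ [x]) * ⁅word k [b], word k [c]⁆ * word k y =
        word k p * lie3 k x b c * word k y +
          word k p * ⁅word k [b], word k [c]⁆ * word k (x :: y) := by
      have hxy : word k (x :: y) = word k [x] * word k y := word_append k [x] y
      rw [hxy, word_append]
      simp only [lie3, Ring.lie_def]
      noncomm_ring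
    rw [key]
    refine Submodule.add_mem _ (mul_lie3_mul_mem (by simpa using hw) (hL _ ⟨?_, ?_⟩ ?_))
      (ih (hw.perm hperm) (hperm.length_eq.symm.trans hlen))
    · intro z hz
      simp only [List.mem_append, List.mem_singleton] at hz
      rcases hz with (hz | rfl) | hz
      · exact hw.1 z (by simp [hz])
      · have := hw.1 x (by simp)
        omega
      · exact hw.1 z (by simp [hz])
    · have := hw.2
      simp only [List.sum_append, List.sum_cons, List.sum_nil] at this ⊢
      omega
    · simp only [List.length_append, List.length_cons, List.length_nil] at hlen ⊢
      omega

/-- Rearranging a word changes it by an element of the orbit, if all shorter words are in the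
orbit. -/
theorem sub_mem_of_perm {L : ℕ} (hL : ∀ w : List ℕ, IsValid 6 w → w.length < L →
    word k w ∈ LinearMap.range (orbitMap k)) {l l' : List ℕ} (h : l.Perm l') (p : List ℕ)
    (hw : IsValid 6 (p ++ l)) (hlen : (p ++ l).length = L) :
    word k (p ++ l) - word k (p ++ l') ∈ LinearMap.range (orbitMap k) := by
  induction h generalizing p with
  | nil =>
    rw [sub_self]
    exact Submodule.zero_mem _
  | cons x _ ih =>
    have := ih (p ++ [x]) (by simpa using hw) (by simpa using hlen)
    simpa using this
  | swap x y l =>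
    have := mul_lie_mul_mem hL p hw hlen
    rw [Ring.lie_def, mul_sub, sub_mul, ← word_append, ← word_append, ← word_append,
      ← word_append, ← word_append, ← word_append] at this
    simpa using this
  | trans h₁ _ ih₁ ih₂ =>
    have h3 := Submodule.add_mem _ (ih₁ p hw hlen) (ih₂ p (hw.perm (h₁.append_left p))
      ((h₁.append_left p).length_eq.symm.trans hlen))
    rwa [sub_add_sub_cancel] at h3

theorem word_mem_range {w : List ℕ} (hw : IsValid 6 w) :
    word k w ∈ LinearMap.range (orbitMap k) := by
  induction hL : w.length using Nat.strong_induction_on generalizing w with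
  | _ L ih =>
    obtain ⟨u, hu⟩ := exists_parts_eq hw
    have hperm : w.Perm (sortedWord u) :=
      Multiset.coe_eq_coe.1 (hu.symm.trans (coe_sortedWord u).symm)
    have h := sub_mem_of_perm (k := k) (fun w' hw' h => ih _ h hw' rfl) hperm [] hw hL
    have h' := Submodule.add_mem _ h (word_sortedWord_mem u)
    rwa [List.nil_append, List.nil_append, sub_add_cancel] at h'

/-- The sum of the sorted words generates the span of all valid words. -/
theorem range_orbitMap : LinearMap.range (orbitMap k) = validSpace k 6 := by
  refine le_antisymm ?_ (Submodule.span_le.2 ?_)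
  · rintro _ ⟨x, rfl⟩
    exact orbitMap_mem x
  · rintro _ ⟨w, hw, rfl⟩
    exact word_mem_range hw

end

end DescentAlg

/-! ### Enumeration of words, vertices, arrows and paths -/

namespace DescentAlg

/-- The words with positive letters and weight at most `s`, if the fuel `m` is at least `s`. -/
def wordList : ℕ → ℕ → List (List ℕ)
  | 0, _ => [[]]
  | m + 1, s => [] :: (List.range s).flatMap fun x => (wordList m (s - (x + 1))).map ((x + 1) :: ·)

theorem mem_wordList {m s : ℕ} (h : s ≤ m) {w : List ℕ} : w ∈ wordList m s ↔ IsValid s w := by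
  induction m generalizing s w with
  | zero =>
    obtain rfl : s = 0 := by omega
    cases w with
    | nil => simp [wordList, IsValid]
    | cons x w =>
      have : ¬ IsValid 0 (x :: w) := fun h => by
        have h1 := h.1 x (by simp)
        have h2 := h.2
        rw [List.sum_cons] at h2
        omega
      simp [wordList, this]
  | succ m ih =>
    cases w with
    | nil => simp [wordList, IsValid]
    | cons x w =>
      simp only [wordList, List.mem_cons, reduceCtorEq, false_or, List.mem_flatMap, List.mem_range,
        List.mem_map, List.cons.injEq]
      constructor
      · rintro ⟨y, hy, w', hw', rfl, rfl⟩
        rw [ih (by omega)] at hw'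
        refine ⟨fun z hz => ?_, ?_⟩
        · rcases List.mem_cons.1 hz with rfl | hz
          · omega
          · exact hw'.1 z hz
        · have := hw'.2
          rw [List.sum_cons]
          omega
      · intro h'
        have h1 := h'.1 x (by simp)
        have h2 := h'.2
        rw [List.sum_cons] at h2
        refine ⟨x - 1, by omega, w, ?_, by omega, rfl⟩
        rw [ih (by omega)]
        exact ⟨fun z hz => h'.1 z (by simp [hz]), by omega⟩

/-- The multisets of parts of the vertices of `Q_n`. -/
def partsFinset (n : ℕ) : Finset (Multiset ℕ) :=
  ((wordList n n).map Multiset.ofList).toFinset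

theorem mem_partsFinset {n : ℕ} {q : Multiset ℕ} :
    q ∈ partsFinset n ↔ ∃ u : QVertex n, u.parts = q := by
  rw [partsFinset, List.mem_toFinset, List.mem_map]
  constructor
  · rintro ⟨w, hw, rfl⟩
    exact exists_parts_eq ((mem_wordList le_rfl).1 hw)
  · rintro ⟨u, rfl⟩
    exact ⟨sortedWord u, (mem_wordList le_rfl).2 (isValid_of_coe_eq u (coe_sortedWord u)),
      coe_sortedWord u⟩

theorem card_vertices : Nat.card (QVertex 6) = 30 := by
  have h1 : Set.range (QVertex.parts (n := 6)) = (partsFinset 6 : Set (Multiset ℕ)) := by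
    ext q
    rw [Finset.mem_coe, mem_partsFinset]
    rfl
  rw [← Set.ncard_univ, ← Set.ncard_image_of_injective _ parts_injective, Set.image_univ, h1,
    Set.ncard_coe_finset]
  decide +kernel

/-- The data of an arrow apart from its ends: the type of the arrow and the labels `a`, `b`, `c`. -/
abbrev ArrowCode : Type := Bool × ℕ × ℕ × ℕ

/-- The data of an arrow apart from its ends. -/
def QArrow.code {n : ℕ} {u v : QVertex n} : QArrow n u v → ArrowCode
  | .first a b c _ _ _ _ _ => (true, a, b, c)
  | .other a b c _ _ _ _ _ _ _ => (false, a, b, c)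

/-- The parts of the source of an arrow, in terms of its code and the parts of its destination. -/
def sourceParts : ArrowCode → Multiset ℕ → Multiset ℕ
  | (true, _, b, c), v => b ::ₘ c ::ₘ v
  | (false, a, b, c), v => a ::ₘ b ::ₘ c ::ₘ v.erase (a + b + c)

/-- The codes of the arrows of `Q_n` to the vertex with parts `v`. -/
def incoming (n : ℕ) (v : Multiset ℕ) : List ArrowCode :=
  ((List.range (n + 1)).product ((List.range (n + 1)).product (List.range (n + 1)))).flatMap
    fun t => (if 0 < t.1 ∧ 0 < t.2.1 ∧ t.2.1 < t.2.2 ∧ t.1 + t.2.1 + t.2.2 + v.sum = n + 1 then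
      [(true, t)] else []) ++
      (if 0 < t.1 ∧ 0 < t.2.1 ∧ t.2.1 < t.2.2 ∧ t.1 ≤ t.2.2 ∧ t.1 + t.2.1 + t.2.2 ∈ v then
        [(false, t)] else [])

theorem QArrow.source_eq {n : ℕ} {u v : QVertex n} (e : QArrow n u v) :
    u.parts = sourceParts e.code v.parts := by
  cases e with
  | first a b c ha hb hbc hvalue hsource => exact hsource
  | other a b c q ha hb hbc hac hdestination hsource =>
    rw [hsource, QArrow.code, sourceParts, hdestination, Multiset.erase_cons_head]

theorem QArrow.code_mem {n : ℕ} {u v : QVertex n} (e : QArrow n u v) :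
    e.code ∈ incoming n v.parts := by
  have hle : ∀ x ∈ u.parts, x < n + 1 := fun x hx =>
    Nat.lt_succ_of_le ((Multiset.single_le_sum (fun _ _ => Nat.zero_le _) _ hx).trans
      (sum_parts_le u))
  rw [incoming, List.mem_flatMap]
  cases e with
  | first a b c ha hb hbc hvalue hsource =>
    refine ⟨(a, b, c), ?_, ?_⟩
    · simp only [List.pair_mem_product, List.mem_range]
      omega
    · rw [if_pos ⟨ha, hb, hbc, hvalue⟩]
      simp [QArrow.code]
  | other a b c q ha hb hbc hac hdestination hsource =>
    refine ⟨(a, b, c), ?_, ?_⟩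
    · simp only [List.pair_mem_product, List.mem_range]
      exact ⟨hle a (by simp [hsource]), hle b (by simp [hsource]), hle c (by simp [hsource])⟩
    · rw [if_pos (c := 0 < a ∧ 0 < b ∧ b < c ∧ a ≤ c ∧ a + b + c ∈ v.parts)
        ⟨ha, hb, hbc, hac, by simp [hdestination]⟩]
      simp [QArrow.code]

theorem exists_arrow_of_mem_incoming {n : ℕ} {v : QVertex n} {t : ArrowCode}
    (ht : t ∈ incoming n v.parts) : ∃ (u : QVertex n) (e : QArrow n u v), e.code = t := by
  have hpos : ∀ {i}, i ∈ v.parts → 0 < i := fun hi => parts_pos v hi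
  have hsum := sum_parts_le v
  rw [incoming, List.mem_flatMap] at ht
  obtain ⟨⟨a, b, c⟩, -, ht⟩ := ht
  rw [List.mem_append] at ht
  rcases ht with ht | ht
  · split_ifs at ht with h
    · obtain rfl := List.mem_singleton.1 ht
      obtain ⟨ha, hb, hbc, hvalue⟩ := h
      refine ⟨QVertex.mk (b ::ₘ c ::ₘ v.parts) ?_ ?_, QArrow.first a b c ha hb hbc hvalue rfl, rfl⟩
      · intro i hi
        rw [Multiset.mem_cons, Multiset.mem_cons] at hi
        rcases hi with rfl | rfl | hi
        · exact hb
        · exact hb.trans hbc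
        · exact hpos hi
      · rw [Multiset.sum_cons, Multiset.sum_cons]
        dsimp only at hvalue ha
        omega
    · exact absurd ht List.not_mem_nil
  · split_ifs at ht with h
    · obtain rfl := List.mem_singleton.1 ht
      obtain ⟨ha, hb, hbc, hac, hmem⟩ := h
      obtain ⟨q, hq⟩ := Multiset.exists_cons_of_mem hmem
      refine ⟨QVertex.mk (a ::ₘ b ::ₘ c ::ₘ q) ?_ ?_,
        QArrow.other a b c q ha hb hbc hac hq rfl, rfl⟩
      · intro i hi
        rw [Multiset.mem_cons, Multiset.mem_cons, Multiset.mem_cons] at hi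
        rcases hi with rfl | rfl | rfl | hi
        · exact ha
        · exact hb
        · exact hb.trans hbc
        · exact hpos (hq ▸ Multiset.mem_cons_of_mem hi)
      · rw [hq, Multiset.sum_cons] at hsum
        rw [Multiset.sum_cons, Multiset.sum_cons, Multiset.sum_cons]
        dsimp only at hsum
        omega
    · exact absurd ht List.not_mem_nil

/-- An arrow is determined by its code and its destination. -/
theorem QArrow.code_injective {n : ℕ} {v : QVertex n} :
    Function.Injective fun x : Σ u : QVertex n, QArrow n u v => x.2.code := by
  rintro ⟨u, e⟩ ⟨u', e'⟩ h
  dsimp only at h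
  obtain rfl : u = u' := parts_injective (by rw [e.source_eq, e'.source_eq, h])
  congr 1
  cases e with
  | first a b c ha hb hbc hvalue hsource =>
    cases e' with
    | first a' b' c' ha' hb' hbc' hvalue' hsource' =>
      simp only [QArrow.code, Prod.mk.injEq, true_and] at h
      obtain ⟨rfl, rfl, rfl⟩ := h
      rfl
    | other a' b' c' q' ha' hb' hbc' hac' hdestination' hsource' => simp [QArrow.code] at h
  | other a b c q ha hb hbc hac hdestination hsource =>
    cases e' with
    | first a' b' c' ha' hb' hbc' hvalue' hsource' => simp [QArrow.code] at h
    | other a' b' c' q' ha' hb' hbc' hac' hdestination' hsource' =>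
      simp only [QArrow.code, Prod.mk.injEq, true_and] at h
      obtain ⟨rfl, rfl, rfl⟩ := h
      obtain rfl : q = q' := (Multiset.cons_inj_right _).1 (hdestination.symm.trans hdestination')
      rfl

theorem card_arrows : Nat.card (Σ u v : QVertex 6, (u ⟶ v)) = 28 := by
  have hinj : Function.Injective fun x : Σ u v : QVertex 6, (u ⟶ v) =>
      (x.2.1.parts, QArrow.code x.2.2) := by
    rintro ⟨u, v, e⟩ ⟨u', v', e'⟩ h
    rw [Prod.mk.injEq] at h
    obtain rfl : v = v' := parts_injective h.1
    have h' := QArrow.code_injective (a₁ := ⟨u, e⟩) (a₂ := ⟨u', e'⟩) h.2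
    rw [Sigma.mk.injEq] at h'
    obtain ⟨rfl, h'⟩ := h'
    rw [eq_of_heq h']
  have hrange : Set.range (fun x : Σ u v : QVertex 6, (u ⟶ v) =>
      (x.2.1.parts, QArrow.code x.2.2)) =
        ((partsFinset 6).biUnion fun q => (incoming 6 q).toFinset.image (Prod.mk q) :
          Finset (Multiset ℕ × ArrowCode)) := by
    ext ⟨q, t⟩
    simp only [Set.mem_range, Finset.coe_biUnion, Set.mem_iUnion, Finset.mem_coe, Finset.mem_image,
      List.mem_toFinset, Prod.mk.injEq, mem_partsFinset]
    constructor
    · rintro ⟨⟨u, v, e⟩, rfl, rfl⟩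
      exact ⟨_, ⟨v, rfl⟩, _, QArrow.code_mem e, rfl, rfl⟩
    · rintro ⟨_, ⟨v, rfl⟩, _, ht, rfl, rfl⟩
      obtain ⟨u, e, he⟩ := exists_arrow_of_mem_incoming ht
      exact ⟨⟨u, v, e⟩, rfl, he⟩
  rw [← Set.ncard_univ, ← Set.ncard_image_of_injective _ hinj, Set.image_univ, hrange,
    Set.ncard_coe_finset, Finset.card_biUnion]
  · have : ∀ q ∈ partsFinset 6, ((incoming 6 q).toFinset.image (Prod.mk q)).card =
        (incoming 6 q).toFinset.card := fun q _ =>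
      Finset.card_image_of_injective _ (Prod.mk_right_injective q)
    rw [Finset.sum_congr rfl this]
    decide +kernel
  · intro q _ q' _ hq
    rw [Function.onFun, Finset.disjoint_left]
    intro x hx hx'
    obtain ⟨t, -, rfl⟩ := Finset.mem_image.1 hx
    obtain ⟨t', -, h⟩ := Finset.mem_image.1 hx'
    exact hq (Prod.mk.inj h).1.symm

/-- The codes of the arrows of a path, the last arrow first. -/
def pathCode {n : ℕ} {u : QVertex n} : ∀ {v : QVertex n}, Quiver.Path u v → List ArrowCode
  | _, .nil => []
  | _, .cons p e => QArrow.code e :: pathCode p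

/-- The codes of the paths of length at most `m` to the vertex with parts `v`. -/
def pathCodes (n : ℕ) : ℕ → Multiset ℕ → List (List ArrowCode)
  | 0, _ => [[]]
  | m + 1, v => [] :: (incoming n v).flatMap fun t => (pathCodes n m (sourceParts t v)).map (t :: ·)

theorem pathCode_mem {n : ℕ} {u v : QVertex n} (p : Quiver.Path u v) {m : ℕ}
    (hm : p.length ≤ m) : pathCode p ∈ pathCodes n m v.parts := by
  induction p generalizing m with
  | nil => cases m <;> simp [pathCode, pathCodes]
  | cons p e ih =>
    cases m with
    | zero => simp at hm
    | succ m =>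
      rw [Quiver.Path.length_cons] at hm
      rw [pathCodes, pathCode, List.mem_cons, List.mem_flatMap]
      refine Or.inr ⟨_, QArrow.code_mem e, List.mem_map_of_mem ?_⟩
      rw [← QArrow.source_eq e]
      exact ih (by omega)

/-- A path is determined by its code and its destination. -/
theorem pathCode_injective {n : ℕ} {u v : QVertex n} (p : Quiver.Path u v) {u' : QVertex n}
    (p' : Quiver.Path u' v) (h : pathCode p = pathCode p') :
    (⟨u, p⟩ : Σ u : QVertex n, Quiver.Path u v) = ⟨u', p'⟩ := by
  induction p with
  | nil =>
    cases p' with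
    | nil => rfl
    | cons p' e' => simp [pathCode] at h
  | cons p e ih =>
    cases p' with
    | nil => simp [pathCode] at h
    | @cons b' _ p' e' =>
      rw [pathCode, pathCode, List.cons.injEq] at h
      have h' := QArrow.code_injective (a₁ := ⟨_, e⟩) (a₂ := ⟨_, e'⟩) h.1
      rw [Sigma.mk.injEq] at h'
      obtain ⟨rfl, h'⟩ := h'
      obtain rfl := eq_of_heq h'
      have h'' := ih p' h.2
      rw [Sigma.mk.injEq] at h''
      obtain ⟨rfl, h''⟩ := h''
      obtain rfl := eq_of_heq h''
      rfl

theorem card_parts_path {n : ℕ} {u v : QVertex n} (p : Quiver.Path u v) :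
    u.parts.card = v.parts.card + 2 * p.length := by
  induction p with
  | nil => simp
  | cons p e ih =>
    rw [ih, Quiver.Path.length_cons]
    change QArrow n _ _ at e
    cases e with
    | first a b c ha hb hbc hvalue hsource =>
      rw [hsource, Multiset.card_cons, Multiset.card_cons]
      ring
    | other a b c q ha hb hbc hac hdestination hsource =>
      rw [hsource, hdestination]
      simp only [Multiset.card_cons]
      ring

theorem length_path_le {n : ℕ} {u v : QVertex n} (p : Quiver.Path u v) : 2 * p.length ≤ n := by
  have h1 := card_parts_path p
  have h2 := Multiset.card_nsmul_le_sum (s := u.parts) (a := 1) fun x hx => parts_pos u hx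
  have h3 := sum_parts_le u
  rw [smul_eq_mul, mul_one] at h2
  omega

/-- The code of a path, together with the parts of its destination. -/
def pathKey {n : ℕ} (p : QuiverPath (QVertex n)) : Multiset ℕ × List ArrowCode :=
  (p.2.1.parts, pathCode p.2.2)

theorem pathKey_injective {n : ℕ} : Function.Injective (pathKey (n := n)) := by
  rintro ⟨u, v, p⟩ ⟨u', v', p'⟩ h
  rw [pathKey, pathKey, Prod.mk.injEq] at h
  obtain rfl : v = v' := parts_injective h.1
  have h' := pathCode_injective p p' h.2
  rw [Sigma.mk.injEq] at h'
  obtain ⟨rfl, h'⟩ := h'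
  rw [eq_of_heq h']

theorem exists_pathKey_finset : ∃ S : Finset (Multiset ℕ × List ArrowCode), S.card ≤ 65 ∧
    ∀ p : QuiverPath (QVertex 6), pathKey p ∈ S := by
  refine ⟨(partsFinset 6).biUnion fun q => (pathCodes 6 3 q).toFinset.image (Prod.mk q), ?_, ?_⟩
  · refine Finset.card_biUnion_le.trans ?_
    have : ∀ q ∈ partsFinset 6, ((pathCodes 6 3 q).toFinset.image (Prod.mk q)).card ≤
        (pathCodes 6 3 q).length := fun q _ =>
      Finset.card_image_le.trans (List.toFinset_card_le _)
    refine (Finset.sum_le_sum this).trans ?_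
    decide +kernel
  · rintro ⟨u, v, p⟩
    have h := length_path_le p
    exact Finset.mem_biUnion.2 ⟨v.parts, mem_partsFinset.2 ⟨v, rfl⟩, Finset.mem_image.2
      ⟨pathCode p, List.mem_toFinset.2 (pathCode_mem p (by omega)), rfl⟩⟩

instance : Finite (QuiverPath (QVertex 6)) := by
  obtain ⟨S, -, hS⟩ := exists_pathKey_finset
  exact Finite.of_injective (fun p => (⟨pathKey p, hS p⟩ : S)) fun p p' h =>
    pathKey_injective (congrArg Subtype.val h)

theorem card_paths_le : Nat.card (QuiverPath (QVertex 6)) ≤ 65 := by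
  obtain ⟨S, hcard, hS⟩ := exists_pathKey_finset
  refine le_trans ?_ hcard
  rw [← Set.ncard_coe_finset, ← Set.ncard_univ]
  exact Set.ncard_le_ncard_of_injOn pathKey (fun p _ => hS p) pathKey_injective.injOn

end DescentAlg

/-! ### The isomorphism -/

namespace DescentAlg

section

variable (k : Type*) [Field k]

/-- The operators extend linearly to the descent algebra. As the elements `x_J` are linearly
independent, the extension can even be chosen on the whole group algebra. -/
theorem exists_faceOp_linear (n : ℕ) :
    ∃ Θ : MonoidAlgebra k (Hyperoctahedral n) →ₗ[k] Module.End k (WordAlg k ℕ),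
      ∀ J, Θ (xElem k (simpleReflection n) J) = faceOp k J := by
  have hli := linearIndependent_xElem (n := n) k
  obtain ⟨Θ, hΘ⟩ := LinearMap.exists_extend ((Module.Basis.span hli).constr k fun J => faceOp k J)
  refine ⟨Θ, fun J => ?_⟩
  have h1 := LinearMap.congr_fun hΘ (Module.Basis.span hli J)
  rw [Module.Basis.constr_basis, LinearMap.comp_apply, Submodule.subtype_apply,
    Module.Basis.span_apply] at h1
  exact h1

variable {k}

theorem validSpace_induction {n : ℕ} {p : WordAlg k ℕ → Prop}
    (hword : ∀ w : List ℕ, IsValid n w → p (word k w)) (hzero : p 0)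
    (hadd : ∀ x y, p x → p y → p (x + y)) (hsmul : ∀ (c : k) (x), p x → p (c • x))
    {z : WordAlg k ℕ} (hz : z ∈ validSpace k n) : p z := by
  refine Submodule.span_induction ?_ hzero (fun x y _ _ => hadd x y) (fun c x _ => hsmul c x) hz
  rintro _ ⟨w, hw, rfl⟩
  exact hword w hw

theorem descentSpan_induction {n : ℕ} {p : MonoidAlgebra k (Hyperoctahedral n) → Prop}
    (hx : ∀ J, p (xElem k (simpleReflection n) J)) (hzero : p 0)
    (hadd : ∀ x y, p x → p y → p (x + y)) (hsmul : ∀ (c : k) (x), p x → p (c • x))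
    (s : descentAlgebra k (simpleReflection n)) : p s := by
  have hs : (s : MonoidAlgebra k (Hyperoctahedral n)) ∈ descentSpan k (simpleReflection n) :=
    toSubmodule_descentAlgebra (n := n) k ▸ s.2
  refine Submodule.span_induction ?_ hzero (fun x y _ _ => hadd x y) (fun c x _ => hsmul c x) hs
  rintro _ ⟨J, rfl⟩
  exact hx J

/-- On valid words the descent algebra acts from the right. -/
theorem faceOp_linear_mul {n : ℕ}
    {Θ : MonoidAlgebra k (Hyperoctahedral n) →ₗ[k] Module.End k (WordAlg k ℕ)}
    (hΘ : ∀ J, Θ (xElem k (simpleReflection n) J) = faceOp k J)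
    (s s' : descentAlgebra k (simpleReflection n)) {z : WordAlg k ℕ} (hz : z ∈ validSpace k n) :
    Θ ((s : MonoidAlgebra k (Hyperoctahedral n)) * s') z = Θ s' (Θ s z) := by
  refine descentSpan_induction (p := fun s =>
    Θ (s * (s' : MonoidAlgebra k (Hyperoctahedral n))) z = Θ s' (Θ s z)) (fun K => ?_) ?_
    (fun x y hx hy => ?_) (fun c x hx => ?_) s
  · refine descentSpan_induction (p := fun s' =>
      Θ (xElem k (simpleReflection n) K * s') z = Θ s' (Θ (xElem k (simpleReflection n) K) z))
      (fun J => ?_) ?_ (fun x y hx hy => ?_) (fun c x hx => ?_) s'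
    · rw [xElem_mul_xElem, hΘ, hΘ, map_sum, LinearMap.sum_apply]
      simp only [map_nsmul, LinearMap.smul_apply, hΘ]
      refine validSpace_induction (p := fun z => ∑ I : Set (Fin n),
        structConst J K I • faceOp k I z = faceOp k J (faceOp k K z))
        (fun w hw => (faceOp_faceOp k J K hw).symm) (by simp) (fun x y hx hy => ?_)
        (fun c x hx => ?_) hz
      · simp only [map_add, smul_add, Finset.sum_add_distrib, hx, hy]
      · simp only [map_smul, ← hx, Finset.smul_sum, smul_comm c]
    · simp
    · simp only [mul_add, map_add, LinearMap.add_apply, hx, hy]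
    · simp only [mul_smul_comm, map_smul, LinearMap.smul_apply, hx]
  · simp
  · simp only [add_mul, map_add, LinearMap.add_apply, hx, hy]
  · simp only [smul_mul_assoc, map_smul, LinearMap.smul_apply, hx]

theorem faceOp_linear_one {n : ℕ}
    {Θ : MonoidAlgebra k (Hyperoctahedral n) →ₗ[k] Module.End k (WordAlg k ℕ)}
    (hΘ : ∀ J, Θ (xElem k (simpleReflection n) J) = faceOp k J)
    (z : WordAlg k ℕ) : Θ 1 z = z := by
  rw [← xElem_univ, hΘ]
  exact LinearMap.congr_fun (wordAlg_hom_ext (g := LinearMap.id) (faceOp_univ k)) z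

theorem faceOp_linear_mem {n : ℕ}
    {Θ : MonoidAlgebra k (Hyperoctahedral n) →ₗ[k] Module.End k (WordAlg k ℕ)}
    (hΘ : ∀ J, Θ (xElem k (simpleReflection n) J) = faceOp k J)
    (s : descentAlgebra k (simpleReflection n)) {z : WordAlg k ℕ} (hz : z ∈ validSpace k n) :
    Θ s z ∈ validSpace k n := by
  refine descentSpan_induction (p := fun s => Θ s z ∈ validSpace k n) (fun J => ?_) ?_
    (fun x y hx hy => ?_) (fun c x hx => ?_) s
  · rw [hΘ]
    refine validSpace_induction (p := fun z => faceOp k J z ∈ validSpace k n) (fun w hw => ?_) ?_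
      (fun x y hx hy => ?_) (fun c x hx => ?_) hz
    · obtain ⟨u, hu⟩ := exists_parts_eq hw
      exact contentSpace_le_validSpace u (hu ▸ faceOp_word_mem J w)
    · simp
    · rw [map_add]
      exact Submodule.add_mem _ hx hy
    · rw [map_smul]
      exact Submodule.smul_mem _ _ hx
  · simp
  · rw [map_add]
    exact Submodule.add_mem _ hx hy
  · rw [map_smul]
    exact Submodule.smul_mem _ _ hx

theorem eq_zero_of_faceOp_linear [CharZero k] {n : ℕ}
    {Θ : MonoidAlgebra k (Hyperoctahedral n) →ₗ[k] Module.End k (WordAlg k ℕ)}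
    (hΘ : ∀ J, Θ (xElem k (simpleReflection n) J) = faceOp k J)
    (s : descentAlgebra k (simpleReflection n))
    (h : ∀ z ∈ validSpace k n, Θ s z = 0) : s = 0 := by
  have hs : (s : MonoidAlgebra k (Hyperoctahedral n)) ∈ descentSpan k (simpleReflection n) :=
    toSubmodule_descentAlgebra (n := n) k ▸ s.2
  obtain ⟨c, hc⟩ := (Submodule.mem_span_range_iff_exists_fun k).1 hs
  have h0 : c = 0 := eq_zero_of_sum_faceOp k fun w hw => by
    have h1 := h (word k w) (Submodule.subset_span ⟨w, hw, rfl⟩)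
    rw [← hc, map_sum, LinearMap.sum_apply] at h1
    simpa only [map_smul, LinearMap.smul_apply, hΘ] using h1
  apply Subtype.ext
  rw [← hc, h0]
  simp

theorem faceOp_linear_rep
    {Θ : MonoidAlgebra k (Hyperoctahedral 6) →ₗ[k] Module.End k (WordAlg k ℕ)}
    (hΘ : ∀ J, Θ (xElem k (simpleReflection 6) J) = faceOp k J)
    (s : descentAlgebra k (simpleReflection 6)) (x : PathAlgebra k (QVertex 6)) (z : WordAlg k ℕ) :
    Θ s (rep k x z) = rep k x (Θ s z) := by
  refine descentSpan_induction (p := fun s => Θ s (rep k x z) = rep k x (Θ s z)) (fun J => ?_) ?_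
    (fun x y hx hy => ?_) (fun c x hx => ?_) s
  · rw [hΘ]
    exact faceOp_rep J x z
  · simp
  · simp only [map_add, LinearMap.add_apply, hx, hy]
  · simp only [map_smul, LinearMap.smul_apply, hx]

variable (k)

theorem finrank_descentAlgebra (n : ℕ) :
    Module.finrank k (descentAlgebra k (simpleReflection n)) = 2 ^ n := by
  classical
  have h1 : Module.finrank k (descentAlgebra k (simpleReflection n)) =
      Module.finrank k (descentSpan k (simpleReflection n)) :=
    congrArg (fun S : Submodule k (MonoidAlgebra k (Hyperoctahedral n)) => Module.finrank k S)
      (toSubmodule_descentAlgebra (n := n) k)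
  rw [h1, descentSpan, finrank_span_eq_card (linearIndependent_xElem k), Fintype.card_set,
    Fintype.card_fin]

theorem validSpace_eq_span (n : ℕ) : validSpace k n =
    Submodule.span k (Set.range fun w : (wordList n n).toFinset => word k w.1) := by
  rw [validSpace]
  congr 1
  ext z
  constructor
  · rintro ⟨w, hw, rfl⟩
    exact ⟨⟨w, List.mem_toFinset.2 ((mem_wordList le_rfl).2 hw)⟩, rfl⟩
  · rintro ⟨⟨w, hw⟩, rfl⟩
    exact ⟨w, (mem_wordList le_rfl).1 (List.mem_toFinset.1 hw), rfl⟩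

instance (n : ℕ) : Module.Finite k (validSpace k n) := by
  rw [validSpace_eq_span]
  exact Module.Finite.span_of_finite k (Set.finite_range _)

theorem finrank_validSpace_le : Module.finrank k (validSpace k 6) ≤ 64 := by
  rw [validSpace_eq_span]
  refine (finrank_range_le_card _).trans ?_
  rw [Fintype.card_coe]
  exact (List.toFinset_card_le _).trans (by decide +kernel)

instance : Module.Finite k (PathAlgebra k (QVertex 6)) :=
  inferInstanceAs (Module.Finite k (QuiverPath (QVertex 6) →₀ k))

theorem finrank_pathAlgebra_le : Module.finrank k (PathAlgebra k (QVertex 6)) ≤ 65 :=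
  (Module.finrank_eq_nat_card_basis (Finsupp.basisSingleOne (R := k)
    (ι := QuiverPath (QVertex 6)))).trans_le card_paths_le

theorem relationQ6_ne_zero : relationQ6 k ≠ 0 := by
  intro h
  rw [relationQ6, sub_eq_zero, PathAlgebra.ofArrow, PathAlgebra.ofArrow, PathAlgebra.ofArrow,
    PathAlgebra.ofArrow, PathAlgebra.ofPath_mul_ofPath, PathAlgebra.ofPath_mul_ofPath,
    PathAlgebra.mulPath_of_comp, PathAlgebra.mulPath_of_comp] at h
  have h1 := congrArg pathKey (Finsupp.single_left_injective (one_ne_zero (α := k)) h)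
  have h2 : ([(true, 1, 1, 5), (false, 2, 1, 2)] : List ArrowCode) =
      [(true, 1, 2, 4), (false, 1, 1, 2)] := (Prod.mk.inj h1).2
  exact absurd h2 (by decide)

/-- The kernel of the action on the sum of the sorted words is spanned by the relation, by a
comparison of dimensions: there are at most `65` paths, and the image has dimension at
least `64`. -/
theorem ker_orbitMap (h : 64 ≤ Module.finrank k (validSpace k 6)) :
    LinearMap.ker (orbitMap k) = Submodule.span k {relationQ6 k} := by
  refine (Submodule.eq_of_le_of_finrank_le ?_ ?_).symm
  · rw [Submodule.span_singleton_le_iff_mem, LinearMap.mem_ker, orbitMap_apply, rep_relationQ6]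
    rfl
  · have h1 := LinearMap.finrank_range_add_finrank_ker (orbitMap k)
    have h2 := finrank_pathAlgebra_le k
    rw [range_orbitMap] at h1
    rw [finrank_span_singleton (relationQ6_ne_zero k)]
    omega

theorem mem_span_relationQ6_iff (h : 64 ≤ Module.finrank k (validSpace k 6))
    (x : PathAlgebra k (QVertex 6)) :
    x ∈ TwoSidedIdeal.span {relationQ6 k} ↔ orbitMap k x = 0 := by
  constructor
  · intro hx
    have hrep : rep k x = 0 := by
      refine TwoSidedIdeal.span_induction (p := fun x _ => rep k x = 0) ?_ ?_ ?_ ?_ ?_ ?_ hx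
      · rintro _ rfl
        exact rep_relationQ6
      · exact map_zero _
      · intro x y _ _ hx hy
        rw [map_add, hx, hy, add_zero]
      · intro x _ hx
        rw [map_neg, hx, neg_zero]
      · intro x y _ hy
        exact LinearMap.ext fun z => by
          rw [rep_mul, hy, LinearMap.zero_apply, map_zero]
      · intro x y _ hx
        exact LinearMap.ext fun z => by
          rw [rep_mul, hx, LinearMap.zero_apply, LinearMap.zero_apply]
    rw [orbitMap_apply, hrep, LinearMap.zero_apply]
  · intro hx
    rw [← LinearMap.mem_ker, ker_orbitMap k h, Submodule.mem_span_singleton] at hx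
    obtain ⟨c, rfl⟩ := hx
    rw [Algebra.smul_def]
    exact TwoSidedIdeal.mul_mem_left _ _ _ (TwoSidedIdeal.subset_span rfl)

theorem orbitMap_one : orbitMap k 1 = sortedSum k 6 := by
  rw [orbitMap_apply, PathAlgebra.one_def, map_sum, LinearMap.sum_apply]
  refine Finset.sum_congr rfl fun u _ => ?_
  rw [rep_ofPath]
  exact contentProj_sortedSum u

/-- An element `s` of the descent algebra corresponds to the class of the elements of the path
algebra which act on the sum of the sorted words in the same way as `s`. -/
theorem nonempty_algEquiv [CharZero k] :
    Nonempty (descentAlgebra k (simpleReflection 6) ≃ₐ[k]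
      (TwoSidedIdeal.span {relationQ6 k}).ringCon.Quotient) := by
  obtain ⟨Θ, hΘ⟩ := exists_faceOp_linear k 6
  let v := sortedSum k 6
  have hv : v ∈ validSpace k 6 := sortedSum_mem
  -- the action of the descent algebra on the generator
  let E : descentAlgebra k (simpleReflection 6) →ₗ[k] validSpace k 6 :=
    { toFun := fun s => ⟨Θ s v, faceOp_linear_mem hΘ s hv⟩
      map_add' := fun s s' => Subtype.ext (by simp)
      map_smul' := fun c s => Subtype.ext (by simp) }
  have hrange : ∀ z ∈ validSpace k 6, ∃ x, orbitMap k x = z := fun z hz => by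
    rwa [← range_orbitMap] at hz
  have hE : Function.Injective E := by
    rw [injective_iff_map_eq_zero]
    intro s hs
    refine eq_zero_of_faceOp_linear hΘ s fun z hz => ?_
    obtain ⟨x, rfl⟩ := hrange z hz
    have hsv : Θ s v = 0 := congrArg Subtype.val hs
    rw [orbitMap_apply, faceOp_linear_rep hΘ, hsv, map_zero]
  have hdim := finrank_descentAlgebra k 6
  have : FiniteDimensional k (descentAlgebra k (simpleReflection 6)) :=
    FiniteDimensional.of_finrank_pos (by omega)
  have hle := LinearMap.finrank_le_finrank_of_injective hE
  have hge := finrank_validSpace_le k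
  have hEs : Function.Surjective E :=
    (LinearMap.injective_iff_surjective_of_finrank_eq_finrank (by omega)).1 hE
  have hI := mem_span_relationQ6_iff k (by omega)
  have hmk (x y : PathAlgebra k (QVertex 6)) :
      (TwoSidedIdeal.span {relationQ6 k}).ringCon.mkₐ k x =
        (TwoSidedIdeal.span {relationQ6 k}).ringCon.mkₐ k y ↔ orbitMap k x = orbitMap k y := by
    rw [← sub_eq_zero (a := orbitMap k x), ← map_sub, ← hI, ← TwoSidedIdeal.rel_iff]
    exact RingCon.eq _
  choose φ hφ using fun s => hrange (E s) (E s).2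
  have hφ' (s) : orbitMap k (φ s) = Θ s v := hφ s
  let Ψ : descentAlgebra k (simpleReflection 6) →ₐ[k]
      (TwoSidedIdeal.span {relationQ6 k}).ringCon.Quotient :=
    AlgHom.ofLinearMap
      { toFun := fun s => (TwoSidedIdeal.span {relationQ6 k}).ringCon.mkₐ k (φ s)
        map_add' := fun s s' => by
          rw [← map_add, hmk, map_add, hφ', hφ', hφ', Subalgebra.coe_add, map_add,
            LinearMap.add_apply]
        map_smul' := fun c s => by
          rw [RingHom.id_apply, ← map_smul, hmk, map_smul, hφ', hφ', Subalgebra.coe_smul, map_smul,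
            LinearMap.smul_apply] }
      (by
        change (TwoSidedIdeal.span {relationQ6 k}).ringCon.mkₐ k (φ 1) = 1
        rw [← map_one ((TwoSidedIdeal.span {relationQ6 k}).ringCon.mkₐ k), hmk, hφ',
          Subalgebra.coe_one, faceOp_linear_one hΘ, orbitMap_one])
      (fun s s' => by
        change (TwoSidedIdeal.span {relationQ6 k}).ringCon.mkₐ k (φ (s * s')) =
          (TwoSidedIdeal.span {relationQ6 k}).ringCon.mkₐ k (φ s) *
            (TwoSidedIdeal.span {relationQ6 k}).ringCon.mkₐ k (φ s')
        rw [← map_mul, hmk, hφ', Subalgebra.coe_mul, faceOp_linear_mul hΘ s s' hv, ← hφ' s,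
          orbitMap_apply, orbitMap_apply, rep_mul, faceOp_linear_rep hΘ]
        exact congrArg (rep k (φ s)) (hφ' s').symm)
  have hΨ (s) : Ψ s = (TwoSidedIdeal.span {relationQ6 k}).ringCon.mkₐ k (φ s) := rfl
  refine ⟨AlgEquiv.ofBijective Ψ ⟨?_, ?_⟩⟩
  · intro s s' h
    rw [hΨ, hΨ, hmk, hφ', hφ'] at h
    exact hE (Subtype.ext h)
  · intro y
    obtain ⟨x, rfl⟩ := RingCon.mkₐ_surjective (α := k) _ y
    obtain ⟨s, hs⟩ := hEs ⟨orbitMap k x, orbitMap_mem x⟩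
    refine ⟨s, ?_⟩
    rw [hΨ, hmk, hφ']
    exact congrArg Subtype.val hs

end

end DescentAlg

theorem mainTheorem8 (k : Type*) [Field k] [CharZero k] :
    Nat.card (DescentAlg.QVertex 6) = 30 ∧
    Nat.card (Σ u v : DescentAlg.QVertex 6, (u ⟶ v)) = 28 ∧
    Subalgebra.toSubmodule
        (DescentAlg.descentAlgebra k (DescentAlg.simpleReflection 6)) =
      DescentAlg.descentSpan k (DescentAlg.simpleReflection 6) ∧
    Nonempty
      (DescentAlg.descentAlgebra k (DescentAlg.simpleReflection 6) ≃ₐ[k]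
        (TwoSidedIdeal.span {DescentAlg.relationQ6 k}).ringCon.Quotient) :=
  ⟨DescentAlg.card_vertices, DescentAlg.card_arrows, DescentAlg.toSubmodule_descentAlgebra k,
    DescentAlg.nonempty_algEquiv k⟩
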